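/- Let $G$ be a finite simple graph on $n$ vertices and $k\ge 0$ an integer. A set $X\subseteq V(G)$ is a feedback vertex set of $G$ if $G-X$ is a forest. Algorithm naive-fvs takes an extended instance $(G,k,F)$, where $F\subseteq V(G)$ induces a forest, and returns a set of vertices or "no"; $d(v)$ is the degree of $v$ in the current graph: 0. if $k<0$, return "no"; if $V(G)=\emptyset$, return $\emptyset$; 1. if a vertex $v$ has degree less than two, return naive-fvs$(G-\{v\},k,F\setminus\{v\})$; 2. if a vertex $v\in V(G)\setminus F$ has two neighbors in the same component of $G[F]$, let $X$ be the result of naive-fvs$(G-\{v\},k-1,F)$ and return $X\cup\{v\}$ ("no" if $X$ is "no"); 3. pick a vertex $v\in V(G)\setminus F$ of maximum degree; 4. if $d(v)=2$: start with $X=\emptyset$; while $G$ contains a cycle $C$, take any vertex $x$ of $C$ outside $F$, add it to $X$ and delete it from $G$; then return $X$ if $|X|\le k$ and "no" otherwise; 5. let $X$ be the result of naive-fvs$(G-\{v\},k-1,F)$; if it is not "no", return $X\cup\{v\}$; 6. return naive-fvs$(G,k,F\cup\{v\})$. The algorithm is called on $(G,k,\emptyset)$ and truncated: on every execution path step 6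 may put at most $3k$ vertices into $F$, and where it would put in one more, "no" is returned instead. A node of the search tree has an entry instance, to which steps 1 and 2 are applied exhaustively; if the algorithm then reaches step 5, the node has the two children with entry instances $(G-\{v\},k-1,F)$ and $(G,k,F\cup\{v\})$, whether or not the second is explored. (A call that is answered "no" at once, because its second argument is negative or because of the truncation, is not counted as a node.) Running times are measured on a random access machine with unit-cost elementary operations (constants, addition, truncated subtraction, indirect addressing, test for zero), with graphs given by adjacency matrices. **Theorem.** (a) For every $n$, $k$ and $G$, and whatever choices are made in steps 1–4, an execution of the truncated algorithm returns a set if and only if $G$ has a feedback vertex set of size at most $k$; the set returned is then such a feedback vertex set. The search tree has depth at most $4k$. (b) There are a constant $C$ and a program, independent of the input, that processes a node of the search tree in at most $C\max(n,1)^2$ steps: given $G$ and an entry instance with nonnegative second argument whose vertex set is a subset of the $n$ vertices of $G$ and whose set $F$ induces a forest, it carries out steps 0–4 and outputs either the answer of the node, or the exit instance, the vertex $v$ to branch on, and the vertices put into the solution by step 2. (c) The truncated algorithm can be implemented in $O(16^k\cdot n^2)$ time: there are a constant $C$ and a program, independent of the input, that on every input $(G,k)$ halts within $C\cdot 16^k\cdot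 \max(n,1)^2$ steps, outputs the result of an execution of the truncated algorithm, and thereby decides whether $G$ has a feedback vertex set of size at most $k$. -/

import Mathlib

namespace NaiveFVS

/-! ### Feedback vertex sets -/

/-- `X` is a feedback vertex set of `G`: the graph `G - X` is a forest. -/
def IsFVS {n : ℕ} (G : SimpleGraph (Fin n)) (X : Finset (Fin n)) : Prop :=
  (G.induce {v | v ∉ X}).IsAcyclic

/-! ### The branching algorithm -/

/-- An extended instance `(H, k, F)`, where `H` is the subgraph induced by `V` in an ambient graph,
together with the number `b` of vertices that may still be put into `F` by branching. -/
structure Inst (n : ℕ) where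
  V : Finset (Fin n)
  k : ℤ
  F : Finset (Fin n)
  b : ℕ

namespace Inst

variable {n : ℕ}

/-- The initial instance `(G, k, ∅)`; at most `3k` vertices may be put into `F`. -/
def root (n k : ℕ) : Inst n := ⟨Finset.univ, k, ∅, 3 * k⟩

/-- The set `F` consists of vertices of the graph and induces a forest. -/
def Valid (G : SimpleGraph (Fin n)) (I : Inst n) : Prop :=
  I.F ⊆ I.V ∧ (G.induce {v | v ∈ I.F}).IsAcyclic

open Classical in
/-- The degree of `v` in the current graph. -/
noncomputable def deg (G : SimpleGraph (Fin n)) (I : Inst n) (v : Fin n) : ℕ :=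
  (I.V.filter (fun w => G.Adj v w)).card

/-- `v` is a vertex of degree less than two. -/
def Low (G : SimpleGraph (Fin n)) (I : Inst n) (v : Fin n) : Prop :=
  v ∈ I.V ∧ I.deg G v < 2

/-- `v` is a vertex outside `F` with two neighbors in the same component of `G[F]`. -/
def Forced (G : SimpleGraph (Fin n)) (I : Inst n) (v : Fin n) : Prop :=
  v ∈ I.V \ I.F ∧ ∃ (x y : Fin n) (hx : x ∈ I.F) (hy : y ∈ I.F),
    x ≠ y ∧ G.Adj v x ∧ G.Adj v y ∧
      (G.induce {w | w ∈ I.F}).Reachable ⟨x, hx⟩ ⟨y, hy⟩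

/-- `v` is a vertex outside `F` with the maximum degree among such vertices. -/
def Greedy (G : SimpleGraph (Fin n)) (I : Inst n) (v : Fin n) : Prop :=
  v ∈ I.V \ I.F ∧ ∀ w ∈ I.V \ I.F, I.deg G w ≤ I.deg G v

/-- `(G - {v}, k, F \ {v})` -/
def discard (I : Inst n) (v : Fin n) : Inst n := ⟨I.V.erase v, I.k, I.F.erase v, I.b⟩

/-- `(G - {v}, k - 1, F)` -/
def take (I : Inst n) (v : Fin n) : Inst n := ⟨I.V.erase v, I.k - 1, I.F, I.b⟩

/-- `(G, k, F ∪ {v})` -/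
def keep (I : Inst n) (v : Fin n) : Inst n := ⟨I.V, I.k, insert v I.F, I.b - 1⟩

end Inst

/-- `CycleLoop G V F X`: starting from the subgraph induced by `V`, repeatedly choosing a cycle and
deleting one of its vertices that is not in `F`, until no cycle is left, may delete exactly `X`. -/
inductive CycleLoop {n : ℕ} (G : SimpleGraph (Fin n)) :
    Finset (Fin n) → Finset (Fin n) → Finset (Fin n) → Prop
  | done (V F : Finset (Fin n)) (h : (G.induce {v | v ∈ V}).IsAcyclic) : CycleLoop G V F ∅
  | step (V F X : Finset (Fin n)) (x : Fin n) (hx : x ∉ F)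
      (hc : ∃ c : G.Walk x x, c.IsCycle ∧ ∀ y ∈ c.support, y ∈ V)
      (h : CycleLoop G (V.erase x) F X) : CycleLoop G V F (insert x X)

/-- What the processing of a search-tree node ends with. -/
inductive Outcome (n : ℕ) where
  /-- The node is a leaf and answers "no" (`none`) or returns a set. -/
  | answer (r : Option (Finset (Fin n)))
  /-- The node branches on `v` in the exit instance `E`; the vertices in `D` have been put into
  the solution on the way from the entry instance to `E`. -/
  | branch (D : Finset (Fin n)) (E : Inst n) (v : Fin n)

/-- Add a vertex to the solution ("no" stays "no"). -/
def Outcome.addVertex {n : ℕ} (v : Fin n) : Outcome n → Outcome n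
  | .answer r => .answer (r.map (insert v))
  | .branch D E w => .branch (insert v D) E w

/-- Steps 0-4 of the algorithm, with all choices left open: `NodeRun G I o` says that the node with
entry instance `I` may have the outcome `o`. An earlier step has priority over a later one. -/
inductive NodeRun {n : ℕ} (G : SimpleGraph (Fin n)) : Inst n → Outcome n → Prop
  /-- step 0: the number `k` is negative -/
  | neg (I : Inst n) (hk : I.k < 0) : NodeRun G I (.answer none)
  /-- step 0: the graph is empty -/
  | empty (I : Inst n) (hk : 0 ≤ I.k) (hV : I.V = ∅) : NodeRun G I (.answer (some ∅))
  /-- step 1: discard a vertex of degree less than two -/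
  | low (I : Inst n) (v : Fin n) (o : Outcome n) (hk : 0 ≤ I.k) (hv : I.Low G v)
      (h : NodeRun G (I.discard v) o) : NodeRun G I o
  /-- step 2: take a vertex that forms a cycle with vertices of `F` -/
  | forced (I : Inst n) (v : Fin n) (o : Outcome n) (hk : 0 ≤ I.k) (h1 : ∀ w, ¬ I.Low G w)
      (hv : I.Forced G v) (h : NodeRun G (I.take v) o) : NodeRun G I (o.addVertex v)
  /-- steps 3 and 4: the maximum degree outside `F` is two -/
  | cycles (I : Inst n) (v : Fin n) (X : Finset (Fin n)) (hk : 0 ≤ I.k) (h1 : ∀ w, ¬ I.Low G w)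
      (h2 : ∀ w, ¬ I.Forced G w) (hv : I.Greedy G v) (hd : I.deg G v = 2)
      (hX : CycleLoop G I.V I.F X) :
      NodeRun G I (.answer (if (X.card : ℤ) ≤ I.k then some X else none))
  /-- step 3: the vertex picked has a degree other than two, so the algorithm branches on it -/
  | branch (I : Inst n) (v : Fin n) (hk : 0 ≤ I.k) (h1 : ∀ w, ¬ I.Low G w)
      (h2 : ∀ w, ¬ I.Forced G w) (hv : I.Greedy G v) (hd : I.deg G v ≠ 2) :
      NodeRun G I (.branch ∅ I v)

/-- The truncated algorithm, with all choices left open: called on `I`, it may return `r`, where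
`none` stands for "no". -/
inductive Run {n : ℕ} (G : SimpleGraph (Fin n)) : Inst n → Option (Finset (Fin n)) → Prop
  | leaf (I : Inst n) (r : Option (Finset (Fin n))) (h : NodeRun G I (.answer r)) : Run G I r
  /-- step 5: the call with `v` in the solution succeeds -/
  | taken (I E : Inst n) (D X : Finset (Fin n)) (v : Fin n) (h : NodeRun G I (.branch D E v))
      (h5 : Run G (E.take v) (some X)) : Run G I (some (D ∪ insert v X))
  /-- step 6: the call with `v` in the solution fails, and `v` is put into `F` -/
  | kept (I E : Inst n) (D : Finset (Fin n)) (v : Fin n) (r : Option (Finset (Fin n)))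
      (h : NodeRun G I (.branch D E v)) (h5 : Run G (E.take v) none) (hb : 0 < E.b)
      (h6 : Run G (E.keep v) r) : Run G I (r.map (D ∪ ·))
  /-- truncation: no further vertex may be put into `F` -/
  | cut (I E : Inst n) (D : Finset (Fin n)) (v : Fin n) (h : NodeRun G I (.branch D E v))
      (h5 : Run G (E.take v) none) (hb : E.b = 0) : Run G I none

/-- `SearchNode G R d I`: the instance `I` may be the entry instance of a node at depth `d` of the
search tree with root instance `R`. Both children of a branching node belong to the tree, whether
explored or not; a call that is answered "no" at once, because it would start with a negative `k`
or because the truncation forbids it, is not a node. -/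
inductive SearchNode {n : ℕ} (G : SimpleGraph (Fin n)) (R : Inst n) : ℕ → Inst n → Prop
  | root : SearchNode G R 0 R
  | taken (d : ℕ) (I E : Inst n) (D : Finset (Fin n)) (v : Fin n) (hI : SearchNode G R d I)
      (h : NodeRun G I (.branch D E v)) (hk : 0 ≤ (E.take v).k) : SearchNode G R (d + 1) (E.take v)
  | kept (d : ℕ) (I E : Inst n) (D : Finset (Fin n)) (v : Fin n) (hI : SearchNode G R d I)
      (h : NodeRun G I (.branch D E v)) (hb : 0 < E.b) : SearchNode G R (d + 1) (E.keep v)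

/-! ### Random access machines with unit cost

Programs over natural-number registers and arrays, with constants, addition, truncated subtraction
and indirect addressing, but without multiplication. Every elementary operation takes one step. -/

/-- A memory state: registers, and arrays indexed by natural numbers. -/
structure Mem where
  reg : ℕ → ℕ
  arr : ℕ → ℕ → ℕ

/-- Expressions. -/
inductive Expr where
  | const (c : ℕ)
  | reg (x : ℕ)
  | get (a : ℕ) (i : Expr)
  | add (e f : Expr)
  | sub (e f : Expr)

/-- The value of an expression. -/
def Expr.eval (m : Mem) : Expr → ℕ
  | .const c => c
  | .reg x => m.reg x
  | .get a i => m.arr a (i.eval m)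
  | .add e f => e.eval m + f.eval m
  | .sub e f => e.eval m - f.eval m

/-- The number of steps needed to evaluate an expression: one for every operation in it. -/
def Expr.cost : Expr → ℕ
  | .const _ => 1
  | .reg _ => 1
  | .get _ i => i.cost + 1
  | .add e f => e.cost + f.cost + 1
  | .sub e f => e.cost + f.cost + 1

/-- Programs; the conditions of `cond` and `loop` are "the expression is not zero". -/
inductive Prog where
  | skip
  | assign (x : ℕ) (e : Expr)
  | store (a : ℕ) (i e : Expr)
  | seq (p q : Prog)
  | cond (e : Expr) (p q : Prog)
  | loop (e : Expr) (p : Prog)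

/-- `x := c` -/
def Mem.setReg (m : Mem) (x c : ℕ) : Mem := ⟨Function.update m.reg x c, m.arr⟩

/-- `a[i] := c` -/
def Mem.setArr (m : Mem) (a i c : ℕ) : Mem :=
  ⟨m.reg, Function.update m.arr a (Function.update (m.arr a) i c)⟩

/-- `Exec p m t m'`: started in the state `m`, the program `p` halts after exactly `t` steps, in the
state `m'`. -/
inductive Exec : Prog → Mem → ℕ → Mem → Prop
  | skip (m : Mem) : Exec .skip m 1 m
  | assign (x : ℕ) (e : Expr) (m : Mem) :
      Exec (.assign x e) m (e.cost + 1) (m.setReg x (e.eval m))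
  | store (a : ℕ) (i e : Expr) (m : Mem) :
      Exec (.store a i e) m (i.cost + e.cost + 1) (m.setArr a (i.eval m) (e.eval m))
  | seq (p q : Prog) (m m' m'' : Mem) (s t : ℕ) (hp : Exec p m s m') (hq : Exec q m' t m'') :
      Exec (.seq p q) m (s + t) m''
  | condTrue (e : Expr) (p q : Prog) (m m' : Mem) (t : ℕ) (he : e.eval m ≠ 0)
      (hp : Exec p m t m') : Exec (.cond e p q) m (e.cost + 1 + t) m'
  | condFalse (e : Expr) (p q : Prog) (m m' : Mem) (t : ℕ) (he : e.eval m = 0)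
      (hq : Exec q m t m') : Exec (.cond e p q) m (e.cost + 1 + t) m'
  | loopTrue (e : Expr) (p : Prog) (m m' m'' : Mem) (s t : ℕ) (he : e.eval m ≠ 0)
      (hp : Exec p m s m') (hl : Exec (.loop e p) m' t m'') :
      Exec (.loop e p) m (e.cost + 1 + s + t) m''
  | loopFalse (e : Expr) (p : Prog) (m : Mem) (he : e.eval m = 0) :
      Exec (.loop e p) m (e.cost + 1) m

/-! ### Input and output conventions -/

open Classical in
/-- The entries `0, …, n - 1` of array `a` are the characteristic vector of `X`. -/
def HoldsSet {n : ℕ} (m : Mem) (a : ℕ) (X : Finset (Fin n)) : Prop :=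
  ∀ v : Fin n, m.arr a v = if v ∈ X then 1 else 0

open Classical in
/-- Register 0 holds `n` and array 0 holds the adjacency matrix of `G`, row by row. -/
def HoldsGraph {n : ℕ} (m : Mem) (G : SimpleGraph (Fin n)) : Prop :=
  m.reg 0 = n ∧ ∀ u v : Fin n, m.arr 0 (u * n + v) = if G.Adj u v then 1 else 0

/-- Register 1 holds `k`, and arrays 1 and 2 hold the vertex set and the set `F`. -/
def HoldsInst {n : ℕ} (m : Mem) (I : Inst n) : Prop :=
  (m.reg 1 : ℤ) = I.k ∧ HoldsSet m 1 I.V ∧ HoldsSet m 2 I.F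

/-- Register 2 holds `0` for "no"; otherwise it holds `1`, and array 3 holds the set returned. -/
def HoldsAnswer {n : ℕ} (m : Mem) : Option (Finset (Fin n)) → Prop
  | none => m.reg 2 = 0
  | some X => m.reg 2 = 1 ∧ HoldsSet m 3 X

/-- Either an answer, or `2` in register 2, the branching vertex in register 3, the vertices put
into the solution in array 3, and the exit instance in the same place as the entry instance. -/
def HoldsOutcome {n : ℕ} (m : Mem) : Outcome n → Prop
  | .answer r => HoldsAnswer m r
  | .branch D E v => m.reg 2 = 2 ∧ m.reg 3 = v ∧ HoldsSet m 3 D ∧ HoldsInst m E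

end NaiveFVS

/-! Most of the correctness is bookkeeping: a vertex of degree less than two lies on no cycle, a
vertex to which step 2 applies belongs to every solution that avoids `F`, and steps 5 and 6 try both
possibilities for `v`. Two points carry weight.

Step 4. Here all vertices outside `F` have degree at most two, and then deleting any such vertex `x`
of any cycle is optimal: by `CycleIn.exchange`, a feedback vertex set `Y` avoiding `F` yields a
smaller one for the graph without `x`. If `x ∉ Y`, some `y ∈ Y` can be given up in exchange for `x`;
otherwise every `y ∈ Y` would have both its neighbors in one component of the forest left by `Y` and
`x`, a cycle through `x` could be rerouted around `Y`, and `Y` would miss it. Hence the loop finds a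
smallest solution (`CycleLoop.card_le`).

Truncation. A vertex put into `F` when its degree is `d` receives the weight `1 / (d - 2)`, and the
potential is the sum of weight times `degree - 2`, with a debit at the full rate `W`, a bound on all
weights, for degrees below two. The invariant `Chargeable` says that the potential is at least `3k -
b`, where `b` is the remaining budget: discarding a vertex does not lower the potential
(`Chargeable.discard`), taking one costs at most `3` (`Chargeable.take`), and keeping one gains `1`
(`Chargeable.keep`). On the other hand, if all degrees are at least two, a solution `X` bounds the
potential by `3 |X|`, since the rest is a forest and so has few edges (`Chargeable.le_three_mul`).
When the budget is exhausted, a solution of size at most `k` that avoids `v` would thus give `3k + 1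
≤ 3k`.

Depth and time. The sum `k + b` is `4k` at the root and drops at every branching, so the tree has
depth at most `4k`, and the search makes `O(2 ^ (4k)) = O(16 ^ k)` iterations (`run_spec`). A node
takes quadratic time because degrees are updated in linear time per deletion, while the vertices to
which step 2 applies are computed only once: reductions do not change this property for the
remaining vertices (`Inst.Low.forced_discard_iff`, `forced_take_iff`). Component labels and the set
of step 4 both come from growing a forest vertex by vertex (`grow_spec`). Programs are written in a
language of bounded loops, whose running time is read off from the syntax (`Cmd.exec`). -/

namespace NaiveFVS

/-! ### Forests and connectivity inside a set of vertices -/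

section Graph

variable {n : ℕ} {G : SimpleGraph (Fin n)} {S T : Finset (Fin n)} {u v x y : Fin n}

/-- The set `S` induces a forest. -/
def AcyclicOn (G : SimpleGraph (Fin n)) (S : Finset (Fin n)) : Prop :=
  (G.induce {v | v ∈ S}).IsAcyclic

/-- A walk inside `S` leads from `x` to `y`. -/
def ConnOn (G : SimpleGraph (Fin n)) (S : Finset (Fin n)) (x y : Fin n) : Prop :=
  ∃ p : G.Walk x y, ∀ z ∈ p.support, z ∈ S

/-- A cycle through `x` lies in `S`. -/
def CycleIn (G : SimpleGraph (Fin n)) (S : Finset (Fin n)) (x : Fin n) : Prop :=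
  ∃ c : G.Walk x x, c.IsCycle ∧ ∀ y ∈ c.support, y ∈ S

open Classical in
/-- The number of neighbors of `v` in `S`. -/
noncomputable def degIn (G : SimpleGraph (Fin n)) (S : Finset (Fin n)) (v : Fin n) : ℕ :=
  (S.filter (fun w => G.Adj v w)).card

/-- Passing from cycles over a subtype to cycles of `G` supported in `S` lets the vertex set vary
without transporting walks. -/
theorem acyclicOn_iff : AcyclicOn G S ↔ ∀ x, ¬ CycleIn G S x := by
  constructor
  · rintro h x ⟨c, hc, hS⟩
    refine h (c.induce {v | v ∈ S} hS) ?_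
    rw [← SimpleGraph.Walk.isCycle_map_iff_of_injective
      (f := (SimpleGraph.Embedding.induce {v | v ∈ S}).toHom) Subtype.val_injective]
    rwa [SimpleGraph.Walk.map_induce]
  · intro h x c hc
    refine h x.1 ⟨c.map (SimpleGraph.Embedding.induce {v | v ∈ S}).toHom, ?_, ?_⟩
    · exact hc.map Subtype.val_injective
    · intro y hy
      obtain ⟨z, -, rfl⟩ := List.mem_map.1 ((SimpleGraph.Walk.support_map _ c) ▸ hy)
      exact z.2

theorem CycleIn.mono (h : CycleIn G S x) (hST : S ⊆ T) : CycleIn G T x := by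
  obtain ⟨c, hc, hS⟩ := h
  exact ⟨c, hc, fun y hy => hST (hS y hy)⟩

theorem CycleIn.mem (h : CycleIn G S x) : x ∈ S := by
  obtain ⟨c, hc, hS⟩ := h
  exact hS x c.start_mem_support

theorem AcyclicOn.mono (h : AcyclicOn G T) (hST : S ⊆ T) : AcyclicOn G S :=
  acyclicOn_iff.2 fun x hx => acyclicOn_iff.1 h x (hx.mono hST)

theorem acyclicOn_empty : AcyclicOn G ∅ :=
  acyclicOn_iff.2 fun x hx => by simpa using hx.mem

theorem ConnOn.refl (hx : x ∈ S) : ConnOn G S x x := ⟨.nil, by simpa using hx⟩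

theorem ConnOn.symm (h : ConnOn G S x y) : ConnOn G S y x := by
  obtain ⟨p, hp⟩ := h
  exact ⟨p.reverse, by simpa using hp⟩

theorem ConnOn.trans {z : Fin n} (h : ConnOn G S x y) (h' : ConnOn G S y z) : ConnOn G S x z := by
  obtain ⟨p, hp⟩ := h
  obtain ⟨q, hq⟩ := h'
  exact ⟨p.append q, fun z hz => ((SimpleGraph.Walk.mem_support_append_iff _ _).1 hz).elim (hp z) (hq z)⟩

theorem ConnOn.mono (h : ConnOn G S x y) (hST : S ⊆ T) : ConnOn G T x y := by
  obtain ⟨p, hp⟩ := h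
  exact ⟨p, fun z hz => hST (hp z hz)⟩

theorem ConnOn.left (h : ConnOn G S x y) : x ∈ S := h.elim fun p hp => hp x p.start_mem_support

theorem ConnOn.right (h : ConnOn G S x y) : y ∈ S := h.elim fun p hp => hp y p.end_mem_support

theorem ConnOn.of_adj (h : G.Adj x y) (hx : x ∈ S) (hy : y ∈ S) : ConnOn G S x y :=
  ⟨h.toWalk, by simp [hx, hy]⟩

/-- A map that sends edges inside `T` to connected pairs of `S` preserves connectivity. -/
theorem ConnOn.map (f : Fin n → Fin n) (hf : ∀ a ∈ T, f a ∈ S)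
    (hadj : ∀ a ∈ T, ∀ b ∈ T, G.Adj a b → ConnOn G S (f a) (f b)) (h : ConnOn G T x y) :
    ConnOn G S (f x) (f y) := by
  obtain ⟨p, hp⟩ := h
  induction p with
  | nil => exact ConnOn.refl (hf _ (hp _ (by simp)))
  | cons h p ih =>
    have h2 : ∀ z ∈ p.support, z ∈ T := fun z hz => hp z (by simp [hz])
    exact (hadj _ (hp _ (by simp)) _ (h2 _ p.start_mem_support) h).trans (ih h2)

theorem connOn_iff_reachable (hx : x ∈ S) (hy : y ∈ S) :
    ConnOn G S x y ↔ (G.induce {w | w ∈ S}).Reachable ⟨x, hx⟩ ⟨y, hy⟩ := by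
  constructor
  · rintro ⟨p, hp⟩
    exact ⟨p.induce {w | w ∈ S} hp⟩
  · rintro ⟨p⟩
    refine ⟨p.map (SimpleGraph.Embedding.induce {v | v ∈ S}).toHom, fun z hz => ?_⟩
    obtain ⟨w, -, rfl⟩ := List.mem_map.1 ((SimpleGraph.Walk.support_map _ p) ▸ hz)
    exact w.2

/-- A neighbor of `y ≠ x` on a walk from `x` to `y`. -/
theorem ConnOn.exists_adj (h : ConnOn G S x y) (hxy : x ≠ y) : ∃ z ∈ S, G.Adj x z := by
  obtain ⟨p, hp⟩ := h
  cases p with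
  | nil => exact absurd rfl hxy
  | cons h p => exact ⟨_, hp _ (by simp), h⟩

/-- With its converse `CycleIn.exists_connOn`, this reduces questions about cycles through `u` to
connectivity without `u`. The walk is shortened to a path, which avoids `u` because `S` does; two
distinct edges at `u` close it. -/
theorem CycleIn.of_connOn (hu : u ∉ S) (hxy : x ≠ y) (hx : G.Adj u x) (hy : G.Adj u y)
    (h : ConnOn G S x y) : CycleIn G (insert u S) u := by
  classical
  obtain ⟨p, hp⟩ := h
  have hpu : u ∉ p.toPath.1.support := fun h => hu (hp _ (p.support_toPath_subset_support h))
  refine ⟨.cons hx (p.toPath.1.concat hy.symm), ?_, ?_⟩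
  · rw [SimpleGraph.Walk.cons_isCycle_iff]
    refine ⟨p.toPath.2.concat hpu _, ?_⟩
    rw [SimpleGraph.Walk.edges_concat, List.concat_eq_append, List.mem_append]
    rintro (h | h)
    · exact hpu (p.toPath.1.fst_mem_support_of_mem_edges h)
    · rw [List.mem_singleton, Sym2.eq_iff] at h
      rcases h with ⟨h1, -⟩ | ⟨-, h2⟩
      · exact hy.ne h1
      · exact hxy h2
  · intro z hz
    rw [SimpleGraph.Walk.support_cons, SimpleGraph.Walk.support_concat] at hz
    simp only [List.mem_cons, List.mem_append, List.not_mem_nil,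
      or_false] at hz
    rcases hz with rfl | h | rfl
    · simp
    · exact Finset.mem_insert_of_mem (hp _ (p.support_toPath_subset_support h))
    · simp

/-- A cycle through `u` enters and leaves `u` by distinct neighbors that are connected elsewhere. -/
theorem CycleIn.exists_connOn (h : CycleIn G S u) :
    ∃ x y, x ≠ y ∧ G.Adj u x ∧ G.Adj u y ∧ ConnOn G (S.erase u) x y := by
  obtain ⟨c, hc, hS⟩ := h
  cases c with
  | nil => simp at hc
  | @cons _ x _ hx p =>
    rw [SimpleGraph.Walk.cons_isCycle_iff] at hc
    obtain ⟨hp, he⟩ := hc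
    -- Reversal turns the last edge of the cycle into the first edge of `q`, where `cases` exposes
    -- the second neighbor of `u`.
    obtain ⟨q, hq⟩ : ∃ q, q = p.reverse := ⟨_, rfl⟩
    have hqp : q.IsPath := hq ▸ hp.reverse
    have hqe : s(u, x) ∉ q.edges := by simpa [hq] using he
    have hqS : ∀ z ∈ q.support, z ∈ S := fun z hz => hS z (by
      rw [hq, SimpleGraph.Walk.support_reverse, List.mem_reverse] at hz
      simp [hz])
    clear hq
    cases q with
    | nil => exact absurd rfl hx.ne
    | @cons _ y _ hy q =>
      rw [SimpleGraph.Walk.cons_isPath_iff] at hqp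
      refine ⟨y, x, ?_, hy, hx, q, fun z hz => ?_⟩
      · rintro rfl
        simp at hqe
      · refine Finset.mem_erase.2 ⟨?_, hqS z (by simp [hz])⟩
        rintro rfl
        exact hqp.2 hz

/-- A cycle avoiding `u` would survive in `S.erase u`; so it passes through `u` and may be started
there. Thus only cycles through the vertex just added need attention. -/
theorem CycleIn.rotate (h : CycleIn G S x) (hx : ¬ CycleIn G (S.erase u) x) : CycleIn G S u := by
  classical
  obtain ⟨c, hc, hS⟩ := h
  by_cases hu : u ∈ c.support
  · exact ⟨c.rotate u hu, hc.rotate hu, fun y hy => hS y (by simpa using hy)⟩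
  · refine absurd ⟨c, hc, fun y hy => Finset.mem_erase.2 ⟨?_, hS y hy⟩⟩ hx
    rintro rfl
    exact hu hy

theorem AcyclicOn.insert (h : AcyclicOn G S)
    (hu : ∀ x ∈ S, ∀ y ∈ S, x ≠ y → G.Adj u x → G.Adj u y → ¬ ConnOn G S x y) :
    AcyclicOn G (insert u S) := by
  rw [acyclicOn_iff] at h ⊢
  intro x hx
  have hsub : (Insert.insert u S).erase u ⊆ S := Finset.erase_insert_subset u S
  obtain ⟨a, b, hab, ha, hb, hc⟩ := (hx.rotate (u := u) fun h' => h x (h'.mono hsub)).exists_connOn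
  have hc := hc.mono hsub
  exact hu a hc.left b hc.right hab ha hb hc

theorem AcyclicOn.of_erase (h : AcyclicOn G (S.erase u)) (hu : ¬ CycleIn G S u) :
    AcyclicOn G S := by
  rw [acyclicOn_iff] at h ⊢
  exact fun x hx => hu (hx.rotate (h x))

theorem degIn_mono (h : S ⊆ T) : degIn G S v ≤ degIn G T v :=
  by classical exact Finset.card_le_card (Finset.filter_subset_filter _ h)

theorem two_le_degIn (hxy : x ≠ y) (hx : x ∈ S) (hy : y ∈ S) (hvx : G.Adj v x) (hvy : G.Adj v y) :
    2 ≤ degIn G S v := by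
  classical
  rw [← Finset.card_pair hxy]
  refine Finset.card_le_card fun z hz => ?_
  rcases Finset.mem_insert.1 hz with rfl | hz
  · simp [hx, hvx]
  · rw [Finset.mem_singleton.1 hz]
    simp [hy, hvy]

theorem CycleIn.two_le_degIn (h : CycleIn G S u) : 2 ≤ degIn G S u := by
  obtain ⟨x, y, hxy, hx, hy, hc⟩ := h.exists_connOn
  exact NaiveFVS.two_le_degIn hxy (Finset.mem_of_mem_erase hc.left)
    (Finset.mem_of_mem_erase hc.right) hx hy

/-- Deleting a vertex with at most one neighbor does not disconnect the others. -/
theorem ConnOn.erase (h : ConnOn G S x y) (hd : degIn G S v < 2) (hx : x ≠ v) (hy : y ≠ v) :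
    ConnOn G (S.erase v) x y := by
  classical
  by_cases hv : ∃ w ∈ S, G.Adj v w
  · obtain ⟨w, hwS, hvw⟩ := hv
    have huniq : ∀ z ∈ S, G.Adj v z → z = w := fun z hz hvz => by
      by_contra hzw
      exact absurd (NaiveFVS.two_le_degIn hzw hz hwS hvz hvw) (by omega)
    have hw : w ∈ S.erase v := Finset.mem_erase.2 ⟨hvw.ne', hwS⟩
    -- Retract `v` to its only neighbor `w`: a passage through `v` enters and leaves by `w`, so it
    -- becomes a pause at `w`.
    have := ConnOn.map (S := S.erase v) (fun z => if z = v then w else z) (fun a ha => ?_)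
      (fun a ha b hb hab => ?_) h
    · simpa [hx, hy] using this
    · split_ifs with hav
      · exact hw
      · exact Finset.mem_erase.2 ⟨hav, ha⟩
    · split_ifs with hav hbv hbv
      · exact ConnOn.refl hw
      · rw [huniq b hb (hav ▸ hab)]
        exact ConnOn.refl hw
      · rw [huniq a ha (hbv ▸ hab.symm)]
        exact ConnOn.refl hw
      · exact ConnOn.of_adj hab (Finset.mem_erase.2 ⟨hav, ha⟩) (Finset.mem_erase.2 ⟨hbv, hb⟩)
  · push Not at hv
    by_cases hxy : x = y
    · subst hxy
      exact ConnOn.refl (Finset.mem_erase.2 ⟨hx, h.left⟩)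
    · obtain ⟨w, hw, hxw⟩ := h.exists_adj hxy
      have hxm : x ∈ S.erase v := Finset.mem_erase.2 ⟨hx, h.left⟩
      -- Without neighbors in `S`, the vertex `v` is on no edge there; its image is arbitrary as
      -- long as it lies in `S.erase v`.
      have := ConnOn.map (S := S.erase v) (fun z => if z = v then x else z) (fun a ha => ?_)
        (fun a ha b hb hab => ?_) h
      · simpa [hx, hy] using this
      · split_ifs with hav
        · exact hxm
        · exact Finset.mem_erase.2 ⟨hav, ha⟩
      · have hav : a ≠ v := by
          rintro rfl
          exact hv b hb hab
        have hbv : b ≠ v := by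
          rintro rfl
          exact hv a ha hab.symm
        simp only [hav, hbv, if_false]
        exact ConnOn.of_adj hab (Finset.mem_erase.2 ⟨hav, ha⟩) (Finset.mem_erase.2 ⟨hbv, hb⟩)

/-- Take an end of a longest path: by maximality its neighbors lie on the path, and in a forest only
the next vertex of the path can be one of them. -/
theorem AcyclicOn.exists_degIn_lt_two (h : AcyclicOn G S) (hS : S.Nonempty) :
    ∃ v ∈ S, degIn G S v < 2 := by
  classical
  obtain ⟨v₀, hv₀⟩ := hS
  have : Nonempty {v | v ∈ S} := ⟨⟨v₀, hv₀⟩⟩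
  obtain ⟨a, b, p, hp, hmax⟩ :=
    SimpleGraph.Walk.exists_isPath_forall_isPath_length_le_length (G.induce {v | v ∈ S})
  refine ⟨a.1, a.2, ?_⟩
  have key : ∀ w : {v | v ∈ S}, G.Adj a.1 w.1 → w = p.snd := fun w hw => by
    have hw' : (G.induce {v | v ∈ S}).Adj a w := hw
    by_cases hws : w ∈ p.support
    · exact h.eq_snd_of_adj_start hp hw' hws
    · have := hmax _ _ (.cons hw'.symm p) (hp.cons hws)
      simp at this
  refine Nat.lt_succ_of_le (Finset.card_le_one.2 fun x hx y hy => ?_)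
  rw [Finset.mem_filter] at hx hy
  exact congrArg Subtype.val ((key ⟨x, hx.1⟩ hx.2).trans (key ⟨y, hy.1⟩ hy.2).symm)

open Classical in
theorem degIn_insert (hu : u ∉ S) :
    degIn G (insert u S) v = degIn G S v + if G.Adj v u then 1 else 0 := by
  unfold degIn
  rw [Finset.filter_insert]
  split_ifs with h
  · rw [Finset.card_insert_of_notMem (by simp [hu])]
  · simp

theorem degIn_insert_self : degIn G (insert v S) v = degIn G S v := by
  classical
  unfold degIn
  rw [Finset.filter_insert, if_neg (G.loopless.irrefl v)]

theorem sum_adj_eq_degIn [DecidableRel G.Adj] :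
    ∑ w ∈ S, (if G.Adj v w then 1 else 0) = degIn G S v := by
  unfold degIn
  rw [Finset.card_filter]
  exact Finset.sum_congr rfl fun w _ => by congr

/-- A forest has at most as many edges as vertices. -/
theorem AcyclicOn.sum_degIn_le (h : AcyclicOn G S) : ∑ v ∈ S, degIn G S v ≤ 2 * S.card := by
  classical
  induction hk : S.card generalizing S with
  | zero => simp [Finset.card_eq_zero.1 hk]
  | succ k ih =>
    obtain ⟨v, hv, hd⟩ := h.exists_degIn_lt_two (Finset.card_pos.1 (by omega))
    have hc : (S.erase v).card = k := by rw [Finset.card_erase_of_mem hv]; omega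
    have ih := ih (h.mono (Finset.erase_subset v S)) hc
    have hd' : degIn G (S.erase v) v = degIn G S v := by
      conv_rhs => rw [← Finset.insert_erase hv, degIn_insert_self]
    -- Deleting `v` lowers the degree sum by `degIn G S v` at the neighbors and by as much at `v`
    -- itself, hence by at most `2`.
    have hsum : ∑ w ∈ S.erase v, degIn G S w
        = ∑ w ∈ S.erase v, degIn G (S.erase v) w + degIn G S v := by
      rw [← hd', ← sum_adj_eq_degIn (v := v), ← Finset.sum_add_distrib]
      refine Finset.sum_congr rfl fun w hw => ?_
      conv_lhs => rw [← Finset.insert_erase hv, degIn_insert (Finset.notMem_erase v S)]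
      simp only [G.adj_comm]
    rw [← Finset.add_sum_erase S _ hv, hsum]
    omega

end Graph

/-! ### Cycles through vertices of degree two -/

section Graph

variable {n : ℕ} {G : SimpleGraph (Fin n)} {V F S X Y : Finset (Fin n)} {u v x y : Fin n}

theorem eq_or_eq_of_degIn_le_two {p q z : Fin n} (hd : degIn G V v ≤ 2) (hpq : p ≠ q) (hp : p ∈ V)
    (hq : q ∈ V) (hvp : G.Adj v p) (hvq : G.Adj v q) (hz : z ∈ V) (hvz : G.Adj v z) :
    z = p ∨ z = q := by
  classical
  by_contra! h
  have h3 : ({p, q, z} : Finset (Fin n)).card = 3 := by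
    rw [Finset.card_eq_three]
    exact ⟨p, q, z, hpq, h.1.symm, h.2.symm, rfl⟩
  have : ({p, q, z} : Finset (Fin n)).card ≤ degIn G V v := Finset.card_le_card fun w hw => by
    simp only [Finset.mem_insert, Finset.mem_singleton] at hw
    rcases hw with rfl | rfl | rfl <;> simp [*]
  omega

/-- If all vertices that may be deleted have degree at most two, then any such vertex on a cycle
can be exchanged for some vertex of a given feedback vertex set. -/
theorem CycleIn.exchange (hx : CycleIn G V x) (hxF : x ∉ F)
    (hd : ∀ u ∈ V \ F, degIn G V u ≤ 2) (hY : Y ⊆ V \ F) (hac : AcyclicOn G (V \ Y)) :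
    ∃ Y' ⊆ V.erase x \ F, AcyclicOn G (V.erase x \ Y') ∧ Y'.card < Y.card := by
  have hxV := hx.mem
  by_cases hxY : x ∈ Y
  · refine ⟨Y.erase x, ?_, ?_, Finset.card_erase_lt_of_mem hxY⟩
    · intro z hz
      have := hY (Finset.mem_of_mem_erase hz)
      simp only [Finset.mem_sdiff, Finset.mem_erase] at this hz ⊢
      tauto
    · refine hac.mono fun z hz => ?_
      simp only [Finset.mem_sdiff, Finset.mem_erase] at hz ⊢
      tauto
  · obtain ⟨y, hy, hyac⟩ : ∃ y ∈ Y, AcyclicOn G (V.erase x \ Y.erase y) := by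
      -- If no exchange works, restoring any `y ∈ Y` to the forest on `V.erase x \ Y` closes a
      -- cycle, so `y` has two neighbors `p y` and `q y` connected in that forest. As its degree is
      -- at most two, these are all its neighbors in `V`; in particular none is `x` or in `Y`.
      by_contra! hcon
      have hR : AcyclicOn G (V.erase x \ Y) :=
        hac.mono (Finset.sdiff_subset_sdiff (Finset.erase_subset x V) subset_rfl)
      have hpair : ∀ y ∈ Y, ∃ p q, p ≠ q ∧ G.Adj y p ∧ G.Adj y q ∧
          ConnOn G (V.erase x \ Y) p q := by
        intro y hy
        by_contra! hno
        refine hcon y hy ((hR.insert (u := y) fun p _ q _ hpq hp hq =>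
          hno p q hpq hp hq).mono fun z hz => ?_)
        simp only [Finset.mem_sdiff, Finset.mem_erase, Finset.mem_insert] at hz ⊢
        tauto
      choose! p q hpq hp hq hc using hpair
      have hmem : ∀ z, z ∈ V.erase x \ Y → z ∈ V ∧ z ≠ x ∧ z ∉ Y := fun z hz => by
        simp only [Finset.mem_sdiff, Finset.mem_erase] at hz
        tauto
      have hnbr : ∀ y ∈ Y, ∀ z ∈ V, G.Adj y z →
          ConnOn G (V.erase x \ Y) (p y) z := fun y hy z hz hyz => by
        rcases eq_or_eq_of_degIn_le_two (hd y (hY hy)) (hpq y hy) (hmem _ (hc y hy).left).1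
          (hmem _ (hc y hy).right).1 (hp y hy) (hq y hy) hz hyz with rfl | rfl
        · exact ConnOn.refl (hc y hy).left
        · exact hc y hy
      obtain ⟨a, b, hab, ha, hb, habc⟩ := hx.exists_connOn
      have hnot : ∀ a, G.Adj x a → a ∉ Y := fun a ha haY =>
        (hmem _ (hnbr a haY x hxV ha.symm).right).2.1 rfl
      -- Reroute the rest of the cycle by replacing each of its vertices `z ∈ Y` with `p z`. The two
      -- neighbors of `x` are then connected in the forest, and `x` closes a cycle in `V \ Y`.
      have := ConnOn.map (S := V.erase x \ Y) (fun z => if z ∈ Y then p z else z)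
        (fun z hz => ?_) (fun z hz w hw hzw => ?_) habc
      · simp only [hnot a ha, hnot b hb, if_false] at this
        refine acyclicOn_iff.1 hac x ((CycleIn.of_connOn (by simp) hab ha hb this).mono ?_)
        intro z hz
        simp only [Finset.mem_sdiff, Finset.mem_erase, Finset.mem_insert] at hz ⊢
        rcases hz with rfl | hz
        · exact ⟨hxV, hxY⟩
        · tauto
      · split_ifs with h
        · exact (hc z h).left
        · exact Finset.mem_sdiff.2 ⟨hz, h⟩
      · have hzV := Finset.mem_of_mem_erase hz
        have hwV := Finset.mem_of_mem_erase hw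
        split_ifs with h h' h'
        · exact absurd h' (hmem _ (hnbr z h w hwV hzw).right).2.2
        · exact hnbr z h w hwV hzw
        · exact (hnbr w h' z hzV hzw.symm).symm
        · exact ConnOn.of_adj hzw (Finset.mem_sdiff.2 ⟨hz, h⟩) (Finset.mem_sdiff.2 ⟨hw, h'⟩)
    refine ⟨Y.erase y, ?_, hyac, Finset.card_erase_lt_of_mem hy⟩
    intro z hz
    have hzY := Finset.mem_of_mem_erase hz
    have := hY hzY
    have hzx : z ≠ x := fun h => hxY (h ▸ hzY)
    simp only [Finset.mem_sdiff, Finset.mem_erase] at this ⊢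
    tauto

theorem CycleLoop.sound (h : CycleLoop G V F X) : X ⊆ V ∧ AcyclicOn G (V \ X) := by
  induction h with
  | done V F h => exact ⟨Finset.empty_subset _, by rw [Finset.sdiff_empty]; exact h⟩
  | step V F X x hx hc h ih =>
    obtain ⟨h1, h2⟩ := ih
    refine ⟨Finset.insert_subset (CycleIn.mem hc) (h1.trans (Finset.erase_subset _ _)), ?_⟩
    refine h2.mono fun z hz => ?_
    simp only [Finset.mem_sdiff, Finset.mem_erase, Finset.mem_insert] at hz ⊢
    tauto

/-- By `CycleIn.exchange`, each deletion made by the loop leaves a strictly smaller competitor for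
the remaining graph; the degree bound is inherited by subgraphs. -/
theorem CycleLoop.card_le (h : CycleLoop G V F X) (hd : ∀ u ∈ V \ F, degIn G V u ≤ 2)
    (hY : Y ⊆ V \ F) (hac : AcyclicOn G (V \ Y)) : X.card ≤ Y.card := by
  induction h generalizing Y with
  | done V F h => simp
  | step V F X x hx hc h ih =>
    obtain ⟨Y', hY', hac', hlt⟩ := CycleIn.exchange hc hx hd hY hac
    refine (Finset.card_insert_le _ _).trans (lt_of_le_of_lt (ih (fun u hu => ?_) hY' hac') hlt)
    exact (degIn_mono (Finset.erase_subset _ _)).trans (hd u (Finset.sdiff_subset_sdiff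
      (Finset.erase_subset _ _) subset_rfl hu))

end Graph

/-! ### The potential -/

section Potential

variable {n : ℕ} {G : SimpleGraph (Fin n)} {V F X : Finset (Fin n)} {v x : Fin n}

/-- The contribution of a vertex of weight `a` and degree `d` to the potential. -/
def charge (W a : ℚ) (d : ℕ) : ℚ := if 2 ≤ d then a * (d - 2) else W * (d - 2)

/-- The potential of the subgraph induced by `V`. -/
noncomputable def potential (G : SimpleGraph (Fin n)) (V : Finset (Fin n)) (w : Fin n → ℚ)
    (W : ℚ) : ℚ := ∑ v ∈ V, charge W (w v) (degIn G V v)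

/-- The vertices of `F` can be given weights, zero outside `F`, such that the potential is at least
`s`; weights are small in comparison with the degrees of the vertices outside `F`. -/
def Chargeable (G : SimpleGraph (Fin n)) (V F : Finset (Fin n)) (s : ℚ) : Prop :=
  ∃ (w : Fin n → ℚ) (W : ℚ), W ≤ 1 ∧ (∀ v, 0 ≤ w v ∧ w v ≤ W) ∧ (∀ v ∈ V \ F, w v = 0) ∧
    (∀ v ∈ V \ F, W * ((degIn G V v : ℚ) - 2) ≤ 1) ∧ 0 ≤ W ∧ s ≤ potential G V w W

/-- As a function of the degree, the charge has slope `W` up to degree two and slope `a ≤ W` from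
there on; both formulas vanish at two. -/
theorem charge_succ_le {W a : ℚ} (h1 : a ≤ W) (d : ℕ) :
    charge W a (d + 1) ≤ charge W a d + W := by
  unfold charge
  split_ifs with h h' h'
  · push_cast; linarith
  · obtain rfl : d = 1 := by omega
    norm_num
  · omega
  · push_cast; linarith

theorem charge_zero_le {W : ℚ} (hW : 0 ≤ W) (d : ℕ) : charge W 0 d ≤ 0 := by
  unfold charge
  split_ifs with h
  · simp
  · have : (d : ℚ) ≤ 2 := by exact_mod_cast (by omega : d ≤ 2)
    nlinarith

theorem degIn_erase_add [DecidableRel G.Adj] (hx : x ∈ V) :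
    degIn G V v = degIn G (V.erase x) v + if G.Adj v x then 1 else 0 := by
  conv_lhs => rw [← Finset.insert_erase hx, degIn_insert (Finset.notMem_erase x V)]
  congr

theorem degIn_erase_self : degIn G (V.erase x) x = degIn G V x := by
  by_cases hx : x ∈ V
  · conv_rhs => rw [← Finset.insert_erase hx, degIn_insert_self]
  · rw [Finset.erase_eq_of_notMem hx]

/-- The charge of `x` disappears, and each neighbor loses one unit of degree, worth at most `W`. -/
theorem potential_erase {w : Fin n → ℚ} {W : ℚ} (hw : ∀ v, 0 ≤ w v ∧ w v ≤ W) (hx : x ∈ V) :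
    potential G V w W
      ≤ potential G (V.erase x) w W + charge W (w x) (degIn G V x) + W * degIn G V x := by
  classical
  have h : ∑ v ∈ V.erase x, charge W (w v) (degIn G V v)
      ≤ ∑ v ∈ V.erase x, charge W (w v) (degIn G (V.erase x) v) + W * degIn G V x := by
    rw [← degIn_erase_self, ← sum_adj_eq_degIn, Nat.cast_sum, Finset.mul_sum,
      ← Finset.sum_add_distrib]
    refine Finset.sum_le_sum fun v hv => ?_
    rw [degIn_erase_add hx, G.adj_comm]
    split_ifs
    · simpa using charge_succ_le (hw v).2 _
    · simp
  unfold potential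
  rw [← Finset.add_sum_erase V _ hx]
  linarith

/-- For a vertex of degree `d ≤ 1`, the charge `W * (d - 2)` that vanishes and the loss of at most
`W * d` at the neighbors add up to `W * (2 * d - 2) ≤ 0`. The debit at the full rate `W` for low
degrees serves this purpose. -/
theorem Chargeable.discard {s : ℚ} (h : Chargeable G V F s) (hx : x ∈ V) (hd : degIn G V x < 2) :
    Chargeable G (V.erase x) (F.erase x) s := by
  obtain ⟨w, W, hW, hw, h0, hle, hW0, hs⟩ := h
  have hsub : V.erase x \ F.erase x ⊆ V \ F := fun z hz => by
    simp only [Finset.mem_sdiff, Finset.mem_erase] at hz ⊢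
    tauto
  refine ⟨w, W, hW, hw, fun v hv => h0 v (hsub hv), fun v hv => ?_, hW0, ?_⟩
  · refine le_trans ?_ (hle v (hsub hv))
    have : (degIn G (V.erase x) v : ℚ) ≤ degIn G V v := by
      exact_mod_cast degIn_mono (Finset.erase_subset _ _)
    gcongr
  · refine hs.trans ((potential_erase hw hx).trans ?_)
    have : (degIn G V x : ℚ) ≤ 1 := by exact_mod_cast (by omega : degIn G V x ≤ 1)
    rw [charge, if_neg (by omega)]
    nlinarith

theorem mul_le_three {W d : ℚ} (hW : W ≤ 1) (h : W * (d - 2) ≤ 1) : W * d ≤ 3 := by linarith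

/-- A vertex outside `F` has weight zero and so no positive charge; its neighbors lose at most `W *
d ≤ 1 + 2 * W ≤ 3`. This is the origin of the factor in the budget `3k`. -/
theorem Chargeable.take {s : ℚ} (h : Chargeable G V F s) (hx : x ∈ V \ F) :
    Chargeable G (V.erase x) F (s - 3) := by
  obtain ⟨w, W, hW, hw, h0, hle, hW0, hs⟩ := h
  have hsub : V.erase x \ F ⊆ V \ F :=
    Finset.sdiff_subset_sdiff (Finset.erase_subset _ _) subset_rfl
  refine ⟨w, W, hW, hw, fun v hv => h0 v (hsub hv), fun v hv => ?_, hW0, ?_⟩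
  · refine le_trans ?_ (hle v (hsub hv))
    have : (degIn G (V.erase x) v : ℚ) ≤ degIn G V v := by
      exact_mod_cast degIn_mono (Finset.erase_subset _ _)
    gcongr
  · have h1 := potential_erase (G := G) hw (Finset.mem_sdiff.1 hx).1
    have h2 := mul_le_three hW (hle x hx)
    have h3 := charge_zero_le hW0 (degIn G V x)
    rw [h0 x hx] at h1
    linarith

/-- Both the weight of `x` and `W` become `1 / (d - 2)`, where `d` is the degree of `x`, so `x` now
contributes exactly `1`. The old constraint at `x` says that `W` does not decrease, and the
maximality of `d` gives the new constraints. The other charges do not depend on `W`, since all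
degrees are at least two. -/
theorem Chargeable.keep {s : ℚ} (h : Chargeable G V F s) (hx : x ∈ V \ F)
    (hlow : ∀ v ∈ V, 2 ≤ degIn G V v) (hd : 3 ≤ degIn G V x)
    (hmax : ∀ v ∈ V \ F, degIn G V v ≤ degIn G V x) : Chargeable G V (insert x F) (s + 1) := by
  obtain ⟨w, W, hW, hw, h0, hle, hW0, hs⟩ := h
  have hd' : (1 : ℚ) ≤ degIn G V x - 2 := by
    have : (3 : ℚ) ≤ degIn G V x := by exact_mod_cast hd
    linarith
  have hpos : (0 : ℚ) < degIn G V x - 2 := by linarith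
  have hWle : W ≤ 1 / (degIn G V x - 2) := (le_div_iff₀ hpos).2 (hle x hx)
  have hinv : (0 : ℚ) ≤ 1 / (degIn G V x - 2) := by positivity
  have hsub : V \ insert x F ⊆ V \ F :=
    Finset.sdiff_subset_sdiff subset_rfl (Finset.subset_insert _ _)
  refine ⟨Function.update w x (1 / (degIn G V x - 2)), 1 / (degIn G V x - 2), ?_, fun v => ?_,
    fun v hv => ?_, fun v hv => ?_, hinv, ?_⟩
  · rw [div_le_one hpos]
    exact hd'
  · by_cases hv : v = x
    · subst hv
      simpa using hpos.le
    · rw [Function.update_of_ne hv]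
      exact ⟨(hw v).1, (hw v).2.trans hWle⟩
  · rw [Function.update_of_ne]
    · exact h0 v (hsub hv)
    · rintro rfl
      simp at hv
  · rw [div_mul_eq_mul_div, one_mul, div_le_one hpos]
    have : (degIn G V v : ℚ) ≤ degIn G V x := by exact_mod_cast hmax v (hsub hv)
    linarith
  · have hxV := (Finset.mem_sdiff.1 hx).1
    unfold potential at hs ⊢
    rw [← Finset.add_sum_erase V _ hxV] at hs ⊢
    rw [h0 x hx, charge, if_pos (by omega)] at hs
    have hsum : ∑ v ∈ V.erase x, charge (1 / ((degIn G V x : ℚ) - 2))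
        (Function.update w x (1 / ((degIn G V x : ℚ) - 2)) v) (degIn G V v)
        = ∑ v ∈ V.erase x, charge W (w v) (degIn G V v) := by
      refine Finset.sum_congr rfl fun v hv => ?_
      rw [Function.update_of_ne (Finset.ne_of_mem_erase hv), charge, charge,
        if_pos (hlow v (Finset.mem_of_mem_erase hv)), if_pos (hlow v (Finset.mem_of_mem_erase hv))]
    rw [hsum, Function.update_self, charge, if_pos (by omega), one_div,
      inv_mul_cancel₀ hpos.ne']
    linarith

/-- The sum of the degrees of the vertices that remain in a forest. -/
theorem AcyclicOn.sum_degIn_sdiff_le (hX : X ⊆ V) (hac : AcyclicOn G (V \ X)) :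
    ∑ v ∈ V \ X, degIn G V v ≤ 2 * (V \ X).card + ∑ x ∈ X, degIn G V x := by
  classical
  have h1 : ∀ v, degIn G V v = degIn G (V \ X) v + degIn G X v := fun v => by
    rw [← sum_adj_eq_degIn, ← sum_adj_eq_degIn, ← sum_adj_eq_degIn, Finset.sum_sdiff hX]
  have h2 : ∑ v ∈ V \ X, degIn G X v = ∑ x ∈ X, degIn G (V \ X) x := by
    simp_rw [← sum_adj_eq_degIn]
    rw [Finset.sum_comm]
    simp only [G.adj_comm]
  -- Edges within the forest contribute at most `2 * (V \ X).card`; every other edge is counted at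
  -- its end in `X`.
  calc ∑ v ∈ V \ X, degIn G V v
      = ∑ v ∈ V \ X, degIn G (V \ X) v + ∑ v ∈ V \ X, degIn G X v := by
        rw [← Finset.sum_add_distrib]
        exact Finset.sum_congr rfl fun v _ => h1 v
    _ ≤ _ := by
        rw [h2]
        exact add_le_add hac.sum_degIn_le
          (Finset.sum_le_sum fun x _ => degIn_mono Finset.sdiff_subset)

/-- Vertices of `X` have weight zero and all others at most `W`, so the potential is at most `W`
times the sum of `d - 2` over `V \ X`. As `V \ X` induces a forest, that sum is at most the degree
sum over `X`, and `W * d ≤ 3` for each vertex of `X`. -/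
theorem Chargeable.le_three_mul {s : ℚ} (h : Chargeable G V F s)
    (hlow : ∀ v ∈ V, 2 ≤ degIn G V v) (hX : X ⊆ V \ F) (hac : AcyclicOn G (V \ X)) :
    s ≤ 3 * X.card := by
  obtain ⟨w, W, hW, hw, h0, hle, hW0, hs⟩ := h
  have hXV : X ⊆ V := hX.trans Finset.sdiff_subset
  have hsum : ((∑ v ∈ V \ X, degIn G V v : ℕ) : ℚ)
      ≤ ((2 * (V \ X).card + ∑ x ∈ X, degIn G V x : ℕ) : ℚ) := by
    exact_mod_cast hac.sum_degIn_sdiff_le hXV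
  push_cast at hsum
  have hp : potential G V w W ≤ W * ∑ v ∈ V \ X, ((degIn G V v : ℚ) - 2) := by
    unfold potential
    rw [← Finset.sum_sdiff hXV, Finset.mul_sum]
    have hz : ∑ x ∈ X, charge W (w x) (degIn G V x) ≤ 0 :=
      Finset.sum_nonpos fun x hx => by
        rw [h0 x (hX hx)]
        exact charge_zero_le hW0 _
    have : ∑ v ∈ V \ X, charge W (w v) (degIn G V v)
        ≤ ∑ v ∈ V \ X, W * ((degIn G V v : ℚ) - 2) := by
      refine Finset.sum_le_sum fun v hv => ?_
      have hv2 := hlow v (Finset.mem_sdiff.1 hv).1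
      rw [charge, if_pos hv2]
      have : (2 : ℚ) ≤ degIn G V v := by exact_mod_cast hv2
      exact mul_le_mul_of_nonneg_right (hw v).2 (by linarith)
    linarith
  have hX3 : W * ∑ x ∈ X, (degIn G V x : ℚ) ≤ 3 * X.card := by
    rw [Finset.mul_sum]
    refine (Finset.sum_le_card_nsmul X _ 3 fun x hx => mul_le_three hW (hle x (hX hx))).trans ?_
    rw [nsmul_eq_mul, mul_comm]
  rw [Finset.sum_sub_distrib, Finset.sum_const, nsmul_eq_mul] at hp
  have : W * ((∑ v ∈ V \ X, (degIn G V v : ℚ)) - (V \ X).card * 2)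
      ≤ W * ∑ x ∈ X, (degIn G V x : ℚ) := mul_le_mul_of_nonneg_left (by linarith) hW0
  linarith

end Potential

/-! ### Correctness of the algorithm -/

section Correctness

variable {n : ℕ} {G : SimpleGraph (Fin n)} {I E : Inst n} {D X : Finset (Fin n)} {v : Fin n}

/-- `X` solves the instance `I`. -/
def Solves (G : SimpleGraph (Fin n)) (I : Inst n) (X : Finset (Fin n)) : Prop :=
  I.F ⊆ I.V ∧ X ⊆ I.V \ I.F ∧ AcyclicOn G (I.V \ X) ∧ (X.card : ℤ) ≤ I.k

/-- The potential of the instance accounts for the vertices put into `F` so far. -/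
def Inst.Charged (G : SimpleGraph (Fin n)) (I : Inst n) : Prop :=
  Chargeable G I.V I.F (3 * I.k - I.b)

theorem forced_iff : I.Forced G v ↔ v ∈ I.V \ I.F ∧
    ∃ x y, x ≠ y ∧ G.Adj v x ∧ G.Adj v y ∧ ConnOn G I.F x y := by
  constructor
  · rintro ⟨hv, x, y, hx, hy, hxy, hvx, hvy, h⟩
    exact ⟨hv, x, y, hxy, hvx, hvy, (connOn_iff_reachable hx hy).2 h⟩
  · rintro ⟨hv, x, y, hxy, hvx, hvy, h⟩
    exact ⟨hv, x, y, h.left, h.right, hxy, hvx, hvy, (connOn_iff_reachable _ _).1 h⟩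

theorem Inst.Forced.cycleIn (h : I.Forced G v) : CycleIn G (insert v I.F) v := by
  obtain ⟨hv, x, y, hxy, hvx, hvy, h⟩ := forced_iff.1 h
  exact CycleIn.of_connOn (Finset.mem_sdiff.1 hv).2 hxy hvx hvy h

/-- A vertex of degree less than two lies on no cycle, so restoring it creates none. -/
theorem Inst.Low.acyclicOn (hv : I.Low G v) (h : AcyclicOn G (I.V.erase v \ X)) :
    AcyclicOn G (I.V \ X) := by
  refine AcyclicOn.of_erase (u := v) ?_ fun hc => ?_
  · rwa [Finset.erase_sdiff_comm] at h
  · exact absurd (hc.two_le_degIn.trans (degIn_mono Finset.sdiff_subset)) (not_le.2 hv.2)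

theorem Inst.Low.solves (h : Solves G I X) : Solves G (I.discard v) (X.erase v) := by
  obtain ⟨hF, hX, hac, hk⟩ := h
  refine ⟨Finset.erase_subset_erase _ hF, fun z hz => ?_, hac.mono fun z hz => ?_,
    le_trans ?_ hk⟩
  · have := hX (Finset.mem_of_mem_erase hz)
    simp only [Inst.discard, Finset.mem_sdiff, Finset.mem_erase] at this hz ⊢
    tauto
  · simp only [Inst.discard, Finset.mem_sdiff, Finset.mem_erase] at hz ⊢
    tauto
  · exact_mod_cast Finset.card_erase_le

theorem Solves.take (h : Solves G I X) (hv : v ∈ X) : Solves G (I.take v) (X.erase v) := by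
  obtain ⟨hF, hX, hac, hk⟩ := h
  have hvF := (Finset.mem_sdiff.1 (hX hv)).2
  refine ⟨fun z hz => Finset.mem_erase.2 ⟨fun h => hvF (h ▸ hz), hF hz⟩, fun z hz => ?_,
    hac.mono fun z hz => ?_, ?_⟩
  · have := hX (Finset.mem_of_mem_erase hz)
    simp only [Inst.take, Finset.mem_sdiff, Finset.mem_erase] at this hz ⊢
    tauto
  · simp only [Inst.take, Finset.mem_sdiff, Finset.mem_erase] at hz ⊢
    tauto
  · have := Finset.card_erase_add_one hv
    simp only [Inst.take]
    omega

theorem Solves.keep (h : Solves G I X) (hv : v ∈ I.V) (hvX : v ∉ X) : Solves G (I.keep v) X := by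
  obtain ⟨hF, hX, hac, hk⟩ := h
  refine ⟨Finset.insert_subset hv hF, fun z hz => ?_, hac, hk⟩
  have := hX hz
  have hzv : z ≠ v := fun h => hvX (h ▸ hz)
  simp only [Inst.keep, Finset.mem_sdiff, Finset.mem_insert] at this ⊢
  tauto

/-- A solution is disjoint from `F`; if it also missed `v`, it would miss the cycle that `v` closes
with `F`. -/
theorem Inst.Forced.mem_of_solves (hv : I.Forced G v) (h : Solves G I X) : v ∈ X := by
  obtain ⟨hF, hX, hac, -⟩ := h
  by_contra hvX
  refine acyclicOn_iff.1 hac v (hv.cycleIn.mono (Finset.insert_subset ?_ fun z hz => ?_))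
  · exact Finset.mem_sdiff.2 ⟨(Finset.mem_sdiff.1 hv.1).1, hvX⟩
  · exact Finset.mem_sdiff.2 ⟨hF hz, fun h => (Finset.mem_sdiff.1 (hX h)).2 hz⟩

theorem Inst.Charged.discard (h : I.Charged G) (hv : I.Low G v) : (I.discard v).Charged G :=
  Chargeable.discard h hv.1 hv.2

theorem Inst.Charged.take (h : I.Charged G) (hv : v ∈ I.V \ I.F) : (I.take v).Charged G := by
  have := Chargeable.take h hv
  unfold Inst.Charged Inst.take
  convert this using 1
  push_cast
  ring

/-- What is known about a branching node. -/
structure BranchSpec (G : SimpleGraph (Fin n)) (I : Inst n) (D : Finset (Fin n)) (E : Inst n)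
    (v : Fin n) : Prop where
  b_eq : E.b = I.b
  k_nonneg : 0 ≤ E.k
  card_le : E.k + D.card ≤ I.k
  subset : E.V ⊆ I.V
  D_subset : D ⊆ I.V
  acyclic : ∀ Y, AcyclicOn G (E.V \ Y) → AcyclicOn G (I.V \ (D ∪ Y))
  solves : (∃ X, Solves G I X) → ∃ X, Solves G E X
  charged : I.Charged G → E.Charged G
  low : ∀ w, ¬ E.Low G w
  forced : ∀ w, ¬ E.Forced G w
  greedy : E.Greedy G v
  three_le : 3 ≤ E.deg G v
  F_subset : I.F ⊆ I.V → E.F ⊆ E.V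
  F_subset' : E.F ⊆ I.F

/-- What is known about the answer of a leaf, or of a run. -/
def AnswerSpec (G : SimpleGraph (Fin n)) (I : Inst n) (r : Option (Finset (Fin n))) : Prop :=
  ∀ X, r = some X → X ⊆ I.V ∧ AcyclicOn G (I.V \ X) ∧ (X.card : ℤ) ≤ I.k

/-- What is known about the outcome of a node. -/
def NodeSpec (G : SimpleGraph (Fin n)) (I : Inst n) : Outcome n → Prop
  | .answer r => AnswerSpec G I r ∧ ((∃ X, Solves G I X) → r.isSome)
  | .branch D E v => BranchSpec G I D E v

theorem NodeSpec.low {o : Outcome n} (hv : I.Low G v) (h : NodeSpec G (I.discard v) o) :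
    NodeSpec G I o := by
  cases o with
  | answer r =>
    refine ⟨fun X hX => ?_, fun ⟨X, hX⟩ => h.2 ⟨_, Inst.Low.solves hX⟩⟩
    obtain ⟨h1, h2, h3⟩ := h.1 X hX
    exact ⟨h1.trans (Finset.erase_subset _ _), hv.acyclicOn h2, h3⟩
  | branch D E w =>
    have h : BranchSpec G (I.discard v) D E w := h
    exact {
      b_eq := h.b_eq
      k_nonneg := h.k_nonneg
      card_le := h.card_le
      subset := h.subset.trans (Finset.erase_subset _ _)
      D_subset := h.D_subset.trans (Finset.erase_subset _ _)
      acyclic := fun Y hY => hv.acyclicOn (h.acyclic Y hY)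
      solves := fun ⟨X, hX⟩ => h.solves ⟨_, Inst.Low.solves hX⟩
      charged := fun hI => h.charged (hI.discard hv)
      low := h.low
      forced := h.forced
      greedy := h.greedy
      three_le := h.three_le
      F_subset := fun hF => h.F_subset (Finset.erase_subset_erase _ hF)
      F_subset' := h.F_subset'.trans (Finset.erase_subset _ _) }

theorem erase_sdiff_eq_sdiff_insert (V : Finset (Fin n)) :
    V.erase v \ X = V \ insert v X := by
  ext z
  simp only [Finset.mem_sdiff, Finset.mem_erase, Finset.mem_insert]
  tauto

theorem AnswerSpec.insert (hv : v ∈ I.V) (h : AnswerSpec G (I.take v) (some X)) :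
    insert v X ⊆ I.V ∧ AcyclicOn G (I.V \ insert v X) ∧ ((insert v X).card : ℤ) ≤ I.k := by
  obtain ⟨h1, h2, h3⟩ := h X rfl
  refine ⟨Finset.insert_subset hv (h1.trans (Finset.erase_subset _ _)), ?_, ?_⟩
  · rw [← erase_sdiff_eq_sdiff_insert]
    exact h2
  · have := Finset.card_insert_le v X
    simp only [Inst.take] at h3
    omega

theorem NodeSpec.forced {o : Outcome n} (hv : I.Forced G v) (h : NodeSpec G (I.take v) o) :
    NodeSpec G I (o.addVertex v) := by
  have hvV := (Finset.mem_sdiff.1 hv.1).1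
  cases o with
  | answer r =>
    refine ⟨fun X hX => ?_, fun ⟨X, hX⟩ => ?_⟩
    · obtain ⟨Y, rfl, rfl⟩ := Option.map_eq_some_iff.1 hX
      exact AnswerSpec.insert hvV h.1
    · have := h.2 ⟨_, hX.take (hv.mem_of_solves hX)⟩
      simpa using this
  | branch D E w =>
    have h : BranchSpec G (I.take v) D E w := h
    exact {
      b_eq := h.b_eq
      k_nonneg := h.k_nonneg
      card_le := by
        have h1 := h.card_le
        have h2 := Finset.card_insert_le v D
        simp only [Inst.take] at h1
        omega
      subset := h.subset.trans (Finset.erase_subset _ _)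
      D_subset := Finset.insert_subset hvV (h.D_subset.trans (Finset.erase_subset _ _))
      acyclic := fun Y hY => by
        rw [Finset.insert_union, ← erase_sdiff_eq_sdiff_insert]
        exact h.acyclic Y hY
      solves := fun ⟨X, hX⟩ => h.solves ⟨_, hX.take (hv.mem_of_solves hX)⟩
      charged := fun hI => h.charged (hI.take hv.1)
      low := h.low
      forced := h.forced
      greedy := h.greedy
      three_le := h.three_le
      F_subset := fun hF => h.F_subset fun z hz => Finset.mem_erase.2
        ⟨fun h => (Finset.mem_sdiff.1 hv.1).2 (h ▸ hz), hF hz⟩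
      F_subset' := h.F_subset' }

theorem NodeRun.spec {o : Outcome n} (h : NodeRun G I o) : NodeSpec G I o := by
  induction h with
  | neg I hk =>
    refine ⟨fun X hX => by simp at hX, fun ⟨X, hX⟩ => ?_⟩
    have := hX.2.2.2
    omega
  | empty I hk hV =>
    refine ⟨fun X hX => ?_, fun _ => rfl⟩
    obtain rfl := Option.some.inj hX
    exact ⟨Finset.empty_subset _, by rw [hV]; exact acyclicOn_empty, by simpa using hk⟩
  | low I v o hk hv h ih => exact ih.low hv
  | forced I v o hk h1 hv h ih => exact ih.forced hv
  | cycles I v X hk h1 h2 hv hd hX =>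
    refine ⟨fun Y hY => ?_, fun ⟨Y, hY⟩ => ?_⟩
    · split_ifs at hY with h
      obtain rfl := Option.some.inj hY
      exact ⟨hX.sound.1, hX.sound.2, h⟩
    -- The picked vertex has maximum degree outside `F`, so every vertex outside `F` has degree at
    -- most two, and the loop does at least as well as the solution `Y`.
    · have := hX.card_le (fun u hu => (hv.2 u hu).trans hd.le) hY.2.1 hY.2.2.1
      have hk := hY.2.2.2
      rw [if_pos (by omega)]
      rfl
  | branch I v hk h1 h2 hv hd =>
    exact {
      b_eq := rfl
      k_nonneg := hk
      card_le := by simp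
      subset := subset_rfl
      D_subset := Finset.empty_subset _
      acyclic := fun Y hY => by simpa using hY
      solves := id
      charged := id
      low := h1
      forced := h2
      greedy := hv
      three_le := by
        have : ¬ I.deg G v < 2 := fun h => h1 v ⟨(Finset.mem_sdiff.1 hv.1).1, h⟩
        omega
      F_subset := id
      F_subset' := subset_rfl }

theorem BranchSpec.mem (h : BranchSpec G I D E v) : v ∈ E.V \ E.F := h.greedy.1

theorem BranchSpec.two_le (h : BranchSpec G I D E v) : ∀ w ∈ E.V, 2 ≤ degIn G E.V w :=
  fun w hw => by
    by_contra hc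
    exact h.low w ⟨hw, not_le.1 hc⟩

/-- The gain from keeping `v` is needed even if the budget is exhausted and `keep` may not be
called, hence a form without truncated subtraction of the budget. -/
theorem BranchSpec.chargeable_keep (h : BranchSpec G I D E v) (hI : I.Charged G) :
    Chargeable G E.V (insert v E.F) (3 * E.k - E.b + 1) :=
  Chargeable.keep (h.charged hI) h.mem h.two_le h.three_le h.greedy.2

theorem BranchSpec.charged_keep (h : BranchSpec G I D E v) (hI : I.Charged G) (hb : 0 < E.b) :
    (E.keep v).Charged G := by
  have := h.chargeable_keep hI
  unfold Inst.Charged Inst.keep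
  convert this using 1
  have : ((E.b - 1 : ℕ) : ℚ) = E.b - 1 := by
    rw [Nat.cast_sub hb, Nat.cast_one]
  simp only [this]
  ring

theorem AnswerSpec.union (h : BranchSpec G I D E v) {Y : Finset (Fin n)}
    (hY : Y ⊆ E.V ∧ AcyclicOn G (E.V \ Y) ∧ (Y.card : ℤ) ≤ E.k) :
    D ∪ Y ⊆ I.V ∧ AcyclicOn G (I.V \ (D ∪ Y)) ∧ ((D ∪ Y).card : ℤ) ≤ I.k := by
  refine ⟨Finset.union_subset h.D_subset (hY.1.trans h.subset), h.acyclic Y hY.2.1, ?_⟩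
  have := Finset.card_union_le D Y
  have := h.card_le
  have := hY.2.2
  omega

theorem Run.sound {r : Option (Finset (Fin n))} (h : Run G I r) : AnswerSpec G I r := by
  induction h with
  | leaf I r h => exact h.spec.1
  | taken I E D X v h h5 ih =>
    intro Y hY
    obtain rfl := Option.some.inj hY
    have hb : BranchSpec G I D E v := h.spec
    exact AnswerSpec.union hb (AnswerSpec.insert (Finset.mem_sdiff.1 hb.mem).1 ih)
  | kept I E D v r h h5 hb h6 ih5 ih6 =>
    intro Y hY
    obtain ⟨Z, rfl, rfl⟩ := Option.map_eq_some_iff.1 hY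
    exact AnswerSpec.union h.spec (ih6 Z rfl)
  | cut I E D v h h5 hb ih => exact fun X hX => by simp at hX

theorem Run.complete {r : Option (Finset (Fin n))} (h : Run G I r) (hI : I.Charged G)
    (hX : ∃ X, Solves G I X) : r.isSome := by
  induction h with
  | leaf I r h => exact h.spec.2 hX
  | taken => rfl
  | kept I E D v r h h5 hb h6 ih5 ih6 =>
    have hs : BranchSpec G I D E v := h.spec
    obtain ⟨X, hX⟩ := hs.solves hX
    by_cases hvX : v ∈ X
    · simpa using ih5 ((hs.charged hI).take hs.mem) ⟨_, hX.take hvX⟩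
    · simpa using ih6 (hs.charged_keep hI hb) ⟨X, hX.keep (Finset.mem_sdiff.1 hs.mem).1 hvX⟩
  | cut I E D v h h5 hb ih =>
    have hs : BranchSpec G I D E v := h.spec
    obtain ⟨X, hX⟩ := hs.solves hX
    by_cases hvX : v ∈ X
    · exact ih ((hs.charged hI).take hs.mem) ⟨_, hX.take hvX⟩
    · obtain ⟨-, hX', hac, hk⟩ := hX.keep (Finset.mem_sdiff.1 hs.mem).1 hvX
      -- The potential after keeping `v` would be at least `3 * E.k + 1`, while `X` bounds it by `3
      -- * X.card ≤ 3 * E.k`. So no solution avoids `v`, and truncation loses nothing.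
      have h3 := (hs.chargeable_keep hI).le_three_mul hs.two_le hX' hac
      rw [hb] at h3
      have : (X.card : ℚ) ≤ E.k := by exact_mod_cast hk
      push_cast at h3
      linarith

/-- At the root `3 * k - b` is zero, and so is the potential for `W = 0` and zero weights. -/
theorem root_charged (k : ℕ) : (Inst.root n k).Charged G := by
  refine ⟨fun _ => 0, 0, by norm_num, fun v => by simp, fun _ _ => rfl, fun _ _ => by simp,
    le_rfl, ?_⟩
  simp [Inst.root, potential, charge]

theorem isFVS_iff : IsFVS G X ↔ AcyclicOn G (Finset.univ \ X) := by
  unfold IsFVS AcyclicOn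
  have : {v | v ∈ Finset.univ \ X} = {v | v ∉ X} := by
    ext
    simp
  rw [this]

theorem Run.root_sound {k : ℕ} (h : Run G (Inst.root n k) (some X)) : IsFVS G X ∧ X.card ≤ k := by
  obtain ⟨-, h1, h2⟩ := h.sound X rfl
  have h2 : (X.card : ℤ) ≤ (k : ℤ) := h2
  exact ⟨isFVS_iff.2 h1, by exact_mod_cast h2⟩

theorem Run.root_isSome_iff {k : ℕ} {r : Option (Finset (Fin n))} (h : Run G (Inst.root n k) r) :
    r.isSome ↔ ∃ X : Finset (Fin n), IsFVS G X ∧ X.card ≤ k := by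
  constructor
  · intro hr
    obtain ⟨X, rfl⟩ := Option.isSome_iff_exists.1 hr
    exact ⟨X, h.root_sound⟩
  · rintro ⟨X, hX, hk⟩
    refine h.complete (root_charged k) ⟨X, ?_, ?_, isFVS_iff.1 hX, ?_⟩
    · exact Finset.empty_subset _
    · simp [Inst.root]
    · simpa [Inst.root] using hk

/-- Every branching spends at least one unit of `k` or of `b`, and their sum is `4 * k` at the root;
neither becomes negative. -/
theorem SearchNode.depth_le {k : ℕ} {d : ℕ} (h : SearchNode G (Inst.root n k) d I) :
    0 ≤ I.k ∧ d + I.k + I.b ≤ 4 * k := by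
  induction h with
  | root =>
    simp only [Inst.root]
    push_cast
    omega
  | taken d I E D v hI h hk ih =>
    have hs : BranchSpec G I D E v := h.spec
    have h1 := hs.card_le
    have h2 := hs.b_eq
    simp only [Inst.take] at hk ⊢
    push_cast
    omega
  | kept d I E D v hI h hb ih =>
    have hs : BranchSpec G I D E v := h.spec
    have h1 := hs.card_le
    have h2 := hs.b_eq
    have h3 := hs.k_nonneg
    simp only [Inst.keep]
    push_cast
    omega

end Correctness

/-! ### Commands with bounded loops -/

/-- Commands whose loops run a register through `0, …, n - 1`, where `n` is the value of
register 0. -/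
inductive Cmd where
  | skip
  | assign (x : ℕ) (e : Expr)
  | store (a : ℕ) (i e : Expr)
  | seq (p q : Cmd)
  | cond (e : Expr) (p q : Cmd)
  | forN (i : ℕ) (p : Cmd)

namespace Cmd

/-- The program that a command stands for. -/
def toProg : Cmd → Prog
  | skip => .skip
  | assign x e => .assign x e
  | store a i e => .store a i e
  | seq p q => .seq p.toProg q.toProg
  | cond e p q => .cond e p.toProg q.toProg
  | forN i p => .seq (.assign i (.const 0)) (.loop (.sub (.reg 0) (.reg i))
      (.seq p.toProg (.assign i (.add (.reg i) (.const 1)))))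

/-- The effect of a command on the memory. -/
def sem : Cmd → Mem → Mem
  | skip, m => m
  | assign x e, m => m.setReg x (e.eval m)
  | store a i e, m => m.setArr a (i.eval m) (e.eval m)
  | seq p q, m => q.sem (p.sem m)
  | cond e p q, m => if e.eval m = 0 then q.sem m else p.sem m
  | forN i p, m => (fun m' => (p.sem m').setReg i (m'.reg i + 1))^[m.reg 0] (m.setReg i 0)

/-- The registers that a command may write. -/
def regs : Cmd → List ℕ
  | skip => []
  | assign x _ => [x]
  | store _ _ _ => []
  | seq p q => p.regs ++ q.regs
  | cond _ p q => p.regs ++ q.regs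
  | forN i p => i :: p.regs

/-- The arrays that a command may write. -/
def arrs : Cmd → List ℕ
  | skip => []
  | assign _ _ => []
  | store a _ _ => [a]
  | seq p q => p.arrs ++ q.arrs
  | cond _ p q => p.arrs ++ q.arrs
  | forN _ p => p.arrs

/-- Loop variables, and the register that bounds all loops, are not written by loop bodies. -/
def wf : Cmd → Bool
  | seq p q => p.wf && q.wf
  | cond _ p q => p.wf && q.wf
  | forN i p => p.wf && i != 0 && !(p.regs.contains i) && !(p.regs.contains 0)
  | _ => true

/-- The nesting depth of the loops. -/
def depth : Cmd → ℕ
  | seq p q => max p.depth q.depth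
  | cond _ p q => max p.depth q.depth
  | forN _ p => p.depth + 1
  | _ => 0

/-- The constant factor in the running time. -/
def factor : Cmd → ℕ
  | skip => 1
  | assign _ e => e.cost + 1
  | store _ i e => i.cost + e.cost + 1
  | seq p q => p.factor + q.factor
  | cond e p q => e.cost + 1 + p.factor + q.factor
  | forN _ p => p.factor + 14

/-- Commands executed one after the other. -/
def block : List Cmd → Cmd
  | [] => skip
  | [c] => c
  | c :: l => seq c (block l)

/-- The states `m` and `m'` agree on everything that `c` does not write. -/
def Frame (c : Cmd) (m m' : Mem) : Prop :=
  (∀ x, x ∉ c.regs → m'.reg x = m.reg x) ∧ ∀ a, a ∉ c.arrs → m'.arr a = m.arr a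

theorem Frame.refl (c : Cmd) (m : Mem) : c.Frame m m := ⟨fun _ _ => rfl, fun _ _ => rfl⟩

theorem setReg_reg_of_ne {m : Mem} {x y c : ℕ} (h : y ≠ x) : (m.setReg x c).reg y = m.reg y :=
  Function.update_of_ne h _ _

theorem frame_loop {i : ℕ} {p : Cmd} {m : Mem} (hp : ∀ m, p.Frame m (p.sem m)) (j : ℕ) :
    (forN i p).Frame m
      ((fun m' => (p.sem m').setReg i (m'.reg i + 1))^[j] (m.setReg i 0)) := by
  induction j with
  | zero =>
    refine ⟨fun x hx => setReg_reg_of_ne fun h => hx ?_, fun a _ => rfl⟩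
    simp [regs, h]
  | succ j ih =>
    rw [Function.iterate_succ_apply']
    refine ⟨fun x hx => ?_, fun a ha => ?_⟩
    · simp only [regs, List.mem_cons, not_or] at hx
      rw [setReg_reg_of_ne hx.1, (hp _).1 x hx.2]
      exact ih.1 x (by simp [regs, hx])
    · exact ((hp _).2 a ha).trans (ih.2 a ha)

theorem frame (c : Cmd) (m : Mem) : c.Frame m (c.sem m) := by
  induction c generalizing m with
  | skip => exact Frame.refl _ _
  | assign x e =>
    exact ⟨fun y hy => setReg_reg_of_ne (by simpa [regs] using hy), fun a _ => rfl⟩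
  | store a i e =>
    exact ⟨fun y _ => rfl, fun b hb => Function.update_of_ne (by simpa [arrs] using hb) _ _⟩
  | seq p q hp hq =>
    refine ⟨fun x hx => ?_, fun a ha => ?_⟩
    · simp only [regs, List.mem_append, not_or] at hx
      exact ((hq _).1 x hx.2).trans ((hp m).1 x hx.1)
    · simp only [arrs, List.mem_append, not_or] at ha
      exact ((hq _).2 a ha.2).trans ((hp m).2 a ha.1)
  | cond e p q hp hq =>
    refine ⟨fun x hx => ?_, fun a ha => ?_⟩
    · simp only [regs, List.mem_append, not_or] at hx
      simp only [sem]
      split_ifs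
      · exact (hq m).1 x hx.2
      · exact (hp m).1 x hx.1
    · simp only [arrs, List.mem_append, not_or] at ha
      simp only [sem]
      split_ifs
      · exact (hq m).2 a ha.2
      · exact (hp m).2 a ha.1
  | forN i p hp => exact frame_loop hp _

theorem sem_reg {c : Cmd} {m : Mem} {x : ℕ} (h : x ∉ c.regs) : (c.sem m).reg x = m.reg x :=
  (c.frame m).1 x h

theorem sem_arr {c : Cmd} {m : Mem} {a : ℕ} (h : a ∉ c.arrs) : (c.sem m).arr a = m.arr a :=
  (c.frame m).2 a h

theorem sem_block_cons (c d : Cmd) (l : List Cmd) (m : Mem) :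
    (block (c :: d :: l)).sem m = (block (d :: l)).sem (c.sem m) := rfl

theorem sem_block_singleton (c : Cmd) (m : Mem) : (block [c]).sem m = c.sem m := rfl

theorem sem_cond_zero {e : Expr} {p q : Cmd} {m : Mem} (h : e.eval m = 0) :
    (cond e p q).sem m = q.sem m := if_pos h

theorem sem_cond_ne {e : Expr} {p q : Cmd} {m : Mem} (h : e.eval m ≠ 0) :
    (cond e p q).sem m = p.sem m := if_neg h

/-- A loop establishes an invariant that its body maintains. -/
theorem forN_rule {n i : ℕ} {p : Cmd} {m : Mem} (Inv : ℕ → Mem → Prop) (hwf : (forN i p).wf)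
    (hn : m.reg 0 = n) (hreg : ∀ j m' c, Inv j m' → Inv j (m'.setReg i c)) (h0 : Inv 0 m)
    (hs : ∀ (u : Fin n) (m' : Mem), (forN i p).Frame m m' → m'.reg i = u → m'.reg 0 = n →
      Inv u m' → Inv (u + 1) (p.sem m')) : Inv n ((forN i p).sem m) := by
  simp only [wf, Bool.and_eq_true, bne_iff_ne, Bool.not_eq_true', List.contains_eq_mem,
    decide_eq_false_iff_not] at hwf
  obtain ⟨⟨⟨-, hi0⟩, hip⟩, h0p⟩ := hwf
  have key : ∀ j ≤ n, Inv j ((fun m' => (p.sem m').setReg i (m'.reg i + 1))^[j] (m.setReg i 0)) ∧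
      ((fun m' => (p.sem m').setReg i (m'.reg i + 1))^[j] (m.setReg i 0)).reg i = j := by
    intro j
    induction j with
    | zero => exact fun _ => ⟨hreg _ _ _ h0, Function.update_self _ _ _⟩
    | succ j ih =>
      intro hj
      obtain ⟨ih1, ih2⟩ := ih (by omega)
      have hf := frame_loop (i := i) (p := p) (m := m) (frame p) j
      rw [Function.iterate_succ_apply']
      generalize (fun m' => (p.sem m').setReg i (m'.reg i + 1))^[j] (m.setReg i 0) = m'
        at ih1 ih2 hf ⊢
      have hm' : m'.reg 0 = n := by
        rw [hf.1 0 (by simp [regs, h0p, Ne.symm hi0]), hn]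
      refine ⟨hreg _ _ _ (hs ⟨j, hj⟩ m' hf ih2 hm' ih1), ?_⟩
      rw [ih2]
      exact Function.update_self _ _ _
  simp only [sem, hn]
  exact (key n le_rfl).1

theorem exec_loop {i : ℕ} {p : Cmd} {n d K : ℕ} (hi0 : i ≠ 0) (hip : i ∉ p.regs)
    (h0p : 0 ∉ p.regs) (hp : ∀ m : Mem, m.reg 0 = n →
      ∃ t, Exec p.toProg m t (p.sem m) ∧ t ≤ K * (max n 1) ^ d) (j : ℕ) :
    ∀ m : Mem, m.reg 0 = n → m.reg i + j = n →
      ∃ t, Exec (.loop (.sub (.reg 0) (.reg i))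
          (.seq p.toProg (.assign i (.add (.reg i) (.const 1))))) m t
          ((fun m' => (p.sem m').setReg i (m'.reg i + 1))^[j] m) ∧
        t ≤ j * (K * (max n 1) ^ d + 8) + 4 := by
  induction j with
  | zero =>
    intro m h0 hi
    exact ⟨_, Exec.loopFalse _ _ _ (by simp [Expr.eval]; omega), by simp [Expr.cost]⟩
  | succ j ih =>
    intro m h0 hi
    obtain ⟨t, ht, htle⟩ := hp m h0
    have hri : (p.sem m).reg i = m.reg i := sem_reg hip
    have hbody := Exec.seq _ _ _ _ _ _ _ ht
      (Exec.assign i (.add (.reg i) (.const 1)) (p.sem m))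
    simp only [Expr.eval, hri] at hbody
    obtain ⟨s, hs, hsle⟩ := ih ((p.sem m).setReg i (m.reg i + 1))
      (by rw [setReg_reg_of_ne hi0.symm, sem_reg h0p, h0])
      (by simp only [Mem.setReg, Function.update_self]; omega)
    refine ⟨_, Exec.loopTrue _ _ _ _ _ _ _ ?_ hbody hs, ?_⟩
    · simp only [Expr.eval]
      omega
    · simp only [Expr.cost]
      nlinarith

/-- Commands halt within a time that is polynomial in the value of register 0. -/
theorem exec (c : Cmd) (hwf : c.wf) (h0 : 0 ∉ c.regs) (m : Mem) :
    ∃ t, Exec c.toProg m t (c.sem m) ∧ t ≤ c.factor * (max (m.reg 0) 1) ^ c.depth := by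
  induction c generalizing m with
  | skip => exact ⟨_, Exec.skip m, by simp [factor, depth]⟩
  | assign x e => exact ⟨_, Exec.assign x e m, by simp [factor, depth]⟩
  | store a i e => exact ⟨_, Exec.store a i e m, by simp [factor, depth]⟩
  | seq p q hp hq =>
    simp only [wf, Bool.and_eq_true] at hwf
    simp only [regs, List.mem_append, not_or] at h0
    obtain ⟨s, hs, hsle⟩ := hp hwf.1 h0.1 m
    obtain ⟨t, ht, htle⟩ := hq hwf.2 h0.2 (p.sem m)
    rw [sem_reg h0.1] at htle
    refine ⟨_, Exec.seq _ _ _ _ _ _ _ hs ht, ?_⟩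
    have h1 : (max (m.reg 0) 1) ^ p.depth ≤ (max (m.reg 0) 1) ^ (max p.depth q.depth) :=
      Nat.pow_le_pow_right (by omega) (le_max_left _ _)
    have h2 : (max (m.reg 0) 1) ^ q.depth ≤ (max (m.reg 0) 1) ^ (max p.depth q.depth) :=
      Nat.pow_le_pow_right (by omega) (le_max_right _ _)
    simp only [factor, depth, add_mul]
    exact add_le_add (hsle.trans (Nat.mul_le_mul_left _ h1)) (htle.trans (Nat.mul_le_mul_left _ h2))
  | cond e p q hp hq =>
    simp only [wf, Bool.and_eq_true] at hwf
    simp only [regs, List.mem_append, not_or] at h0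
    have h1 : (max (m.reg 0) 1) ^ p.depth ≤ (max (m.reg 0) 1) ^ (max p.depth q.depth) :=
      Nat.pow_le_pow_right (by omega) (le_max_left _ _)
    have h2 : (max (m.reg 0) 1) ^ q.depth ≤ (max (m.reg 0) 1) ^ (max p.depth q.depth) :=
      Nat.pow_le_pow_right (by omega) (le_max_right _ _)
    have h3 : 1 ≤ (max (m.reg 0) 1) ^ (max p.depth q.depth) := Nat.one_le_pow _ _ (by omega)
    by_cases he : e.eval m = 0
    · obtain ⟨t, ht, htle⟩ := hq hwf.2 h0.2 m
      refine ⟨_, by simpa only [sem, toProg, he, if_true] using Exec.condFalse _ _ _ _ _ _ he ht, ?_⟩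
      have := htle.trans (Nat.mul_le_mul_left _ h2)
      have := Nat.mul_le_mul_left (e.cost + 1) h3
      simp only [factor, depth, add_mul] at *
      omega
    · obtain ⟨t, ht, htle⟩ := hp hwf.1 h0.1 m
      refine ⟨_, by simpa only [sem, toProg, he, if_false] using Exec.condTrue _ _ _ _ _ _ he ht, ?_⟩
      have := htle.trans (Nat.mul_le_mul_left _ h1)
      have := Nat.mul_le_mul_left (e.cost + 1) h3
      simp only [factor, depth, add_mul] at *
      omega
  | forN i p hp =>
    simp only [wf, Bool.and_eq_true, bne_iff_ne, Bool.not_eq_true', List.contains_eq_mem,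
      decide_eq_false_iff_not] at hwf
    obtain ⟨⟨⟨hwf, hi0⟩, hip⟩, h0p⟩ := hwf
    obtain ⟨t, ht, htle⟩ := exec_loop hi0 hip h0p (n := m.reg 0) (d := p.depth) (K := p.factor)
      (fun m' hm' => hm' ▸ hp hwf h0p m') (m.reg 0) (m.setReg i 0)
      (setReg_reg_of_ne hi0.symm) (by simp [Mem.setReg])
    refine ⟨_, Exec.seq _ _ _ _ _ _ _ (Exec.assign i (.const 0) m) ht, ?_⟩
    have h1 : 1 ≤ (max (m.reg 0) 1) ^ p.depth := Nat.one_le_pow _ _ (by omega)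
    have h2 := Nat.mul_le_mul_right (p.factor * (max (m.reg 0) 1) ^ p.depth + 8)
      (le_max_left (m.reg 0) 1)
    have h3 := Nat.mul_le_mul_left (max (m.reg 0) 1) h1
    simp only [factor, depth, Expr.cost, pow_succ]
    nlinarith [le_max_right (m.reg 0) 1]

/-- A loop that stores into the entry given by its loop variable. -/
theorem forN_store_rule {n i a : ℕ} {e : Expr} {m : Mem} (f : Fin n → ℕ) (hi : i ≠ 0)
    (hn : m.reg 0 = n)
    (he : ∀ (u : Fin n) (m' : Mem), (forN i (store a (.reg i) e)).Frame m m' → m'.reg i = u →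
      m'.arr a u = m.arr a u → e.eval m' = f u) (v : Fin n) :
    ((forN i (store a (.reg i) e)).sem m).arr a v = f v := by
  have := forN_rule (i := i) (p := store a (.reg i) e) (m := m) (n := n)
    (fun j m' => ∀ v : Fin n, m'.arr a v = if v.1 < j then f v else m.arr a v)
    (by simp [wf, regs, hi]) hn (fun _ _ _ h => h) (by simp) ?_ v
  · simpa using this
  · intro u m' hf hu hm' hI w
    simp only [sem, Mem.setArr, Expr.eval, Function.update_self, hu]
    rw [he u m' hf hu (by rw [hI, if_neg (lt_irrefl _)])]
    by_cases h : w = u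
    · subst h
      simp
    · have h' : w.1 ≠ u.1 := fun h' => h (Fin.ext h')
      rw [Function.update_of_ne h', hI]
      have : w.1 < u.1 + 1 ↔ w.1 < u.1 := by omega
      simp only [this]

end Cmd

/-! ### Sets and the graph in memory -/

section Memory

variable {n : ℕ} {G : SimpleGraph (Fin n)} {S X : Finset (Fin n)} {m : Mem} {a : ℕ}

/-- The nonzero entries of array `a` are those of `S`. -/
def Marks (m : Mem) (a : ℕ) (S : Finset (Fin n)) : Prop :=
  ∀ v : Fin n, m.arr a v ≠ 0 ↔ v ∈ S

theorem HoldsSet.marks (h : HoldsSet m a S) : Marks m a S := fun v => by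
  rw [h v]
  split_ifs with hv <;> simp [hv]

theorem HoldsSet.sem {c : Cmd} (h : HoldsSet m a S) (ha : a ∉ c.arrs) :
    HoldsSet (c.sem m) a S := fun v => by
  rw [Cmd.sem_arr ha, h v]

theorem HoldsSet.frame {c : Cmd} {m' : Mem} (hf : c.Frame m m') (h : HoldsSet m a S)
    (ha : a ∉ c.arrs) : HoldsSet m' a S := fun v => by
  rw [hf.2 a ha, h v]

theorem Marks.sem {c : Cmd} (h : Marks m a S) (ha : a ∉ c.arrs) : Marks (c.sem m) a S :=
  fun v => by rw [Cmd.sem_arr ha, h v]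

theorem Marks.frame {c : Cmd} {m' : Mem} (hf : c.Frame m m') (h : Marks m a S)
    (ha : a ∉ c.arrs) : Marks m' a S := fun v => by
  rw [hf.2 a ha, h v]

theorem HoldsSet.insert {v : Fin n} (h : HoldsSet m a S) :
    HoldsSet (m.setArr a v 1) a (insert v S) := fun w => by
  simp only [Mem.setArr, Function.update_self]
  by_cases hw : w = v
  · subst hw
    simp
  · rw [Function.update_of_ne (fun h => hw (Fin.ext h)), h w]
    simp [hw]

theorem HoldsSet.erase {v : Fin n} (h : HoldsSet m a S) :
    HoldsSet (m.setArr a v 0) a (S.erase v) := fun w => by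
  simp only [Mem.setArr, Function.update_self]
  by_cases hw : w = v
  · subst hw
    simp
  · rw [Function.update_of_ne (fun h => hw (Fin.ext h)), h w]
    simp [hw]

theorem Marks.insert {v : Fin n} (h : Marks m a S) : Marks (m.setArr a v 1) a (insert v S) :=
  fun w => by
  simp only [Mem.setArr, Function.update_self]
  by_cases hw : w = v
  · subst hw
    simp
  · rw [Function.update_of_ne (fun h => hw (Fin.ext h)), h w]
    simp [hw]

theorem setArr_arr_of_ne {b i c : ℕ} (h : b ≠ a) : (m.setArr a i c).arr b = m.arr b :=
  Function.update_of_ne h _ _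

theorem HoldsSet.setArr {b i c : ℕ} (h : HoldsSet m a S) (hb : a ≠ b) :
    HoldsSet (m.setArr b i c) a S := fun v => by rw [setArr_arr_of_ne hb, h v]

theorem Marks.setArr {b i c : ℕ} (h : Marks m a S) (hb : a ≠ b) :
    Marks (m.setArr b i c) a S := fun v => by rw [setArr_arr_of_ne hb, h v]

/-- The graph is in memory, together with the offsets of the rows of its adjacency matrix. -/
def Ready (m : Mem) (G : SimpleGraph (Fin n)) : Prop :=
  HoldsGraph m G ∧ ∀ u : Fin n, m.arr 9 u = u * n

theorem Ready.frame {c : Cmd} {m' : Mem} (h : Ready m G) (hf : c.Frame m m') (h0 : 0 ∉ c.regs)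
    (ha : 0 ∉ c.arrs) (hb : 9 ∉ c.arrs) : Ready m' G := by
  refine ⟨⟨(hf.1 0 h0).trans h.1.1, fun u v => ?_⟩, fun u => ?_⟩
  · rw [hf.2 0 ha]
    exact h.1.2 u v
  · rw [hf.2 9 hb]
    exact h.2 u

theorem Ready.sem {c : Cmd} (h : Ready m G) (h0 : 0 ∉ c.regs)
    (ha : 0 ∉ c.arrs) (hb : 9 ∉ c.arrs) : Ready (c.sem m) G :=
  h.frame (c.frame m) h0 ha hb

/-- The entry of the adjacency matrix for the vertices in two registers. -/
def adjExpr (x y : ℕ) : Expr := .get 0 (.add (.get 9 (.reg x)) (.reg y))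

open Classical in
theorem Ready.eval_adjExpr (h : Ready m G) {x y : ℕ} {u w : Fin n} (hx : m.reg x = u)
    (hy : m.reg y = w) : (adjExpr x y).eval m = if G.Adj u w then 1 else 0 := by
  simp only [adjExpr, Expr.eval, hx, hy, h.2 u]
  exact h.1.2 u w

/-- Clear an array. -/
def zeroArr (i a : ℕ) : Cmd := .forN i (.store a (.reg i) (.const 0))

theorem zeroArr_spec {i : ℕ} (hi : i ≠ 0) (hn : m.reg 0 = n) (v : Fin n) :
    ((zeroArr i a).sem m).arr a v = 0 :=
  Cmd.forN_store_rule (fun _ => 0) hi hn (fun _ _ _ _ _ => rfl) v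

theorem zeroArr_marks {i : ℕ} (hi : i ≠ 0) (hn : m.reg 0 = n) :
    Marks ((zeroArr i a).sem m) a (∅ : Finset (Fin n)) := fun v => by
  simp [zeroArr_spec hi hn]

theorem zeroArr_holdsSet {i : ℕ} (hi : i ≠ 0) (hn : m.reg 0 = n) :
    HoldsSet ((zeroArr i a).sem m) a (∅ : Finset (Fin n)) := fun v => by
  simp [zeroArr_spec hi hn]

end Memory

/-! ### Growing a forest -/

section Forest

variable {n : ℕ} {G : SimpleGraph (Fin n)} {S B X V : Finset (Fin n)} {m : Mem} {u : Fin n}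

/-- Compare the labels of the neighbors of a vertex `u` in register 4: mark the labels that occur
in array 7, and set register 6 if one occurs twice. -/
def testBody : Cmd :=
  .cond (.get 5 (.reg 5)) (.cond (adjExpr 4 5)
    (.cond (.get 7 (.get 6 (.reg 5))) (.assign 6 (.const 1))
      (.store 7 (.get 6 (.reg 5)) (.const 1))) .skip) .skip

/-- Run the test over all vertices. -/
def test : Cmd := .block [.assign 6 (.const 0), .forN 5 testBody]

/-- Give the label `u` to the vertices with marked labels, and to `u`. -/
def merge : Cmd := .block [
  .forN 5 (.cond (.get 5 (.reg 5)) (.cond (.get 7 (.get 6 (.reg 5)))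
    (.store 6 (.reg 5) (.reg 4)) .skip) .skip),
  .store 5 (.reg 4) (.const 1), .store 6 (.reg 4) (.reg 4)]

/-- For the vertices `u` in array 10: put `u` into the forest in array 5, unless this closes a cycle;
then put `u` into array 3 and count it in register 11. -/
def growBody : Cmd := .cond (.get 10 (.reg 4)) (.block [test,
    .cond (.reg 6) (.block [.store 3 (.reg 4) (.const 1),
      .assign 11 (.add (.reg 11) (.const 1))]) merge,
    zeroArr 5 7]) .skip

/-- Grow the forest by one vertex after the other. -/
def grow : Cmd := .forN 4 growBody

/-- `L` labels the components of the subgraph induced by `S` with vertices of `S`. -/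
structure Labels (G : SimpleGraph (Fin n)) (S : Finset (Fin n)) (L : Fin n → Fin n) : Prop where
  mem : ∀ x ∈ S, L x ∈ S
  eq_iff : ∀ x ∈ S, ∀ y ∈ S, L x = L y ↔ ConnOn G S x y

/-- Arrays 5 and 6 hold a set and the labels of its components, and array 7 is clear. -/
structure HoldsForest (m : Mem) (G : SimpleGraph (Fin n)) (S : Finset (Fin n))
    (L : Fin n → Fin n) : Prop where
  marks : Marks m 5 S
  label : ∀ v ∈ S, m.arr 6 v = L v
  labels : Labels G S L
  clear : Marks m 7 (∅ : Finset (Fin n))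

theorem ConnOn.apply_eq {α : Type*} {x y : Fin n} (f : Fin n → α)
    (hf : ∀ a ∈ S, ∀ b ∈ S, G.Adj a b → f a = f b) (h : ConnOn G S x y) : f x = f y := by
  obtain ⟨p, hp⟩ := h
  induction p with
  | nil => rfl
  | cons h p ih =>
    have h2 : ∀ z ∈ p.support, z ∈ S := fun z hz => hp z (by simp [hz])
    exact (hf _ (hp _ (by simp)) _ (h2 _ p.start_mem_support) h).trans (ih h2)

open Classical in
/-- The labels after a new vertex has been joined to the components of its neighbors. -/
noncomputable def mergeLabels (G : SimpleGraph (Fin n)) (S : Finset (Fin n)) (L : Fin n → Fin n)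
    (u v : Fin n) : Fin n :=
  if v = u ∨ ∃ w ∈ S, G.Adj u w ∧ L w = L v then u else L v

/-- Labels are vertices of `S`, so the label `u` is fresh. After merging, it marks exactly `u` and
the components that contain a neighbor of `u`, which `u` joins into one. -/
theorem Labels.merge {L : Fin n → Fin n} (h : Labels G S L) (hu : u ∉ S) :
    Labels G (insert u S) (mergeLabels G S L u) := by
  classical
  have hmono : S ⊆ insert u S := Finset.subset_insert _ _
  have hconn : ∀ x ∈ insert u S, mergeLabels G S L u x = u → ConnOn G (insert u S) u x := by
    intro x hx hxu
    unfold mergeLabels at hxu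
    rcases Finset.mem_insert.1 hx with rfl | hxS
    · exact ConnOn.refl hx
    · have hne : x ≠ u := fun h => hu (h ▸ hxS)
      split_ifs at hxu with hc
      · obtain ⟨w, hw, huw, hwL⟩ := hc.resolve_left hne
        exact (ConnOn.of_adj huw (Finset.mem_insert_self _ _) (hmono hw)).trans
          (((h.eq_iff w hw x hxS).1 hwL).mono hmono)
      · exact absurd (hxu ▸ h.mem x hxS) hu
  constructor
  · intro x hx
    unfold mergeLabels
    split_ifs with hc
    · exact Finset.mem_insert_self _ _
    · push Not at hc
      exact hmono (h.mem x ((Finset.mem_insert.1 hx).resolve_left hc.1))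
  · intro x hx y hy
    constructor
    · intro hxy
      by_cases hxu : mergeLabels G S L u x = u
      · exact (hconn x hx hxu).symm.trans (hconn y hy (hxy ▸ hxu))
      · have hyu : mergeLabels G S L u y ≠ u := hxy ▸ hxu
        unfold mergeLabels at hxy hxu hyu
        split_ifs at hxy hxu hyu with h1 h2 h2
        · exact absurd rfl hyu
        · exact absurd rfl hxu
        · exact absurd rfl hyu
        · push Not at h1 h2
          exact ((h.eq_iff x ((Finset.mem_insert.1 hx).resolve_left h1.1) y
            ((Finset.mem_insert.1 hy).resolve_left h2.1)).1 hxy).mono hmono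
    · refine ConnOn.apply_eq _ fun a ha b hb hab => ?_
      have key : ∀ b ∈ insert u S, G.Adj u b → mergeLabels G S L u b = u := fun b hb hub => by
        unfold mergeLabels
        rw [if_pos]
        exact (Finset.mem_insert.1 hb).imp_right fun hbS => ⟨b, hbS, hub, rfl⟩
      have hself : mergeLabels G S L u u = u := by
        unfold mergeLabels
        rw [if_pos (Or.inl rfl)]
      rcases Finset.mem_insert.1 ha with rfl | haS
      · rw [key b hb hab, hself]
      · rcases Finset.mem_insert.1 hb with rfl | hbS
        · rw [key a ha hab.symm, hself]
        · have hL : L a = L b := (h.eq_iff a haS b hbS).2 (ConnOn.of_adj hab haS hbS)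
          have hau : a ≠ u := fun h => hu (h ▸ haS)
          have hbu : b ≠ u := fun h => hu (h ▸ hbS)
          unfold mergeLabels
          exact if_congr (by simp only [hL, hau, hbu]) rfl hL

theorem exists_lt_succ_iff {A : Fin n → Prop} (w : Fin n) :
    (∃ x : Fin n, x.1 < w.1 + 1 ∧ A x) ↔ (∃ x : Fin n, x.1 < w.1 ∧ A x) ∨ A w := by
  constructor
  · rintro ⟨x, hx, hA⟩
    by_cases hxw : x = w
    · exact Or.inr (hxw ▸ hA)
    · exact Or.inl ⟨x, by have := Fin.val_ne_of_ne hxw; omega, hA⟩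
  · rintro (⟨x, hx, hA⟩ | hA)
    · exact ⟨x, by omega, hA⟩
    · exact ⟨w, by omega, hA⟩

/-- Advancing the bound past `w` adds only pairs that contain `w`: the induction step for a scan
that looks up the current label among those seen before. -/
theorem exists_pair_lt_succ_iff {α : Type*} {A : Fin n → Prop} (L : Fin n → α) (w : Fin n) :
    (∃ x y : Fin n, x.1 < w.1 + 1 ∧ y.1 < w.1 + 1 ∧ x ≠ y ∧ A x ∧ A y ∧ L x = L y) ↔
      (∃ x y : Fin n, x.1 < w.1 ∧ y.1 < w.1 ∧ x ≠ y ∧ A x ∧ A y ∧ L x = L y) ∨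
        (A w ∧ ∃ x : Fin n, x.1 < w.1 ∧ A x ∧ L x = L w) := by
  constructor
  · rintro ⟨x, y, hx, hy, hxy, hAx, hAy, hL⟩
    by_cases hxw : x = w
    · subst hxw
      exact Or.inr ⟨hAx, y, by have := Fin.val_ne_of_ne hxy; omega, hAy, hL.symm⟩
    · by_cases hyw : y = w
      · subst hyw
        exact Or.inr ⟨hAy, x, by have := Fin.val_ne_of_ne hxy; omega, hAx, hL⟩
      · have := Fin.val_ne_of_ne hxw
        have := Fin.val_ne_of_ne hyw
        exact Or.inl ⟨x, y, by omega, by omega, hxy, hAx, hAy, hL⟩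
  · rintro (⟨x, y, hx, hy, h⟩ | ⟨hA, x, hx, hAx, hL⟩)
    · exact ⟨x, y, by omega, by omega, h⟩
    · exact ⟨x, w, by omega, by omega, fun h => by simp [h] at hx, hAx, hA, hL⟩

/-- Neighbors of `u` in the same component are neighbors with the same label. Marking labels as they
occur reveals a repetition in one linear pass, without comparing pairs. -/
theorem test_spec {L : Fin n → Fin n} (hR : Ready m G) (hF : HoldsForest m G S L)
    (hu : m.reg 4 = u) :
    (∀ l : Fin n, (test.sem m).arr 7 l ≠ 0 ↔ ∃ w ∈ S, G.Adj u w ∧ L w = l) ∧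
    ((test.sem m).reg 6 ≠ 0 ↔
      ∃ x y, x ≠ y ∧ G.Adj u x ∧ G.Adj u y ∧ ConnOn G S x y) := by
  have key := Cmd.forN_rule (i := 5) (p := testBody) (m := m.setReg 6 0) (n := n)
    (fun j m' => (∀ l : Fin n, m'.arr 7 l ≠ 0 ↔
        ∃ w : Fin n, w.1 < j ∧ (w ∈ S ∧ G.Adj u w) ∧ L w = l) ∧
      (m'.reg 6 ≠ 0 ↔ ∃ x y : Fin n, x.1 < j ∧ y.1 < j ∧ x ≠ y ∧ (x ∈ S ∧ G.Adj u x) ∧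
        (y ∈ S ∧ G.Adj u y) ∧ L x = L y)) (by decide) hR.1.1 (fun _ _ _ h => h)
    ⟨fun l => (hF.clear l).trans (by simp), by simp [Mem.setReg]⟩ ?_
  · constructor
    · intro l
      refine (key.1 l).trans ⟨?_, ?_⟩
      · rintro ⟨w, -, h1, h2⟩
        exact ⟨w, h1.1, h1.2, h2⟩
      · rintro ⟨w, h1, h2, h3⟩
        exact ⟨w, w.2, ⟨h1, h2⟩, h3⟩
    · refine key.2.trans ⟨?_, ?_⟩
      · rintro ⟨x, y, -, -, hxy, hx, hy, hL⟩
        exact ⟨x, y, hxy, hx.2, hy.2, (hF.labels.eq_iff x hx.1 y hy.1).1 hL⟩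
      · rintro ⟨x, y, hxy, hx, hy, hc⟩
        exact ⟨x, y, x.2, y.2, hxy, ⟨hc.left, hx⟩, ⟨hc.right, hy⟩,
          (hF.labels.eq_iff x hc.left y hc.right).2 hc⟩
  · rintro w m' hf hw hm' ⟨h1, h2⟩
    have hR' : Ready m' G := Ready.frame (m := m.setReg 6 0) hR hf (by decide) (by decide)
      (by decide)
    have h4 : m'.reg 4 = u := (hf.1 4 (by decide)).trans hu
    have h5 : m'.arr 5 = m.arr 5 := hf.2 5 (by decide)
    have h6 : m'.arr 6 = m.arr 6 := hf.2 6 (by decide)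
    simp only [exists_lt_succ_iff, exists_pair_lt_succ_iff]
    simp only [testBody, Cmd.sem, hR'.eval_adjExpr h4 hw, Expr.eval, hw, h5, h6]
    by_cases hwS : w ∈ S
    · rw [if_neg ((hF.marks w).2 hwS), hF.label w hwS]
      by_cases hadj : G.Adj u w
      · rw [if_pos hadj, if_neg one_ne_zero]
        by_cases h7 : m'.arr 7 (L w) = 0
        · have hno := (not_congr (h1 (L w))).1 (not_not.2 h7)
          rw [if_pos h7]
          refine ⟨fun l => ?_, ?_⟩
          · simp only [Mem.setArr, Function.update_self]
            by_cases hl : l = L w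
            · subst hl
              simp [hwS, hadj]
            · rw [Function.update_of_ne (fun h => hl (Fin.ext h)), h1]
              simp [Ne.symm hl]
          · refine h2.trans ?_
            rw [or_iff_left]
            exact fun h => hno h.2
        · have hyes := (h1 (L w)).1 h7
          rw [if_neg h7]
          refine ⟨fun l => (h1 l).trans ?_, ?_⟩
          · rw [or_iff_left_of_imp]
            rintro ⟨-, rfl⟩
            exact hyes
          · simp only [Mem.setReg, Function.update_self, ne_eq, one_ne_zero, not_false_eq_true,
              true_iff]
            exact Or.inr ⟨⟨hwS, hadj⟩, hyes⟩
      · simp only [hadj, if_false, if_true, and_false, false_and, or_false]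
        exact ⟨h1, h2⟩
    · rw [if_pos (not_not.1 ((not_congr (hF.marks w)).2 hwS))]
      simp only [hwS, false_and, or_false]
      exact ⟨h1, h2⟩

theorem merge_spec {L : Fin n → Fin n} (hn : m.reg 0 = n) (hS : Marks m 5 S)
    (hL : ∀ v ∈ S, m.arr 6 v = L v) (hu : m.reg 4 = u) (huS : u ∉ S)
    (hM : ∀ l : Fin n, m.arr 7 l ≠ 0 ↔ ∃ w ∈ S, G.Adj u w ∧ L w = l) :
    Marks (merge.sem m) 5 (insert u S) ∧
      ∀ v ∈ insert u S, (merge.sem m).arr 6 v = mergeLabels G S L u v := by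
  classical
  have key := Cmd.forN_rule (i := 5) (p := .cond (.get 5 (.reg 5)) (.cond (.get 7 (.get 6 (.reg 5)))
    (.store 6 (.reg 5) (.reg 4)) .skip) .skip) (m := m) (n := n)
    (fun j m' => ∀ v ∈ S, m'.arr 6 v = if v.1 < j then mergeLabels G S L u v else L v)
    (by decide) hn (fun _ _ _ h => h) (by simpa using hL) ?_
  · simp only [merge, Cmd.sem_block_cons, Cmd.sem_block_singleton]
    have hf := Cmd.frame (.forN 5 (.cond (.get 5 (.reg 5)) (.cond (.get 7 (.get 6 (.reg 5)))
      (.store 6 (.reg 5) (.reg 4)) .skip) .skip)) m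
    revert key hf
    generalize Cmd.sem (.forN 5 (.cond (.get 5 (.reg 5)) (.cond (.get 7 (.get 6 (.reg 5)))
      (.store 6 (.reg 5) (.reg 4)) .skip) .skip)) m = m'
    intro key hf
    have h4 : m'.reg 4 = u := (hf.1 4 (by decide)).trans hu
    have h5 : Marks m' 5 S := hS.frame hf (by decide)
    have h4' : (m'.setArr 5 u 1).reg 4 = u := h4
    simp only [Cmd.sem, Expr.eval, h4, h4']
    refine ⟨h5.insert.setArr (by decide), fun v hv => ?_⟩
    simp only [Mem.setArr, Function.update_self]
    by_cases hvu : v = u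
    · subst hvu
      rw [Function.update_self, mergeLabels, if_pos (Or.inl rfl)]
    · rw [Function.update_of_ne (fun h => hvu (Fin.ext h))]
      rw [Function.update_of_ne (by decide)]
      simpa using key v ((Finset.mem_insert.1 hv).resolve_left hvu)
  · intro w m' hf hw hm' hI v hv
    have h4 : m'.reg 4 = u := (hf.1 4 (by decide)).trans hu
    have h5 : m'.arr 5 = m.arr 5 := hf.2 5 (by decide)
    have h7 : m'.arr 7 = m.arr 7 := hf.2 7 (by decide)
    have hlt : v ≠ w → (v.1 < w.1 + 1 ↔ v.1 < w.1) := fun h => by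
      have := Fin.val_ne_of_ne h
      omega
    simp only [Cmd.sem, Expr.eval, hw, h5, h7, h4]
    by_cases hwS : w ∈ S
    · have hwu : w ≠ u := fun h => huS (h ▸ hwS)
      -- The loop has not yet rewritten entry `w`, so the old label is looked up among the marks,
      -- which refer to old labels.
      rw [if_neg ((hS w).2 hwS), hI w hwS, if_neg (lt_irrefl _)]
      by_cases hMw : m.arr 7 (L w) = 0
      · rw [if_pos hMw, hI v hv]
        by_cases hvw : v = w
        · subst hvw
          rw [if_neg (lt_irrefl _), if_pos (Nat.lt_succ_self _), mergeLabels, if_neg]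
          rintro (h | h)
          · exact hwu h
          · exact (hM _).2 h hMw
        · simp only [hlt hvw]
      · rw [if_neg hMw]
        simp only [Mem.setArr, Function.update_self]
        by_cases hvw : v = w
        · subst hvw
          rw [Function.update_self, if_pos (Nat.lt_succ_self _), mergeLabels,
            if_pos (Or.inr ((hM _).1 hMw))]
        · rw [Function.update_of_ne (fun h => hvw (Fin.ext h)), hI v hv]
          simp only [hlt hvw]
    · have hvw : v ≠ w := fun h => hwS (h ▸ hv)
      rw [if_pos (not_not.1 ((not_congr (hS w)).2 hwS)), hI v hv]
      simp only [hlt hvw]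

end Forest

/-! ### Greedy growth of a forest, degrees, and flags for step 2 -/

section Forest

variable {n : ℕ} {G : SimpleGraph (Fin n)} {S B X V F : Finset (Fin n)} {m : Mem} {u : Fin n}

theorem filter_lt_succ_of_mem (hu : u ∈ B) :
    B.filter (fun v => v.1 < u.1 + 1) = insert u (B.filter (fun v => v.1 < u.1)) := by
  ext v
  simp only [Finset.mem_filter, Finset.mem_insert]
  constructor
  · rintro ⟨hv, hlt⟩
    by_cases h : v = u
    · exact Or.inl h
    · exact Or.inr ⟨hv, by have := Fin.val_ne_of_ne h; omega⟩
  · rintro (rfl | ⟨hv, hlt⟩)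
    · exact ⟨hu, by omega⟩
    · exact ⟨hv, by omega⟩

theorem filter_lt_succ_of_notMem (hu : u ∉ B) :
    B.filter (fun v => v.1 < u.1 + 1) = B.filter (fun v => v.1 < u.1) :=
  Finset.filter_congr fun v hv => by
    have := Fin.val_ne_of_ne (fun h => hu (h ▸ hv) : v ≠ u)
    omega

theorem filter_lt_self : B.filter (fun v => v.1 < n) = B :=
  Finset.filter_true_of_mem fun v _ => v.2

theorem filter_lt_zero : B.filter (fun v => v.1 < 0) = ∅ :=
  Finset.filter_false_of_mem fun _ _ => Nat.not_lt_zero _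

/-- The state of the loop `grow` when the vertices of `B` have been processed. -/
structure Growing (m₀ m : Mem) (G : SimpleGraph (Fin n)) (S B X₀ : Finset (Fin n))
    (P : Finset (Fin n) → Prop) (X : Finset (Fin n)) (L : Fin n → Fin n) : Prop where
  subset : X ⊆ B
  prop : P X
  acyclic : AcyclicOn G ((S ∪ B) \ X)
  forest : HoldsForest m G ((S ∪ B) \ X) L
  sol : HoldsSet m 3 (X₀ ∪ X)
  count : m.reg 11 = m₀.reg 11 + X.card

theorem grow_step {m₀ : Mem} {X₀ : Finset (Fin n)} {P : Finset (Fin n) → Prop}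
    {L : Fin n → Fin n} (hR : Ready m G) (hu : m.reg 4 = u)
    (hB : m.arr 10 u ≠ 0) (huS : u ∉ S) (huB : u ∉ B)
    (hP : CycleIn G ((S ∪ insert u B) \ X) u → P (insert u X))
    (h : Growing m₀ m G S B X₀ P X L) :
    ∃ X' L', Growing m₀ (growBody.sem m) G S (insert u B) X₀ P X' L' := by
  have huX : u ∉ X := fun h' => huB (h.subset h')
  have huT : u ∉ (S ∪ B) \ X := by simp [huS, huB]
  obtain ⟨ht7, ht6⟩ := test_spec hR h.forest hu
  have hm1 := test.frame m
  have hu1 : (test.sem m).reg 4 = u := (hm1.1 4 (by decide)).trans hu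
  have h0 : (test.sem m).reg 0 = n := (hm1.1 0 (by decide)).trans hR.1.1
  have h11 : (test.sem m).reg 11 = m₀.reg 11 + X.card := (hm1.1 11 (by decide)).trans h.count
  have hsol1 : HoldsSet (test.sem m) 3 (X₀ ∪ X) := h.sol.frame hm1 (by decide)
  have hmk1 : Marks (test.sem m) 5 ((S ∪ B) \ X) := h.forest.marks.frame hm1 (by decide)
  have hlb1 : ∀ v ∈ (S ∪ B) \ X, (test.sem m).arr 6 v = L v := fun v hv => by
    rw [hm1.2 6 (by decide)]
    exact h.forest.label v hv
  have hT : insert u ((S ∪ B) \ X) = (S ∪ insert u B) \ X := by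
    rw [Finset.union_insert, Finset.insert_sdiff_of_notMem _ huX]
  simp only [growBody, Cmd.sem, Expr.eval, hu, if_neg hB, Cmd.sem_block_cons,
    Cmd.sem_block_singleton]
  clear hm1
  revert ht7 ht6 hu1 h0 h11 hsol1 hmk1 hlb1
  generalize test.sem m = m1
  intro ht7 ht6 hu1 h0 h11 hsol1 hmk1 hlb1
  by_cases h6 : m1.reg 6 = 0
  · simp only [h6, if_true]
    obtain ⟨hg1, hg2⟩ := merge_spec h0 hmk1 hlb1 hu1 huT ht7
    have hm2 := merge.frame m1
    refine ⟨X, mergeLabels G ((S ∪ B) \ X) L u, h.subset.trans (Finset.subset_insert _ _), h.prop,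
      ?_, ?_, ?_, ?_⟩
    · rw [← hT]
      exact h.acyclic.insert fun x _ y _ hxy hx hy hc => ht6.2 ⟨x, y, hxy, hx, hy, hc⟩ h6
    · rw [← hT]
      exact ⟨hg1.sem (by decide), fun v hv => by rw [Cmd.sem_arr (by decide), hg2 v hv],
        h.forest.labels.merge huT, zeroArr_marks (by decide) ((hm2.1 0 (by decide)).trans h0)⟩
    · exact (hsol1.frame hm2 (by decide)).sem (by decide)
    · rw [Cmd.sem_reg (by decide), hm2.1 11 (by decide), h11]
  · simp only [h6, if_false]
    obtain ⟨x, y, hxy, hx, hy, hc⟩ := ht6.1 h6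
    have hT' : (S ∪ insert u B) \ insert u X = (S ∪ B) \ X := by
      rw [Finset.union_insert, Finset.insert_sdiff_insert, Finset.sdiff_insert_of_notMem]
      simp [huS, huB]
    refine ⟨insert u X, L, Finset.insert_subset_insert _ h.subset, hP ?_, ?_, ?_, ?_, ?_⟩
    · rw [← hT]
      exact CycleIn.of_connOn huT hxy hx hy hc
    · rw [hT']
      exact h.acyclic
    · rw [hT']
      refine ⟨Marks.sem ?_ (by decide), fun v hv => ?_, h.forest.labels,
        zeroArr_marks (by decide) h0⟩
      · exact (hmk1.setArr (by decide) : Marks (m1.setArr 3 (m1.reg 4) 1) 5 _)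
      · rw [Cmd.sem_arr (by decide)]
        exact hlb1 v hv
    · refine HoldsSet.sem ?_ (by decide)
      rw [Finset.union_insert, hu1]
      exact hsol1.insert
    · rw [Cmd.sem_reg (by decide), Finset.card_insert_of_notMem huX, ← add_assoc, ← h11]
      simp [Mem.setReg, Mem.setArr]

/-- Relabeling costs linear time per vertex, quadratic in all. The predicate `P` collects what the
caller needs to know about the rejected vertices: that there are none in `label_spec`, and that they
form the beginning of a run of the cycle loop in `cycles_spec`. A cycle closed by a rejected vertex
consists of processed vertices, so it also lies in the full set `(S ∪ B) \ X`. -/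
theorem grow_spec {X₀ : Finset (Fin n)} (P : Finset (Fin n) → Prop) {L : Fin n → Fin n}
    (hR : Ready m G) (hF : HoldsForest m G S L) (hB : Marks m 10 B) (hSB : Disjoint S B)
    (hac : AcyclicOn G S) (hX₀ : HoldsSet m 3 X₀) (hP0 : P ∅)
    (hP : ∀ X u, P X → u ∈ B → u ∉ X → CycleIn G ((S ∪ B) \ X) u → P (insert u X)) :
    ∃ X L', Growing m (grow.sem m) G S B X₀ P X L' := by
  have := Cmd.forN_rule (i := 4) (p := growBody) (m := m) (n := n)
    (fun j m' => ∃ X L', Growing m m' G S (B.filter (fun v => v.1 < j)) X₀ P X L')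
    (by decide) hR.1.1 ?_ ?_ ?_
  · rwa [filter_lt_self] at this
  · rintro j m' c ⟨X, L', h⟩
    exact ⟨X, L', h.subset, h.prop, h.acyclic,
      ⟨h.forest.marks, h.forest.label, h.forest.labels, h.forest.clear⟩, h.sol, h.count⟩
  · rw [filter_lt_zero]
    have hS : (S ∪ ∅) \ ∅ = S := by simp
    refine ⟨∅, L, subset_rfl, hP0, ?_, ?_, ?_, by simp⟩
    · rwa [hS]
    · rwa [hS]
    · simpa using hX₀
  · rintro u m' hf hu hm' ⟨X, L', h⟩
    have hR' : Ready m' G := hR.frame hf (by decide) (by decide) (by decide)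
    have hB' : Marks m' 10 B := hB.frame hf (by decide)
    by_cases huB : u ∈ B
    · rw [filter_lt_succ_of_mem huB]
      refine grow_step hR' hu ((hB' u).2 huB) (fun h' => Finset.disjoint_left.1 hSB h' huB)
        (by simp) (fun hc => hP X u h.prop huB (fun h' => ?_) (hc.mono ?_)) h
      · simpa using h.subset h'
      · refine Finset.sdiff_subset_sdiff (Finset.union_subset_union subset_rfl ?_) subset_rfl
        exact Finset.insert_subset huB (Finset.filter_subset _ _)
    · rw [filter_lt_succ_of_notMem huB]
      refine ⟨X, L', ?_⟩
      have h0 : m'.arr 10 u = 0 := not_not.1 ((not_congr (hB' u)).2 huB)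
      simpa only [growBody, Cmd.sem, Expr.eval, hu, h0, if_true] using h

/-- Copy one array into another. -/
def copyArr (i a b : ℕ) : Cmd := .forN i (.store b (.reg i) (.get a (.reg i)))

theorem copyArr_spec {i a b : ℕ} (hi : i ≠ 0) (hab : a ≠ b) (hn : m.reg 0 = n)
    (h : HoldsSet m a S) : HoldsSet ((copyArr i a b).sem m) b S := by
  intro v
  rw [← h v]
  refine Cmd.forN_store_rule (n := n) (fun v => m.arr a v) hi hn (fun u m' hf hu _ => ?_) v
  have : a ∉ (Cmd.forN i (.store b (.reg i) (.get a (.reg i)))).arrs := by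
    simpa [Cmd.arrs] using hab
  simp [Expr.eval, hu, hf.2 a this]

/-- Label the components of the forest induced by the set in array 2. -/
def label : Cmd := .block [zeroArr 4 5, copyArr 4 2 10, grow]

/-- The forest is grown from the empty set through `F`; as `F` is acyclic, no vertex is ever
rejected. -/
theorem label_spec {X₀ : Finset (Fin n)} (hR : Ready m G) (hF : HoldsSet m 2 F)
    (hac : AcyclicOn G F) (h7 : Marks m 7 (∅ : Finset (Fin n))) (hX₀ : HoldsSet m 3 X₀) :
    HoldsSet (label.sem m) 3 X₀ ∧ ∃ L, HoldsForest (label.sem m) G F L := by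
  simp only [label, Cmd.sem_block_cons, Cmd.sem_block_singleton]
  have hR1 : Ready ((zeroArr 4 5).sem m) G := hR.sem (by decide) (by decide) (by decide)
  have h51 := zeroArr_marks (m := m) (a := 5) (i := 4) (n := n) (by decide) hR.1.1
  have hF1 : HoldsSet ((zeroArr 4 5).sem m) 2 F := hF.sem (by decide)
  have h71 : Marks ((zeroArr 4 5).sem m) 7 (∅ : Finset (Fin n)) := h7.sem (by decide)
  have hX1 : HoldsSet ((zeroArr 4 5).sem m) 3 X₀ := hX₀.sem (by decide)
  revert hR1 h51 hF1 h71 hX1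
  generalize (zeroArr 4 5).sem m = m1
  intro hR1 h51 hF1 h71 hX1
  have hB := copyArr_spec (b := 10) (i := 4) (by decide) (by decide) hR1.1.1 hF1
  obtain ⟨X, L, h⟩ := grow_spec (m := (copyArr 4 2 10).sem m1) (S := ∅) (B := F) (X₀ := X₀)
    (L := id) (fun X => X = ∅) (hR1.sem (by decide) (by decide) (by decide))
    ⟨h51.sem (by decide), by simp, ⟨by simp, by simp⟩, h71.sem (by decide)⟩ hB.marks
    (Finset.disjoint_empty_left _) acyclicOn_empty (hX1.sem (by decide)) rfl
    (fun X u hX hu _ hc => by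
      subst hX
      simp only [Finset.empty_union, Finset.sdiff_empty] at hc
      exact absurd hc (acyclicOn_iff.1 hac u))
  obtain rfl := h.prop
  have h1 := h.forest
  have h2 := h.sol
  simp only [Finset.empty_union, Finset.sdiff_empty, Finset.union_empty] at h1 h2
  exact ⟨h2, L, h1⟩

/-- Compute the offsets of the rows of the adjacency matrix. -/
def rows : Cmd := .block [.assign 9 (.const 0), .forN 4 (.block [.store 9 (.reg 4) (.reg 9),
  .assign 9 (.add (.reg 9) (.reg 0))])]

/-- The machine cannot multiply, so the offsets `u * n` are obtained by repeated addition. -/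
theorem rows_spec (h : HoldsGraph m G) : Ready (rows.sem m) G := by
  refine ⟨⟨(Cmd.sem_reg (by decide)).trans h.1, fun u v => ?_⟩, ?_⟩
  · rw [Cmd.sem_arr (by decide)]
    exact h.2 u v
  · have := Cmd.forN_rule (i := 4) (p := .block [.store 9 (.reg 4) (.reg 9),
      .assign 9 (.add (.reg 9) (.reg 0))]) (m := m.setReg 9 0) (n := n)
      (fun j m' => m'.reg 9 = j * n ∧ ∀ u : Fin n, u.1 < j → m'.arr 9 u = u * n)
      (by decide) h.1 (fun _ _ _ h => h) ⟨by simp [Mem.setReg], by simp⟩ ?_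
    · exact fun u => this.2 u u.2
    · rintro u m' hf hu hm' ⟨h1, h2⟩
      simp only [Cmd.sem_block_cons, Cmd.sem_block_singleton, Cmd.sem, Expr.eval, hu]
      refine ⟨?_, fun v hv => ?_⟩
      · simp only [Mem.setReg, Mem.setArr, Function.update_self, h1, hm']
        ring
      · simp only [Mem.setReg, Mem.setArr, Function.update_self, h1]
        by_cases hvu : v = u
        · subst hvu
          rw [Function.update_self]
        · have := Fin.val_ne_of_ne hvu
          rw [Function.update_of_ne this, h2 v (by omega)]

/-- Count in register 9 the neighbors of the vertex in register 4. -/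
def countBody : Cmd := .cond (.get 1 (.reg 5)) (.cond (adjExpr 4 5)
  (.assign 9 (.add (.reg 9) (.const 1))) .skip) .skip

/-- Compute the degrees in the subgraph induced by the set in array 1. -/
def degrees : Cmd := .forN 4 (.block [.assign 9 (.const 0), .forN 5 countBody,
  .store 4 (.reg 4) (.reg 9)])

theorem count_spec (hR : Ready m G) (hV : Marks m 1 V) (hu : m.reg 4 = u) (h9 : m.reg 9 = 0) :
    ((Cmd.forN 5 countBody).sem m).reg 9 = degIn G V u := by
  have := Cmd.forN_rule (i := 5) (p := countBody) (m := m) (n := n)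
    (fun j m' => m'.reg 9 = degIn G (V.filter (fun v => v.1 < j)) u) (by decide) hR.1.1
    (fun _ _ _ h => h) (by rw [filter_lt_zero]; simpa [degIn] using h9) ?_
  · rwa [filter_lt_self] at this
  · intro w m' hf hw hm' hI
    have hR' : Ready m' G := hR.frame hf (by decide) (by decide) (by decide)
    have h4 : m'.reg 4 = u := (hf.1 4 (by decide)).trans hu
    have h1 : m'.arr 1 = m.arr 1 := hf.2 1 (by decide)
    simp only [countBody, Cmd.sem, hR'.eval_adjExpr h4 hw, Expr.eval, hw, h1]
    by_cases hwV : w ∈ V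
    · have hw' : w ∉ V.filter (fun v => v.1 < w.1) := by simp
      rw [filter_lt_succ_of_mem hwV, degIn_insert hw', if_neg ((hV w).2 hwV), ← hI]
      by_cases hadj : G.Adj u w
      · simp [hadj, Mem.setReg]
      · simp [hadj]
    · rw [filter_lt_succ_of_notMem hwV, if_pos (not_not.1 ((not_congr (hV w)).2 hwV)), ← hI]

theorem degrees_spec (hR : Ready m G) (hV : Marks m 1 V) (v : Fin n) :
    (degrees.sem m).arr 4 v = degIn G V v := by
  refine Cmd.forN_rule (i := 4) (p := .block [.assign 9 (.const 0), .forN 5 countBody,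
    .store 4 (.reg 4) (.reg 9)]) (m := m) (n := n)
    (fun j m' => ∀ v : Fin n, v.1 < j → m'.arr 4 v = degIn G V v) (by decide) hR.1.1
    (fun _ _ _ h => h) (by simp) ?_ v v.2
  intro u m' hf hu hm' hI v hv
  simp only [Cmd.sem_block_cons, Cmd.sem_block_singleton]
  have hR' : Ready m' G := hR.frame hf (by decide) (by decide) (by decide)
  have hc := count_spec (m := m'.setReg 9 0) (u := u) hR'
    (hV.frame hf (by decide) : Marks m' 1 V) hu rfl
  have h4 : ((Cmd.forN 5 countBody).sem (m'.setReg 9 0)).reg 4 = u :=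
    (Cmd.sem_reg (by decide)).trans hu
  have h4' : ((Cmd.forN 5 countBody).sem (m'.setReg 9 0)).arr 4 = m'.arr 4 :=
    Cmd.sem_arr (by decide)
  rw [show (Cmd.assign 9 (.const 0)).sem m' = m'.setReg 9 0 from rfl]
  generalize (Cmd.forN 5 countBody).sem (m'.setReg 9 0) = m2 at hc h4 h4' ⊢
  simp only [Cmd.sem, Expr.eval, Mem.setArr, Function.update_self, hc, h4, h4']
  by_cases hvu : v = u
  · subst hvu
    rw [Function.update_self]
  · have := Fin.val_ne_of_ne hvu
    rw [Function.update_of_ne this, hI v (by omega)]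

/-- Flag in array 8 the vertex in register 4 if it has two neighbors in one component of the labeled
forest. -/
def flagBody : Cmd := .cond (.get 1 (.reg 4)) (.cond (.get 2 (.reg 4)) .skip
  (.block [test, .store 8 (.reg 4) (.reg 6), zeroArr 5 7])) .skip

/-- Compute the flags of all vertices. -/
def flags : Cmd := .block [zeroArr 4 8, .forN 4 flagBody]

theorem flags_spec {L : Fin n → Fin n} {I : Inst n} (hR : Ready m G)
    (hF : HoldsForest m G I.F L) (h1 : HoldsSet m 1 I.V) (h2 : HoldsSet m 2 I.F) :
    (∀ v : Fin n, (flags.sem m).arr 8 v ≠ 0 ↔ I.Forced G v) ∧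
      Marks (flags.sem m) 7 (∅ : Finset (Fin n)) := by
  simp only [flags, Cmd.sem_block_cons, Cmd.sem_block_singleton]
  have hR0 : Ready ((zeroArr 4 8).sem m) G := hR.sem (by decide) (by decide) (by decide)
  have := Cmd.forN_rule (i := 4) (p := flagBody) (m := (zeroArr 4 8).sem m) (n := n)
    (fun j m' => (∀ v : Fin n, m'.arr 8 v ≠ 0 ↔ v.1 < j ∧ I.Forced G v) ∧
      HoldsForest m' G I.F L) (by decide) hR0.1.1
    (fun _ _ _ h => ⟨h.1, h.2.marks, h.2.label, h.2.labels, h.2.clear⟩) ?_ ?_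
  · exact ⟨fun v => (this.1 v).trans (and_iff_right v.2), this.2.clear⟩
  · refine ⟨fun v => ?_, hF.marks.sem (by decide), fun v hv => ?_, hF.labels,
      hF.clear.sem (by decide)⟩
    · simp [zeroArr_spec (m := m) (a := 8) (i := 4) (by decide) hR.1.1 v]
    · rw [Cmd.sem_arr (by decide)]
      exact hF.label v hv
  · rintro u m' hf hu hm' ⟨hI, hF'⟩
    have hR' : Ready m' G := hR0.frame hf (by decide) (by decide) (by decide)
    have h1' : Marks m' 1 I.V := ((h1.sem (by decide)).frame hf (by decide)).marks
    have h2' : Marks m' 2 I.F := ((h2.sem (by decide)).frame hf (by decide)).marks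
    have hskip : ¬ I.Forced G u → ∀ v : Fin n, m'.arr 8 v ≠ 0 ↔ v.1 < u.1 + 1 ∧ I.Forced G v := by
      intro hno v
      rw [hI]
      by_cases hvu : v = u
      · subst hvu
        simp [hno]
      · have := Fin.val_ne_of_ne hvu
        have : v.1 < u.1 + 1 ↔ v.1 < u.1 := by omega
        rw [this]
    simp only [flagBody, Cmd.sem, Expr.eval, hu]
    by_cases hV : u ∈ I.V
    · rw [if_neg ((h1' u).2 hV)]
      by_cases hFu : u ∈ I.F
      · rw [if_neg ((h2' u).2 hFu)]
        exact ⟨hskip fun h => (Finset.mem_sdiff.1 h.1).2 hFu, hF'⟩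
      · rw [if_pos (not_not.1 ((not_congr (h2' u)).2 hFu))]
        simp only [Cmd.sem_block_cons, Cmd.sem_block_singleton, Cmd.sem]
        obtain ⟨-, ht6⟩ := test_spec hR' hF' hu
        have hft := test.frame m'
        have hu1 : (test.sem m').reg 4 = u := (hft.1 4 (by decide)).trans hu
        have h0 : (test.sem m').reg 0 = n := (hft.1 0 (by decide)).trans hm'
        refine ⟨fun v => ?_, Marks.sem ?_ (by decide), fun v hv => ?_, hF.labels,
          zeroArr_marks (by decide) h0⟩
        · rw [Cmd.sem_arr (by decide)]
          simp only [Expr.eval, hu1, Mem.setArr, Function.update_self]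
          by_cases hvu : v = u
          · subst hvu
            rw [Function.update_self, ht6, forced_iff]
            simp [hV, hFu]
          · have := Fin.val_ne_of_ne hvu
            rw [Function.update_of_ne this, hft.2 8 (by decide), hI]
            have : v.1 < u.1 + 1 ↔ v.1 < u.1 := by omega
            rw [this]
        · exact (hF'.marks.frame hft (by decide)).setArr (by decide)
        · rw [Cmd.sem_arr (by decide), setArr_arr_of_ne (by decide), hft.2 6 (by decide)]
          exact hF'.label v hv
    · rw [if_pos (not_not.1 ((not_congr (h1' u)).2 hV))]
      exact ⟨hskip fun h => hV (Finset.mem_sdiff.1 h.1).1, hF'⟩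

end Forest

/-! ### Steps 1 and 2 -/

/-- Add a set of vertices to the solution ("no" stays "no"). -/
def Outcome.addSet {n : ℕ} (D : Finset (Fin n)) : Outcome n → Outcome n
  | .answer r => .answer (r.map (D ∪ ·))
  | .branch D' E w => .branch (D ∪ D') E w

section Reduce

variable {n : ℕ} {G : SimpleGraph (Fin n)} {V F D S₀ : Finset (Fin n)} {m : Mem} {u v w : Fin n}
  {I J : Inst n}

theorem Outcome.addSet_addVertex (o : Outcome n) :
    (o.addVertex v).addSet D = o.addSet (insert v D) := by
  cases o with
  | answer r => cases r <;> simp [addVertex, addSet]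
  | branch => simp [addVertex, addSet]

/-- From the instance `I`, steps 1 and 2 may lead to `J`, with `D` put into the solution. -/
structure Link (G : SimpleGraph (Fin n)) (I : Inst n) (D : Finset (Fin n)) (J : Inst n) :
    Prop where
  F_subset : J.F ⊆ I.F
  run : ∀ o, NodeRun G J o → NodeRun G I (o.addSet D)

theorem Link.refl : Link G I ∅ I := by
  refine ⟨subset_rfl, fun o h => ?_⟩
  cases o with
  | answer r => cases r <;> simpa [Outcome.addSet] using h
  | branch => simpa [Outcome.addSet] using h

theorem Link.discard (h : Link G I D J) (hk : 0 ≤ J.k) (hv : J.Low G v) :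
    Link G I D (J.discard v) :=
  ⟨(Finset.erase_subset _ _).trans h.F_subset, fun o ho => h.run o (.low J v o hk hv ho)⟩

theorem Link.take (h : Link G I D J) (hk : 0 ≤ J.k) (h1 : ∀ w, ¬ J.Low G w)
    (hv : J.Forced G v) : Link G I (insert v D) (J.take v) := by
  refine ⟨h.F_subset, fun o ho => ?_⟩
  rw [← Outcome.addSet_addVertex]
  exact h.run _ (.forced J v o hk h1 hv ho)

/-- This keeps the flags valid without recomputation. By `ConnOn.erase`, connections in `F` between
other vertices do not need `v`. Nor is `v` one of the two connected neighbors of `w`: besides `w ∉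
F` it would have a neighbor in `F`, hence degree at least two. -/
theorem Inst.Low.forced_discard_iff (hF : J.F ⊆ J.V) (hv : J.Low G v) (hw : w ≠ v) :
    (J.discard v).Forced G w ↔ J.Forced G w := by
  rw [forced_iff, forced_iff]
  constructor
  · rintro ⟨h, x, y, hxy, hx, hy, hc⟩
    refine ⟨?_, x, y, hxy, hx, hy, hc.mono (Finset.erase_subset _ _)⟩
    simp only [Inst.discard, Finset.mem_sdiff, Finset.mem_erase] at h ⊢
    tauto
  · rintro ⟨h, x, y, hxy, hx, hy, hc⟩
    have hne : ∀ x y, x ≠ y → G.Adj w x → ConnOn G J.F x y → x ≠ v := by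
      rintro x y hxy hx hc rfl
      obtain ⟨z, hz, hxz⟩ := hc.exists_adj hxy
      have hwz : w ≠ z := fun h' => (Finset.mem_sdiff.1 h).2 (h' ▸ hz)
      exact absurd (two_le_degIn hwz (Finset.mem_sdiff.1 h).1 (hF hz) hx.symm hxz)
        (not_le.2 hv.2)
    refine ⟨?_, x, y, hxy, hx, hy, hc.erase ((degIn_mono hF).trans_lt hv.2)
      (hne x y hxy hx hc) (hne y x hxy.symm hy hc.symm)⟩
    simp only [Inst.discard, Finset.mem_sdiff, Finset.mem_erase] at h ⊢
    tauto

/-- Being forced depends on the neighbors in `F`, and `take` leaves `F` alone; so the flags of other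
vertices stay valid. -/
theorem forced_take_iff (hw : w ≠ v) : (J.take v).Forced G w ↔ J.Forced G w := by
  rw [forced_iff, forced_iff]
  simp only [Inst.take, Finset.mem_sdiff, Finset.mem_erase, hw, ne_eq, not_false_eq_true, true_and]

/-- Look for an element of the set in array 1 that satisfies a condition. -/
def find (i t : ℕ) (e : Expr) : Cmd :=
  .forN i (.cond (.get 1 (.reg i)) (.cond e (.assign t (.reg i)) .skip) .skip)

theorem find_spec {i t : ℕ} {e : Expr} (Q : Fin n → Prop) (hwf : (find i t e).wf) (hti : t ≠ i)
    (hn : m.reg 0 = n) (hV : Marks m 1 V)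
    (he : ∀ (u : Fin n) m', (find i t e).Frame m m' → m'.reg i = u → (e.eval m' ≠ 0 ↔ Q u)) :
    (∃ u ∈ V, Q u ∧ ((find i t e).sem m).reg t = u) ∨
      ((∀ u ∈ V, ¬ Q u) ∧ ((find i t e).sem m).reg t = m.reg t) := by
  have := Cmd.forN_rule (m := m) (n := n)
    (fun j m' => (∃ u ∈ V, Q u ∧ m'.reg t = u) ∨
      ((∀ u ∈ V, u.1 < j → ¬ Q u) ∧ m'.reg t = m.reg t)) hwf hn ?_ (by simp) ?_
  · exact this.imp_right fun h => ⟨fun u hu => h.1 u hu u.2, h.2⟩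
  · intro j m' c h
    rwa [Cmd.setReg_reg_of_ne hti]
  · intro u m' hf hu hm' hI
    have h1 : m'.arr 1 = m.arr 1 := hf.2 1 (by simp [Cmd.arrs])
    have he := he u m' hf hu
    simp only [Cmd.sem, Expr.eval, hu, h1]
    have hskip : ¬ (u ∈ V ∧ Q u) → (∃ u ∈ V, Q u ∧ m'.reg t = u) ∨
        ((∀ v ∈ V, v.1 < u.1 + 1 → ¬ Q v) ∧ m'.reg t = m.reg t) := fun hno =>
      hI.imp_right fun h => ⟨fun v hv hlt hQ => by
        by_cases hvu : v = u
        · exact hno (hvu ▸ ⟨hv, hQ⟩)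
        · have := Fin.val_ne_of_ne hvu
          exact h.1 v hv (by omega) hQ, h.2⟩
    by_cases hVu : u ∈ V
    · rw [if_neg ((hV u).2 hVu)]
      by_cases hQ : Q u
      · rw [if_neg (he.2 hQ)]
        exact Or.inl ⟨u, hVu, hQ, by simp [Mem.setReg]⟩
      · rw [if_pos (not_not.1 ((not_congr he).2 hQ))]
        exact hskip fun h => hQ h.2
    · rw [if_pos (not_not.1 ((not_congr (hV u)).2 hVu))]
      exact hskip fun h => hVu h.1

/-- Delete the vertex in register `t` and update the degrees. -/
def delete (t : ℕ) : Cmd := .block [.store 1 (.reg t) (.const 0), .store 2 (.reg t) (.const 0),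
  .forN 4 (.store 4 (.reg 4) (.sub (.get 4 (.reg 4)) (adjExpr t 4)))]

theorem delete_spec {t : ℕ} (ht : t ≠ 4) (hR : Ready m G) (hV : HoldsSet m 1 V)
    (hF : HoldsSet m 2 F) (hd : ∀ v : Fin n, m.arr 4 v = degIn G V v) (hu : m.reg t = u)
    (huV : u ∈ V) :
    HoldsSet ((delete t).sem m) 1 (V.erase u) ∧ HoldsSet ((delete t).sem m) 2 (F.erase u) ∧
      ∀ v : Fin n, ((delete t).sem m).arr 4 v = degIn G (V.erase u) v := by
  classical
  simp only [delete, Cmd.sem_block_cons, Cmd.sem_block_singleton]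
  have h1 : (Cmd.store 2 (.reg t) (.const 0)).sem ((Cmd.store 1 (.reg t) (.const 0)).sem m)
      = (m.setArr 1 u 0).setArr 2 u 0 := by
    simp only [Cmd.sem, Expr.eval, hu]
    rw [show (m.setArr 1 u 0).reg t = u from hu]
  rw [h1]
  have hR1 : Ready ((m.setArr 1 u 0).setArr 2 u 0) G := by
    refine ⟨⟨hR.1.1, fun u v => ?_⟩, fun u => ?_⟩
    · rw [setArr_arr_of_ne (by decide), setArr_arr_of_ne (by decide)]
      exact hR.1.2 u v
    · rw [setArr_arr_of_ne (by decide), setArr_arr_of_ne (by decide)]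
      exact hR.2 u
  have hV1 : HoldsSet ((m.setArr 1 u 0).setArr 2 u 0) 1 (V.erase u) :=
    hV.erase.setArr (by decide)
  have hF1 : HoldsSet ((m.setArr 1 u 0).setArr 2 u 0) 2 (F.erase u) :=
    (hF.setArr (by decide)).erase
  refine ⟨hV1.sem (by simp [Cmd.arrs]), hF1.sem (by simp [Cmd.arrs]), fun v => ?_⟩
  refine Cmd.forN_store_rule (n := n) (fun v => degIn G (V.erase u) v) (by decide) hR1.1.1
    (fun w m' hf hw hm' => ?_) v
  have hR' : Ready m' G := hR1.frame hf (by simp [Cmd.regs]) (by simp [Cmd.arrs])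
    (by simp [Cmd.arrs])
  have hu' : m'.reg t = u := (hf.1 t (by simpa [Cmd.regs] using ht)).trans hu
  have hw' : m'.arr 4 w = degIn G V w := by
    rw [hm', setArr_arr_of_ne (by decide), setArr_arr_of_ne (by decide), hd]
  simp only [Expr.eval, hR'.eval_adjExpr hu' hw, hw, hw']
  rw [degIn_erase_add huV, G.adj_comm w u]
  simp

/-- One application of step 1 or of step 2. Register 10 is set if neither applies, and registers 10
and 13 are set if the parameter becomes negative. -/
def reduceStep : Cmd := .cond (.reg 10) .skip (.block [
  .assign 7 (.reg 0), .assign 8 (.reg 0), find 4 7 (.get 8 (.reg 4)),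
  find 4 8 (.sub (.const 2) (.get 4 (.reg 4))),
  .cond (.sub (.reg 0) (.reg 8)) (delete 8)
    (.cond (.sub (.reg 0) (.reg 7))
      (.cond (.reg 1)
        (.block [delete 7, .assign 1 (.sub (.reg 1) (.const 1)), .store 3 (.reg 7) (.const 1)])
        (.block [.assign 13 (.const 1), .assign 10 (.const 1)]))
      (.assign 10 (.const 1)))])

/-- Apply steps 1 and 2 exhaustively. -/
def reduce : Cmd := .block [.assign 10 (.const 0), .assign 13 (.const 0), .forN 12 reduceStep]

/-- The memory during the application of steps 1 and 2. -/
structure Reducing (m : Mem) (G : SimpleGraph (Fin n)) (J : Inst n) (X : Finset (Fin n)) :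
    Prop where
  ready : Ready m G
  inst : HoldsInst m J
  sol : HoldsSet m 3 X
  deg : ∀ v : Fin n, m.arr 4 v = degIn G J.V v
  flag : ∀ v : Fin n, v ∈ J.V → (m.arr 8 v ≠ 0 ↔ J.Forced G v)
  subset : J.F ⊆ J.V
  clear : Marks m 7 (∅ : Finset (Fin n))

theorem Reducing.frame {c : Cmd} {m' : Mem} {X : Finset (Fin n)} (h : Reducing m G J X)
    (hf : c.Frame m m') (h0 : 0 ∉ c.regs) (h1 : 1 ∉ c.regs)
    (ha : ∀ a ∈ [0, 1, 2, 3, 4, 7, 8, 9], a ∉ c.arrs) : Reducing m' G J X where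
  ready := h.ready.frame hf h0 (ha _ (by decide)) (ha _ (by decide))
  inst := ⟨by rw [hf.1 1 h1]; exact h.inst.1, h.inst.2.1.frame hf (ha _ (by decide)),
    h.inst.2.2.frame hf (ha _ (by decide))⟩
  sol := h.sol.frame hf (ha _ (by decide))
  deg v := by rw [hf.2 4 (ha _ (by decide))]; exact h.deg v
  flag v := by rw [hf.2 8 (ha _ (by decide))]; exact h.flag v
  subset := h.subset
  clear := h.clear.frame hf (ha _ (by decide))

theorem Reducing.setReg {X : Finset (Fin n)} {x c : ℕ} (h : Reducing m G J X)
    (h0 : x ≠ 0) (h1 : x ≠ 1) : Reducing (m.setReg x c) G J X where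
  ready := ⟨⟨by rw [Cmd.setReg_reg_of_ne h0.symm]; exact h.ready.1.1, h.ready.1.2⟩, h.ready.2⟩
  inst := ⟨by rw [Cmd.setReg_reg_of_ne h1.symm]; exact h.inst.1, h.inst.2.1, h.inst.2.2⟩
  sol := h.sol
  deg := h.deg
  flag := h.flag
  subset := h.subset
  clear := h.clear

theorem Reducing.delete_low {X : Finset (Fin n)} (h : Reducing m G J X) (hu : J.Low G u)
    (h8 : m.reg 8 = u) : Reducing ((delete 8).sem m) G (J.discard u) X := by
  obtain ⟨h1, h2, h4⟩ := delete_spec (t := 8) (by decide) h.ready h.inst.2.1 h.inst.2.2 h.deg h8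
    hu.1
  refine ⟨h.ready.sem (by decide) (by decide) (by decide), ⟨?_, h1, h2⟩, h.sol.sem (by decide), h4,
    fun v hv => ?_, Finset.erase_subset_erase _ h.subset, h.clear.sem (by decide)⟩
  · rw [Cmd.sem_reg (by decide)]
    exact h.inst.1
  · rw [Cmd.sem_arr (by decide), h.flag v (Finset.mem_of_mem_erase hv),
      hu.forced_discard_iff h.subset (Finset.ne_of_mem_erase hv)]

theorem Reducing.delete_forced {X : Finset (Fin n)} (h : Reducing m G J X) (hu : J.Forced G u)
    (h7 : m.reg 7 = u) (hk : m.reg 1 ≠ 0) :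
    Reducing ((Cmd.block [delete 7, .assign 1 (.sub (.reg 1) (.const 1)),
      .store 3 (.reg 7) (.const 1)]).sem m) G (J.take u) (insert u X) := by
  have huV := Finset.mem_sdiff.1 hu.1
  obtain ⟨h1, h2, h4⟩ := delete_spec (t := 7) (by decide) h.ready h.inst.2.1 h.inst.2.2 h.deg h7
    huV.1
  simp only [Cmd.sem_block_cons, Cmd.sem_block_singleton]
  have hR := h.ready.sem (c := delete 7) (by decide) (by decide) (by decide)
  have hf := (delete 7).frame m
  have hs := h.sol.frame hf (by decide)
  have h7' := (hf.1 7 (by decide)).trans h7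
  have h1' := hf.1 1 (by decide)
  have h8' := hf.2 8 (by decide)
  have hc := h.clear.frame hf (by decide)
  clear hf
  revert h1 h2 h4 hR hs h7' h1' h8' hc
  generalize (delete 7).sem m = m'
  intro h1 h2 h4 hR hs h7' h1' h8' hc
  have he : (Cmd.store 3 (.reg 7) (.const 1)).sem
      ((Cmd.assign 1 (.sub (.reg 1) (.const 1))).sem m')
      = (m'.setReg 1 (m.reg 1 - 1)).setArr 3 u 1 := by
    simp only [Cmd.sem, Expr.eval, h1']
    rw [show (m'.setReg 1 (m.reg 1 - 1)).reg 7 = u from h7']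
  rw [he]
  -- The command `delete` also clears the entry for `F`, which changes nothing for a vertex outside
  -- `F`.
  rw [Finset.erase_eq_of_notMem huV.2] at h2
  refine ⟨⟨⟨hR.1.1, hR.1.2⟩, hR.2⟩, ⟨?_, h1, h2⟩, ?_, h4, fun v hv => ?_, fun v hv => ?_, hc⟩
  · have := h.inst.1
    simp only [Mem.setReg, Mem.setArr, Function.update_self, Inst.take]
    omega
  · exact HoldsSet.insert (m := m'.setReg 1 (m.reg 1 - 1)) hs
  · change m'.arr 8 v ≠ 0 ↔ _
    rw [h8', h.flag v (Finset.mem_of_mem_erase hv), forced_take_iff (Finset.ne_of_mem_erase hv)]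
  · exact Finset.mem_erase.2 ⟨fun h => huV.2 (h ▸ hv), h.subset hv⟩

/-- The invariant of the loop of `reduce`, before `j` further iterations. -/
def ReduceInv (G : SimpleGraph (Fin n)) (I : Inst n) (S₀ : Finset (Fin n)) (j : ℕ) (m : Mem) :
    Prop :=
  (m.reg 13 = 0 ∧ ∃ D J, Link G I D J ∧ Reducing m G J (S₀ ∪ D) ∧
    (m.reg 10 = 0 → J.V.card ≤ j) ∧
    (m.reg 10 ≠ 0 → (∀ w, ¬ J.Low G w) ∧ ∀ w, ¬ J.Forced G w)) ∨
  (m.reg 13 ≠ 0 ∧ m.reg 10 ≠ 0 ∧ NodeRun G I (.answer none))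

/-- The default `n` in registers 7 and 8 is not the number of a vertex and so signals an
unsuccessful search. -/
theorem select_spec {X : Finset (Fin n)} (h : Reducing m G J X) :
    ∃ m', (Cmd.block [.assign 7 (.reg 0), .assign 8 (.reg 0), find 4 7 (.get 8 (.reg 4)),
        find 4 8 (.sub (.const 2) (.get 4 (.reg 4)))]).sem m = m' ∧ Reducing m' G J X ∧
      m'.reg 13 = m.reg 13 ∧ m'.reg 10 = m.reg 10 ∧
      ((∃ u : Fin n, m'.reg 8 = u ∧ J.Low G u) ∨ (m'.reg 8 = n ∧ (∀ w, ¬ J.Low G w) ∧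
        ((∃ u : Fin n, m'.reg 7 = u ∧ J.Forced G u) ∨ (m'.reg 7 = n ∧ ∀ w, ¬ J.Forced G w)))) := by
  simp only [Cmd.sem_block_cons, Cmd.sem_block_singleton]
  obtain ⟨m1, hm1⟩ : ∃ m1, m1 = (Cmd.assign 8 (.reg 0)).sem ((Cmd.assign 7 (.reg 0)).sem m) :=
    ⟨_, rfl⟩
  have hr1 : Reducing m1 G J X := by
    rw [hm1]
    exact (h.setReg (by decide) (by decide)).setReg (by decide) (by decide)
  have h17 : m1.reg 7 = n := by rw [hm1]; exact h.ready.1.1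
  have h18 : m1.reg 8 = n := by rw [hm1]; exact h.ready.1.1
  have h113 : m1.reg 13 = m.reg 13 := by rw [hm1]; rfl
  have h110 : m1.reg 10 = m.reg 10 := by rw [hm1]; rfl
  rw [← hm1]
  clear hm1
  have hf2 := (find 4 7 (.get 8 (.reg 4))).frame m1
  have hc2 := find_spec (i := 4) (t := 7) (e := .get 8 (.reg 4)) (n := n) (m := m1) (V := J.V)
    (fun u => m1.arr 8 u ≠ 0) (by decide) (by decide) hr1.ready.1.1 hr1.inst.2.1.marks
    (fun u m' hf hu => by simp only [Expr.eval, hu, hf.2 8 (by decide)])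
  generalize (find 4 7 (.get 8 (.reg 4))).sem m1 = m2 at hf2 hc2 ⊢
  have hr2 := hr1.frame hf2 (by decide) (by decide) (by decide)
  have hf3 := (find 4 8 (.sub (.const 2) (.get 4 (.reg 4)))).frame m2
  have hc3 := find_spec (i := 4) (t := 8) (e := .sub (.const 2) (.get 4 (.reg 4))) (n := n)
    (m := m2) (V := J.V) (fun u => degIn G J.V u < 2) (by decide) (by decide) hr2.ready.1.1
    hr2.inst.2.1.marks
    (fun u m' hf hu => by
      simp only [Expr.eval, hu, hf.2 4 (by decide), hr2.deg]
      omega)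
  generalize (find 4 8 (.sub (.const 2) (.get 4 (.reg 4)))).sem m2 = m3 at hf3 hc3 ⊢
  refine ⟨m3, rfl, hr2.frame hf3 (by decide) (by decide) (by decide), ?_, ?_, ?_⟩
  · rw [hf3.1 13 (by decide), hf2.1 13 (by decide), h113]
  · rw [hf3.1 10 (by decide), hf2.1 10 (by decide), h110]
  · rw [hf3.1 7 (by decide)]
    rcases hc3 with ⟨u, huV, hu, h8⟩ | ⟨hno, h8⟩
    · exact Or.inl ⟨u, h8, huV, hu⟩
    · refine Or.inr ⟨?_, fun w hw => hno w hw.1 hw.2, ?_⟩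
      · rw [h8, hf2.1 8 (by decide), h18]
      · rcases hc2 with ⟨u, huV, hu, h7⟩ | ⟨hno, h7⟩
        · exact Or.inl ⟨u, h7, (hr1.flag u huV).1 hu⟩
        · refine Or.inr ⟨h7.trans h17, fun w hw => ?_⟩
          have hwV := (Finset.mem_sdiff.1 hw.1).1
          exact hno w hwV ((hr1.flag w hwV).2 hw)

theorem reduceStep_spec {j : ℕ} (h : ReduceInv G I S₀ (j + 1) m) :
    ReduceInv G I S₀ j (reduceStep.sem m) := by
  by_cases h10 : m.reg 10 = 0
  · obtain ⟨h13, D, J, hl, hr, hcard, -⟩ := h.resolve_right fun h => h.2.1 h10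
    have hcard := hcard h10
    obtain ⟨m', hm', hr', h13', h10', hcase⟩ := select_spec hr
    have hsem : reduceStep.sem m = (Cmd.cond (.sub (.reg 0) (.reg 8)) (delete 8)
        (.cond (.sub (.reg 0) (.reg 7))
          (.cond (.reg 1)
            (.block [delete 7, .assign 1 (.sub (.reg 1) (.const 1)), .store 3 (.reg 7) (.const 1)])
            (.block [.assign 13 (.const 1), .assign 10 (.const 1)]))
          (.assign 10 (.const 1)))).sem m' := by
      rw [← hm', reduceStep, Cmd.sem_cond_zero (e := .reg 10) h10]
      rfl
    rw [hsem]
    clear hm' hsem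
    rw [h13] at h13'
    rw [h10] at h10'
    have h0 : m'.reg 0 = n := hr'.ready.1.1
    have hk : 0 ≤ J.k := by
      have := hr'.inst.1
      omega
    have herase : ∀ u ∈ J.V, (J.V.erase u).card ≤ j := fun u hu => by
      have := Finset.card_erase_add_one hu
      omega
    rcases hcase with ⟨u, h8, hu⟩ | ⟨h8, hlow, ⟨u, h7, hu⟩ | ⟨h7, hforced⟩⟩
    · rw [Cmd.sem_cond_ne (by simp only [Expr.eval, h0, h8]; have := u.2; omega)]
      refine Or.inl ⟨?_, D, J.discard u, hl.discard hk hu, hr'.delete_low hu h8,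
        fun _ => herase u hu.1, fun h => absurd ?_ h⟩
      · rw [Cmd.sem_reg (by decide), h13']
      · rw [Cmd.sem_reg (by decide), h10']
    · rw [Cmd.sem_cond_zero (by simp only [Expr.eval, h0, h8]; omega),
        Cmd.sem_cond_ne (by simp only [Expr.eval, h0, h7]; have := u.2; omega)]
      -- A register cannot hold the parameter `-1` that taking `u` would produce, so the answer "no"
      -- is recorded in register 13 instead.
      by_cases h1 : m'.reg 1 = 0
      · rw [Cmd.sem_cond_zero (e := .reg 1) h1]
        refine Or.inr ⟨?_, ?_, ?_⟩
        · simp [Cmd.sem_block_cons, Cmd.sem_block_singleton, Cmd.sem, Expr.eval, Mem.setReg]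
        · simp [Cmd.sem_block_cons, Cmd.sem_block_singleton, Cmd.sem, Expr.eval, Mem.setReg]
        · refine (hl.take hk hlow hu).run (.answer none) (.neg _ ?_)
          have := hr'.inst.1
          simp only [Inst.take]
          omega
      · rw [Cmd.sem_cond_ne (e := .reg 1) h1]
        have hr2 := hr'.delete_forced hu h7 h1
        refine Or.inl ⟨?_, insert u D, J.take u, hl.take hk hlow hu, ?_,
          fun _ => herase u (Finset.mem_sdiff.1 hu.1).1, fun h => absurd ?_ h⟩
        · rw [Cmd.sem_reg (by decide), h13']
        · rwa [Finset.union_insert]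
        · rw [Cmd.sem_reg (by decide), h10']
    · rw [Cmd.sem_cond_zero (by simp only [Expr.eval, h0, h8]; omega),
        Cmd.sem_cond_zero (by simp only [Expr.eval, h0, h7]; omega)]
      exact Or.inl ⟨h13', D, J, hl, hr'.setReg (by decide) (by decide),
        fun h => by simp [Cmd.sem, Expr.eval, Mem.setReg] at h, fun _ => ⟨hlow, hforced⟩⟩
  · have : reduceStep.sem m = m := by
      rw [reduceStep, Cmd.sem_cond_ne (e := .reg 10) h10, Cmd.sem]
    rw [this]
    exact h.imp_left fun ⟨h13, D, J, hl, hr, hcard, hno⟩ =>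
      ⟨h13, D, J, hl, hr, fun h => absurd h h10, hno⟩

/-- Every reduction deletes a vertex, so `n` rounds suffice. If they end without register 10 being
set, the graph is empty and neither step applies. -/
theorem reduce_spec (h : Reducing m G I S₀) :
    (∃ D J, (reduce.sem m).reg 13 = 0 ∧ Link G I D J ∧ Reducing (reduce.sem m) G J (S₀ ∪ D) ∧
      (∀ w, ¬ J.Low G w) ∧ ∀ w, ¬ J.Forced G w) ∨
    ((reduce.sem m).reg 13 ≠ 0 ∧ NodeRun G I (.answer none)) := by
  simp only [reduce, Cmd.sem_block_cons, Cmd.sem_block_singleton]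
  have h' : Reducing ((m.setReg 10 0).setReg 13 0) G I (S₀ ∪ ∅) := by
    rw [Finset.union_empty]
    exact (h.setReg (by decide) (by decide)).setReg (by decide) (by decide)
  have key := Cmd.forN_rule (i := 12) (p := reduceStep) (m := (m.setReg 10 0).setReg 13 0) (n := n)
    (fun j m' => j ≤ n ∧ ReduceInv G I S₀ (n - j) m') (by decide) h'.ready.1.1 ?_ ?_ ?_
  · obtain ⟨-, ⟨h13, D, J, hl, hr, hcard, hno⟩ | ⟨h13, -, hno⟩⟩ := key
    · refine Or.inl ⟨D, J, h13, hl, hr, ?_⟩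
      by_cases h10 : ((Cmd.forN 12 reduceStep).sem ((m.setReg 10 0).setReg 13 0)).reg 10 = 0
      · have hV : J.V = ∅ := Finset.card_eq_zero.1 (by have := hcard h10; omega)
        refine ⟨fun w hw => ?_, fun w hw => ?_⟩
        · simpa [hV] using hw.1
        · simpa [hV] using hw.1
      · exact hno h10
    · exact Or.inr ⟨h13, hno⟩
  · rintro j m' c ⟨hj, h⟩
    refine ⟨hj, h.imp_left ?_⟩
    rintro ⟨h13, D, J, hl, hr, hcard⟩
    exact ⟨h13, D, J, hl, hr.setReg (by decide) (by decide), hcard⟩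
  · refine ⟨Nat.zero_le _, Or.inl ⟨rfl, ∅, I, Link.refl, h', fun _ => ?_, fun h => absurd rfl h⟩⟩
    simpa using Finset.card_le_univ I.V
  · rintro u m' hf hu hm' ⟨hj, hI⟩
    refine ⟨u.2, reduceStep_spec ?_⟩
    rwa [show n - (u.1 + 1) + 1 = n - u.1 by have := u.2; omega]

end Reduce

/-! ### Steps 3 and 4 -/

section Node

variable {n : ℕ} {G : SimpleGraph (Fin n)} {D S₀ X : Finset (Fin n)} {m : Mem} {u v w : Fin n}
  {I J : Inst n}

/-- Compare the degree of the vertex in register 4 with the best one so far, in register 9. -/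
def pickBody : Cmd := .cond (.get 1 (.reg 4)) (.cond (.get 2 (.reg 4)) .skip
  (.cond (.sub (.get 4 (.reg 4)) (.reg 9))
    (.block [.assign 3 (.reg 4), .assign 9 (.get 4 (.reg 4))]) .skip)) .skip

/-- Pick a vertex of maximum degree outside `F`. -/
def pick : Cmd := .block [.assign 3 (.reg 0), .assign 9 (.const 0), .forN 4 pickBody]

/-- The best degree starts at zero and must be exceeded, so isolated vertices are never picked;
after step 1 there are none. -/
theorem pick_spec (h : Reducing m G J X) :
    ((pick.sem m).reg 3 = n ∧ ∀ w ∈ J.V \ J.F, degIn G J.V w = 0) ∨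
      ∃ v, J.Greedy G v ∧ (pick.sem m).reg 3 = v ∧ (pick.sem m).reg 9 = J.deg G v := by
  have hr : Reducing ((m.setReg 3 (m.reg 0)).setReg 9 0) G J X :=
    (h.setReg (by decide) (by decide)).setReg (by decide) (by decide)
  have key := Cmd.forN_rule (i := 4) (p := pickBody) (m := (m.setReg 3 (m.reg 0)).setReg 9 0)
    (n := n) (fun j m' => (∀ w ∈ J.V \ J.F, w.1 < j → degIn G J.V w ≤ m'.reg 9) ∧
      ((m'.reg 3 = n ∧ m'.reg 9 = 0) ∨
        ∃ v ∈ J.V \ J.F, m'.reg 3 = v ∧ m'.reg 9 = degIn G J.V v)) (by decide) hr.ready.1.1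
    (fun _ _ _ h => h) ⟨by simp, Or.inl ⟨h.ready.1.1, rfl⟩⟩ ?_
  · obtain ⟨h1, ⟨h3, h9⟩ | ⟨v, hv, h3, h9⟩⟩ := key
    · refine Or.inl ⟨h3, fun w hw => ?_⟩
      have := h1 w hw w.2
      omega
    · refine Or.inr ⟨v, ⟨hv, fun w hw => ?_⟩, h3, h9⟩
      exact (h1 w hw w.2).trans h9.le
  · rintro u m' hf hu hm' ⟨h1, h3⟩
    have hr' := hr.frame hf (by decide) (by decide) (by decide)
    have hskip : (u ∈ J.V \ J.F → degIn G J.V u ≤ m'.reg 9) →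
        ∀ w ∈ J.V \ J.F, w.1 < u.1 + 1 → degIn G J.V w ≤ m'.reg 9 := fun hle w hw hlt => by
      by_cases hwu : w = u
      · subst hwu
        exact hle hw
      · have := Fin.val_ne_of_ne hwu
        exact h1 w hw (by omega)
    have hV := hr'.inst.2.1.marks u
    have hF := hr'.inst.2.2.marks u
    by_cases hVu : u ∈ J.V
    · rw [pickBody, Cmd.sem_cond_ne (by simpa only [Expr.eval, hu] using hV.2 hVu)]
      by_cases hFu : u ∈ J.F
      · rw [Cmd.sem_cond_ne (by simpa only [Expr.eval, hu] using hF.2 hFu)]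
        exact ⟨hskip fun h => absurd hFu (Finset.mem_sdiff.1 h).2, h3⟩
      · rw [Cmd.sem_cond_zero
          (by simpa only [Expr.eval, hu] using not_not.1 ((not_congr hF).2 hFu))]
        by_cases hlt : m'.reg 9 < degIn G J.V u
        · rw [Cmd.sem_cond_ne (by simp only [Expr.eval, hu, hr'.deg]; omega)]
          have hsem : (Cmd.block [.assign 3 (.reg 4), .assign 9 (.get 4 (.reg 4))]).sem m'
              = (m'.setReg 3 u).setReg 9 (degIn G J.V u) := by
            simp only [Cmd.sem_block_cons, Cmd.sem_block_singleton, Cmd.sem, Expr.eval, hu]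
            rw [show (m'.setReg 3 u).reg 4 = u from hu, ← hr'.deg]
            rfl
          rw [hsem]
          refine ⟨fun w hw hwu => ?_, Or.inr ⟨u, Finset.mem_sdiff.2 ⟨hVu, hFu⟩, rfl, rfl⟩⟩
          change degIn G J.V w ≤ degIn G J.V u
          by_cases hwu' : w = u
          · rw [hwu']
          · have := Fin.val_ne_of_ne hwu'
            exact (h1 w hw (by omega)).trans hlt.le
        · rw [Cmd.sem_cond_zero (by simp only [Expr.eval, hu, hr'.deg]; omega)]
          exact ⟨hskip fun _ => not_lt.1 hlt, h3⟩
    · rw [pickBody, Cmd.sem_cond_zero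
        (by simpa only [Expr.eval, hu] using not_not.1 ((not_congr hV).2 hVu))]
      exact ⟨hskip fun h => absurd (Finset.mem_sdiff.1 h).1 hVu, h3⟩

/-- The memory holds the outcome of a node, where vertices have been added to `S₀`. -/
def HoldsFrom (S₀ : Finset (Fin n)) (m : Mem) : Outcome n → Prop
  | .answer none => m.reg 2 = 0
  | .answer (some X) => m.reg 2 = 1 ∧ HoldsSet m 3 (S₀ ∪ X)
  | .branch D E v => m.reg 2 = 2 ∧ m.reg 3 = v ∧ HoldsSet m 3 (S₀ ∪ D) ∧ HoldsInst m E

theorem HoldsFrom.addSet {o : Outcome n} (h : HoldsFrom (S₀ ∪ D) m o) :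
    HoldsFrom S₀ m (o.addSet D) := by
  cases o with
  | answer r =>
    cases r with
    | none => exact h
    | some X => exact ⟨h.1, by rw [← Finset.union_assoc]; exact h.2⟩
  | branch D' E v => exact ⟨h.1, h.2.1, by rw [← Finset.union_assoc]; exact h.2.2.1, h.2.2.2⟩

theorem HoldsFrom.holdsOutcome {o : Outcome n} (h : HoldsFrom ∅ m o) : HoldsOutcome m o := by
  cases o with
  | answer r =>
    cases r with
    | none => exact h
    | some X => exact ⟨h.1, by simpa using h.2⟩
  | branch D' E v => exact ⟨h.1, h.2.1, by simpa using h.2.2.1, h.2.2.2⟩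

/-- Store the vertices outside `F` in array 10. -/
def outside : Cmd := .forN 4 (.store 10 (.reg 4) (.sub (.get 1 (.reg 4)) (.get 2 (.reg 4))))

theorem outside_spec (hn : m.reg 0 = n) (h : HoldsInst m J) :
    HoldsSet (outside.sem m) 10 (J.V \ J.F) := by
  classical
  intro v
  refine Cmd.forN_store_rule (n := n) (fun v => if v ∈ J.V \ J.F then 1 else 0) (by decide) hn
    (fun u m' hf hu _ => ?_) v |>.trans (by congr)
  simp only [Expr.eval, hu, hf.2 1 (by decide), hf.2 2 (by decide), h.2.1 u, h.2.2 u,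
    Finset.mem_sdiff]
  split_ifs <;> simp_all

/-- Step 4. -/
def cycles : Cmd := .block [label, outside, .assign 11 (.const 0), grow,
  .cond (.sub (.reg 11) (.reg 1)) (.assign 2 (.const 0)) (.assign 2 (.const 1))]

/-- Instead of searching for cycles, the vertices outside `F` are added to the forest on `F` one by
one. A rejected vertex lies on a cycle of the graph without the earlier rejects, so the rejects form
a legal run of the loop of step 4. -/
theorem cycles_spec (h : Reducing m G J X) (hac : AcyclicOn G J.F) :
    ∃ Y, CycleLoop G J.V J.F Y ∧
      HoldsFrom X (cycles.sem m) (.answer (if (Y.card : ℤ) ≤ J.k then some Y else none)) := by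
  simp only [cycles, Cmd.sem_block_cons, Cmd.sem_block_singleton]
  obtain ⟨h3, L, hL⟩ := label_spec h.ready h.inst.2.2 hac h.clear h.sol
  have hR1 : Ready (label.sem m) G := h.ready.sem (by decide) (by decide) (by decide)
  have hI1 : HoldsInst (label.sem m) J :=
    ⟨by rw [Cmd.sem_reg (by decide)]; exact h.inst.1, h.inst.2.1.sem (by decide),
      h.inst.2.2.sem (by decide)⟩
  revert h3 hL hR1 hI1
  generalize label.sem m = m1
  intro h3 hL hR1 hI1
  have hf2 := outside.frame m1
  have hB2 := outside_spec hR1.1.1 hI1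
  generalize outside.sem m1 = m2 at hf2 hB2 ⊢
  have hR2 := hR1.frame hf2 (by decide) (by decide) (by decide)
  have hk2 : (m2.reg 1 : ℤ) = J.k := by rw [hf2.1 1 (by decide)]; exact hI1.1
  have h32 := h3.frame hf2 (by decide)
  have h52 := hL.marks.frame hf2 (by decide)
  have h72 := hL.clear.frame hf2 (by decide)
  have hVF : J.F ∪ J.V \ J.F = J.V := Finset.union_sdiff_of_subset h.subset
  obtain ⟨Y, L', hg⟩ := grow_spec (m := m2.setReg 11 0) (S := J.F) (B := J.V \ J.F) (X₀ := X)
    -- A run is built backwards from its last deletion, whereas `Z` grows in the order of deletion;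
    -- hence the invariant speaks of all continuations.
    (L := L) (fun Z => ∀ Y, CycleLoop G (J.V \ Z) J.F Y → CycleLoop G J.V J.F (Z ∪ Y))
    ⟨⟨hR2.1.1, hR2.1.2⟩, hR2.2⟩
    ⟨h52, fun v hv => by
      rw [← hL.label v hv, ← hf2.2 6 (by decide)]
      rfl, hL.labels, h72⟩
    hB2.marks Finset.disjoint_sdiff hac h32 (by simp)
    (fun Z u hZ hu _ hc Y hY => by
      rw [hVF] at hc
      rw [← erase_sdiff_eq_sdiff_insert, Finset.erase_sdiff_comm] at hY
      rw [Finset.insert_union, ← Finset.union_insert]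
      exact hZ _ (.step _ _ _ u (Finset.mem_sdiff.1 hu).2 hc hY))
  have hk3 : ((grow.sem (m2.setReg 11 0)).reg 1 : ℤ) = J.k := by
    rw [Cmd.sem_reg (by decide)]
    exact hk2
  have hac := hg.acyclic
  rw [hVF] at hac
  refine ⟨Y, by simpa using hg.prop ∅ (.done _ _ hac), ?_⟩
  have hcount : (grow.sem (m2.setReg 11 0)).reg 11 = Y.card := by
    rw [hg.count]
    simp [Mem.setReg]
  have hsol := hg.sol
  rw [show (Cmd.assign 11 (.const 0)).sem m2 = m2.setReg 11 0 from rfl]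
  generalize grow.sem (m2.setReg 11 0) = m3 at hk3 hcount hsol ⊢
  split_ifs with hle
  · rw [Cmd.sem_cond_zero (by simp only [Expr.eval, hcount]; omega)]
    exact ⟨rfl, hsol⟩
  · rw [Cmd.sem_cond_ne (by simp only [Expr.eval, hcount]; omega)]
    rfl

/-- Steps 3 and 4, and the answers of step 0. -/
def finish : Cmd := .block [pick, .cond (.sub (.reg 0) (.reg 3))
  (.cond (.sub (.reg 9) (.const 2)) (.assign 2 (.const 2)) cycles) (.assign 2 (.const 1))]

theorem finish_spec (h : Reducing m G J X) (hac : AcyclicOn G J.F) (h1 : ∀ w, ¬ J.Low G w)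
    (h2 : ∀ w, ¬ J.Forced G w) :
    ∃ o, NodeRun G J o ∧ HoldsFrom X (finish.sem m) o := by
  have hk : 0 ≤ J.k := by
    have := h.inst.1
    omega
  have hr : Reducing (pick.sem m) G J X :=
    h.frame (pick.frame m) (by decide) (by decide) (by decide)
  simp only [finish, Cmd.sem_block_cons, Cmd.sem_block_singleton]
  have hp := pick_spec h
  generalize pick.sem m = m' at hr hp ⊢
  have h0 : m'.reg 0 = n := hr.ready.1.1
  have hlow : ∀ w ∈ J.V, 2 ≤ degIn G J.V w := fun w hw => by
    by_contra hc
    exact h1 w ⟨hw, not_le.1 hc⟩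
  rcases hp with ⟨h3, hdeg⟩ | ⟨v, hv, h3, h9⟩
  -- All degrees are at least two, so no vertex is left outside `F`. The whole graph is then a
  -- forest, and a nonempty forest has a vertex of smaller degree.
  · have hV : J.V = ∅ := by
      by_contra hne
      have hVF : J.V ⊆ J.F := fun w hw => by
        by_contra hwF
        have := hdeg w (Finset.mem_sdiff.2 ⟨hw, hwF⟩)
        have := hlow w hw
        omega
      obtain ⟨w, hw, hd⟩ := (hac.mono hVF).exists_degIn_lt_two (Finset.nonempty_iff_ne_empty.2 hne)
      have := hlow w hw
      omega
    refine ⟨_, .empty J hk hV, ?_⟩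
    rw [Cmd.sem_cond_zero (by simp only [Expr.eval, h0, h3]; omega)]
    exact ⟨rfl, by rw [Finset.union_empty]; exact hr.sol⟩
  · rw [Cmd.sem_cond_ne (by simp only [Expr.eval, h0, h3]; have := v.2; omega)]
    have hd2 := hlow v (Finset.mem_sdiff.1 hv.1).1
    change 2 ≤ J.deg G v at hd2
    by_cases hd : J.deg G v = 2
    · rw [Cmd.sem_cond_zero (by simp only [Expr.eval, h9]; omega)]
      obtain ⟨Y, hY, hfrom⟩ := cycles_spec hr hac
      exact ⟨_, .cycles J v Y hk h1 h2 hv hd hY, hfrom⟩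
    · rw [Cmd.sem_cond_ne (by simp only [Expr.eval, h9]; omega)]
      refine ⟨_, .branch J v hk h1 h2 hv hd, rfl, h3, ?_, hr.inst⟩
      rw [Finset.union_empty]
      exact hr.sol

/-- The processing of a node; the solution is accumulated in array 3. -/
def nodeCmd : Cmd := .block [rows, zeroArr 4 7, degrees, label, flags, reduce,
  .cond (.reg 13) (.assign 2 (.const 0)) finish]

theorem nodeCmd_spec (hI : I.Valid G) (hG : HoldsGraph m G) (hm : HoldsInst m I)
    (h3 : HoldsSet m 3 S₀) : ∃ o, NodeRun G I o ∧ HoldsFrom S₀ (nodeCmd.sem m) o := by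
  have hac : AcyclicOn G I.F := hI.2
  simp only [nodeCmd, Cmd.sem_block_cons, Cmd.sem_block_singleton]
  have hR1 := rows_spec hG
  have hm1 : HoldsInst (rows.sem m) I :=
    ⟨by rw [Cmd.sem_reg (by decide)]; exact hm.1, hm.2.1.sem (by decide), hm.2.2.sem (by decide)⟩
  have h31 : HoldsSet (rows.sem m) 3 S₀ := h3.sem (by decide)
  generalize rows.sem m = m1 at hR1 hm1 h31 ⊢
  have hf2 := (zeroArr 4 7).frame m1
  have h72 := zeroArr_marks (m := m1) (i := 4) (a := 7) (n := n) (by decide) hR1.1.1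
  generalize (zeroArr 4 7).sem m1 = m2 at hf2 h72 ⊢
  have hR2 := hR1.frame hf2 (by decide) (by decide) (by decide)
  have hV2 := hm1.2.1.frame hf2 (by decide)
  have hf3 := degrees.frame m2
  have h43 := degrees_spec hR2 hV2.marks
  generalize degrees.sem m2 = m3 at hf3 h43 ⊢
  have hR3 := hR2.frame hf3 (by decide) (by decide) (by decide)
  have hV3 := hV2.frame hf3 (by decide)
  have hF3 := (hm1.2.2.frame hf2 (by decide)).frame hf3 (by decide)
  have hf4 := label.frame m3
  obtain ⟨h34, L, hL⟩ := label_spec hR3 hF3 hac (h72.frame hf3 (by decide))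
    ((h31.frame hf2 (by decide)).frame hf3 (by decide))
  generalize label.sem m3 = m4 at hf4 h34 hL ⊢
  have hR4 := hR3.frame hf4 (by decide) (by decide) (by decide)
  have hV4 := hV3.frame hf4 (by decide)
  have hF4 := hF3.frame hf4 (by decide)
  have hf5 := flags.frame m4
  obtain ⟨h85, h75⟩ := flags_spec hR4 hL hV4 hF4
  generalize flags.sem m4 = m5 at hf5 h85 h75 ⊢
  have hr5 : Reducing m5 G I S₀ := by
    refine ⟨hR4.frame hf5 (by decide) (by decide) (by decide), ⟨?_, hV4.frame hf5 (by decide),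
      hF4.frame hf5 (by decide)⟩, h34.frame hf5 (by decide), fun v => ?_, fun v _ => h85 v, hI.1,
      h75⟩
    · rw [hf5.1 1 (by decide), hf4.1 1 (by decide), hf3.1 1 (by decide), hf2.1 1 (by decide)]
      exact hm1.1
    · rw [hf5.2 4 (by decide), hf4.2 4 (by decide), h43]
  have h6 := reduce_spec hr5
  generalize reduce.sem m5 = m6 at h6 ⊢
  rcases h6 with ⟨D, J, h13, hl, hr, hlow, hforced⟩ | ⟨h13, hno⟩
  · rw [Cmd.sem_cond_zero (e := .reg 13) h13]
    obtain ⟨o, ho, hfrom⟩ := finish_spec hr (hac.mono hl.F_subset) hlow hforced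
    exact ⟨_, hl.run o ho, hfrom.addSet⟩
  · rw [Cmd.sem_cond_ne (e := .reg 13) h13]
    exact ⟨_, hno, rfl⟩

theorem exists_nodeProg : ∃ (node : Prog) (C : ℕ), ∀ (n : ℕ) (G : SimpleGraph (Fin n))
    (I : Inst n) (m : Mem), I.Valid G → HoldsGraph m G → HoldsInst m I →
    ∃ (o : Outcome n) (t : ℕ) (m' : Mem), NodeRun G I o ∧ Exec node m t m' ∧ HoldsOutcome m' o ∧
      t ≤ C * (max n 1) ^ 2 := by
  refine ⟨(Cmd.block [zeroArr 4 3, nodeCmd]).toProg, (Cmd.block [zeroArr 4 3, nodeCmd]).factor,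
    fun n G I m hI hG hm => ?_⟩
  have hf := (zeroArr 4 3).frame m
  have h3 := zeroArr_holdsSet (m := m) (i := 4) (a := 3) (n := n) (by decide) hG.1
  obtain ⟨o, ho, hfrom⟩ := nodeCmd_spec (m := (zeroArr 4 3).sem m) hI
    ⟨(hf.1 0 (by decide)).trans hG.1, fun u v => by rw [hf.2 0 (by decide)]; exact hG.2 u v⟩
    ⟨by rw [hf.1 1 (by decide)]; exact hm.1, hm.2.1.frame hf (by decide),
      hm.2.2.frame hf (by decide)⟩ h3
  obtain ⟨t, ht, htle⟩ := Cmd.exec (.block [zeroArr 4 3, nodeCmd]) (by decide) (by decide) m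
  refine ⟨o, t, _, ho, ht, hfrom.holdsOutcome, ?_⟩
  -- The loops of this command are nested to depth two, by evaluation of `Cmd.depth`.
  rw [hG.1] at htle
  exact htle

end Node

/-! ### The search -/

section Search

variable {n : ℕ} {G : SimpleGraph (Fin n)} {S X : Finset (Fin n)} {m m' m'' : Mem} {u v : Fin n}
  {I E : Inst n} {p : ℕ}

open Classical in
/-- The entries of array `a` from `off` on are the characteristic vector of `X`. -/
def HoldsSetAt (m : Mem) (a off : ℕ) (X : Finset (Fin n)) : Prop :=
  ∀ v : Fin n, m.arr a (off + v) = if v ∈ X then 1 else 0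

/-- Copy a set from array `a` to the top of the stack in array `b`. -/
def save (a b : ℕ) : Cmd := .forN 4 (.store b (.add (.reg 15) (.reg 4)) (.get a (.reg 4)))

/-- Copy a set from the top of the stack in array `b` to array `a`. -/
def load (a b : ℕ) : Cmd := .forN 4 (.store a (.reg 4) (.get b (.add (.reg 15) (.reg 4))))

theorem save_spec {a b off : ℕ} (hab : a ≠ b) (hn : m.reg 0 = n) (h : HoldsSet m a X)
    (h15 : m.reg 15 = off) : HoldsSetAt ((save a b).sem m) b off X ∧
      ∀ i < off, ((save a b).sem m).arr b i = m.arr b i := by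
  have := Cmd.forN_rule (i := 4) (p := .store b (.add (.reg 15) (.reg 4)) (.get a (.reg 4)))
    (m := m) (n := n) (fun j m' => (∀ v : Fin n, v.1 < j → m'.arr b (off + v) = m.arr a v) ∧
      ∀ i < off, m'.arr b i = m.arr b i) rfl hn (fun _ _ _ h => h) (by simp) ?_
  · exact ⟨fun v => (this.1 v v.2).trans (h v), this.2⟩
  · rintro w m' hf hw hm' ⟨h1, h2⟩
    have h15' : m'.reg 15 = off := (hf.1 15 (by simp [Cmd.regs])).trans h15
    have ha : m'.arr a = m.arr a := hf.2 a (by simpa [Cmd.arrs] using hab)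
    simp only [Cmd.sem, Expr.eval, hw, h15', ha, Mem.setArr, Function.update_self]
    refine ⟨fun v hv => ?_, fun i hi => ?_⟩
    · by_cases hvw : v = w
      · subst hvw
        rw [Function.update_self]
      · have := Fin.val_ne_of_ne hvw
        rw [Function.update_of_ne (by omega), h1 v (by omega)]
    · rw [Function.update_of_ne (by omega), h2 i hi]

theorem load_spec {a b off : ℕ} (hab : a ≠ b) (hn : m.reg 0 = n) (h : HoldsSetAt m b off X)
    (h15 : m.reg 15 = off) : HoldsSet ((load a b).sem m) a X := fun v => by
  rw [← h v]
  refine Cmd.forN_store_rule (n := n) (fun v => m.arr b (off + v)) (by decide) hn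
    (fun u m' hf hu _ => ?_) v
  have hb : b ∉ (Cmd.forN 4 (.store a (.reg 4) (.get b (.add (.reg 15) (.reg 4))))).arrs := by
    simpa [Cmd.arrs] using hab.symm
  simp [Expr.eval, hu, hf.1 15 (by simp [Cmd.regs]), hf.2 b hb, h15]

/-- Push the current state and turn to the instance without the branching vertex. -/
def descend : Cmd := .block [save 1 11, save 2 12, save 3 13, .store 14 (.reg 14) (.reg 1),
  .store 15 (.reg 14) (.reg 16), .store 16 (.reg 14) (.reg 3),
  .assign 14 (.add (.reg 14) (.const 1)), .assign 15 (.add (.reg 15) (.reg 0)),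
  .cond (.reg 1) (.block [.store 1 (.reg 3) (.const 0), .store 3 (.reg 3) (.const 1),
    .assign 1 (.sub (.reg 1) (.const 1))]) (.assign 17 (.const 2))]

/-- Process a node. -/
def call : Cmd := .block [nodeCmd, .cond (.reg 2)
  (.cond (.sub (.reg 2) (.const 1)) descend (.assign 17 (.const 3))) (.assign 17 (.const 2))]

/-- Restore the state at the top of the stack, and put the branching vertex into `F`. -/
def restore : Cmd := .block [.assign 16 (.sub (.reg 16) (.const 1)), .assign 1 (.get 14 (.reg 14)),
  load 1 11, load 2 12, load 3 13, .store 2 (.get 16 (.reg 14)) (.const 1), .assign 17 (.const 1)]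

/-- Return from the instance without the branching vertex. -/
def ascend : Cmd := .block [.assign 14 (.sub (.reg 14) (.const 1)),
  .assign 15 (.sub (.reg 15) (.reg 0)), .cond (.sub (.reg 17) (.const 2)) .skip
    (.block [.assign 16 (.get 15 (.reg 14)), .cond (.reg 16) restore .skip])]

/-- One step of the search. Register 17 holds `1` if an instance is to be solved, and `2` or `3` if
the answer to one is "no" or a set; register 14 holds the height of the stack. -/
def searchStep : Cmd := .cond (.sub (.reg 17) (.const 1)) ascend call

/-- The search continues unless there is an answer and the stack is empty. -/
def searchCond : Expr := .add (.reg 14) (.sub (.const 2) (.reg 17))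

/-- The pointers to the top of the stack. -/
structure Pointers (m : Mem) (G : SimpleGraph (Fin n)) (p : ℕ) : Prop where
  graph : HoldsGraph m G
  height : m.reg 14 = p
  offset : m.reg 15 = p * n

/-- The instance `I` is to be solved, with `S` already in the solution. -/
structure Calling (m : Mem) (G : SimpleGraph (Fin n)) (I : Inst n) (S : Finset (Fin n)) (p : ℕ) :
    Prop extends Pointers m G p where
  inst : HoldsInst m I
  budget : m.reg 16 = I.b
  sol : HoldsSet m 3 S
  mode : m.reg 17 = 1

/-- An instance has been solved. -/
structure Returned (m : Mem) (G : SimpleGraph (Fin n)) (r : Option (Finset (Fin n)))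
    (S : Finset (Fin n)) (p : ℕ) : Prop extends Pointers m G p where
  none_mode : r = none → m.reg 17 = 2
  some_mode : ∀ X, r = some X → m.reg 17 = 3 ∧ HoldsSet m 3 (S ∪ X)

/-- The stacks agree below height `p`. -/
def StackEq (n p : ℕ) (m m' : Mem) : Prop :=
  (∀ a ∈ [11, 12, 13], ∀ i < p * n, m'.arr a i = m.arr a i) ∧
    ∀ a ∈ [14, 15, 16], ∀ i < p, m'.arr a i = m.arr a i

theorem StackEq.trans (h : StackEq n p m m') (h' : StackEq n p m' m'') : StackEq n p m m'' :=
  ⟨fun a ha i hi => (h'.1 a ha i hi).trans (h.1 a ha i hi),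
    fun a ha i hi => (h'.2 a ha i hi).trans (h.2 a ha i hi)⟩

theorem StackEq.mono {q : ℕ} (h : StackEq n p m m') (hq : q ≤ p) : StackEq n q m m' :=
  ⟨fun a ha i hi => h.1 a ha i (hi.trans_le (Nat.mul_le_mul_right n hq)),
    fun a ha i hi => h.2 a ha i (hi.trans_le hq)⟩

theorem stackEq_of_arr (h : ∀ a ∈ [11, 12, 13, 14, 15, 16], m'.arr a = m.arr a) :
    StackEq n p m m' :=
  ⟨fun a ha i _ => by rw [h a (by simp at ha ⊢; omega)],
    fun a ha i _ => by rw [h a (by simp at ha ⊢; omega)]⟩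

/-- The state saved at height `p` of the stack. -/
structure Saved (m : Mem) (p : ℕ) (E : Inst n) (S : Finset (Fin n)) (v : Fin n) : Prop where
  setV : HoldsSetAt m 11 (p * n) E.V
  setF : HoldsSetAt m 12 (p * n) E.F
  sol : HoldsSetAt m 13 (p * n) S
  k_eq : (m.arr 14 p : ℤ) = E.k
  b_eq : m.arr 15 p = E.b
  v_eq : m.arr 16 p = v

theorem HoldsSetAt.stackEq {a : ℕ} (h : HoldsSetAt m a (p * n) X) (hs : StackEq n (p + 1) m m')
    (ha : a ∈ [11, 12, 13]) : HoldsSetAt m' a (p * n) X := fun v => by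
  rw [hs.1 a ha _ (by have := v.2; rw [Nat.succ_mul]; omega), h v]

theorem Saved.stackEq (h : Saved m p E S v) (hs : StackEq n (p + 1) m m') : Saved m' p E S v where
  setV := h.setV.stackEq hs (by decide)
  setF := h.setF.stackEq hs (by decide)
  sol := h.sol.stackEq hs (by decide)
  k_eq := by rw [hs.2 14 (by decide) p (Nat.lt_succ_self p)]; exact h.k_eq
  b_eq := by rw [hs.2 15 (by decide) p (Nat.lt_succ_self p)]; exact h.b_eq
  v_eq := by rw [hs.2 16 (by decide) p (Nat.lt_succ_self p)]; exact h.v_eq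

theorem HoldsGraph.frame {c : Cmd} (h : HoldsGraph m G) (hf : c.Frame m m') (h0 : 0 ∉ c.regs)
    (ha : 0 ∉ c.arrs) : HoldsGraph m' G :=
  ⟨(hf.1 0 h0).trans h.1, fun u v => by rw [hf.2 0 ha]; exact h.2 u v⟩

theorem descend_spec (h : Calling m G E S p) (h3 : m.reg 3 = v) :
    Pointers (descend.sem m) G (p + 1) ∧ Saved (descend.sem m) p E S v ∧
      StackEq n p m (descend.sem m) ∧ (E.k = 0 → (descend.sem m).reg 17 = 2) ∧
      (0 < E.k → Calling (descend.sem m) G (E.take v) (insert v S) (p + 1)) := by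
  simp only [descend, Cmd.sem_block_cons, Cmd.sem_block_singleton]
  have hf1 := (save 1 11).frame m
  obtain ⟨hs1, hb1⟩ := save_spec (a := 1) (b := 11) (by decide) h.graph.1 h.inst.2.1 h.offset
  generalize (save 1 11).sem m = m1 at hf1 hs1 hb1 ⊢
  have hg1 := h.graph.frame hf1 (by decide) (by decide)
  have hf2 := (save 2 12).frame m1
  obtain ⟨hs2, hb2⟩ := save_spec (a := 2) (b := 12) (by decide) hg1.1
    (h.inst.2.2.frame hf1 (by decide)) ((hf1.1 15 (by decide)).trans h.offset)
  generalize (save 2 12).sem m1 = m2 at hf2 hs2 hb2 ⊢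
  have hg2 := hg1.frame hf2 (by decide) (by decide)
  have hf3 := (save 3 13).frame m2
  obtain ⟨hs3, hb3⟩ := save_spec (a := 3) (b := 13) (by decide) hg2.1
    ((h.sol.frame hf1 (by decide)).frame hf2 (by decide))
    ((hf2.1 15 (by decide)).trans ((hf1.1 15 (by decide)).trans h.offset))
  generalize (save 3 13).sem m2 = m3 at hf3 hs3 hb3 ⊢
  have hg3 := hg2.frame hf3 (by decide) (by decide)
  have hreg : ∀ x, x ≠ 4 → m3.reg x = m.reg x := fun x hx => by
    rw [hf3.1 x (by simpa [save, Cmd.regs] using hx), hf2.1 x (by simpa [save, Cmd.regs] using hx),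
      hf1.1 x (by simpa [save, Cmd.regs] using hx)]
  have harr : ∀ a, a ≠ 11 → a ≠ 12 → a ≠ 13 → m3.arr a = m.arr a := fun a h11 h12 h13 => by
    rw [hf3.2 a (by simpa [save, Cmd.arrs] using h13), hf2.2 a (by simpa [save, Cmd.arrs] using h12),
      hf1.2 a (by simpa [save, Cmd.arrs] using h11)]
  have h11 : m3.arr 11 = m1.arr 11 := by rw [hf3.2 11 (by decide), hf2.2 11 (by decide)]
  have h12 : m3.arr 12 = m2.arr 12 := hf3.2 12 (by decide)
  obtain ⟨m4, hm4⟩ : ∃ m4, m4 = (((m3.setArr 14 p (m.reg 1)).setArr 15 p E.b).setArr 16 p v) :=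
    ⟨_, rfl⟩
  have hsem : (Cmd.store 16 (.reg 14) (.reg 3)).sem ((Cmd.store 15 (.reg 14) (.reg 16)).sem
      ((Cmd.store 14 (.reg 14) (.reg 1)).sem m3)) = m4 := by
    rw [hm4]
    simp only [Cmd.sem, Expr.eval]
    rw [← h.budget, ← h3, ← h.height, ← hreg 14 (by decide), ← hreg 1 (by decide),
      ← hreg 16 (by decide), ← hreg 3 (by decide)]
    rfl
  rw [hsem]
  have hr4 : m4.reg = m3.reg := by rw [hm4]; rfl
  have ha4 : ∀ a, a ≠ 14 → a ≠ 15 → a ≠ 16 → m4.arr a = m3.arr a := fun a h1 h2 h3 => by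
    rw [hm4, setArr_arr_of_ne h3, setArr_arr_of_ne h2, setArr_arr_of_ne h1]
  have hsaved : Saved m4 p E S v := by
    refine ⟨fun w => ?_, fun w => ?_, fun w => ?_, ?_, ?_, ?_⟩
    · rw [ha4 11 (by decide) (by decide) (by decide), h11]
      exact hs1 w
    · rw [ha4 12 (by decide) (by decide) (by decide), h12]
      exact hs2 w
    · rw [ha4 13 (by decide) (by decide) (by decide)]
      exact hs3 w
    · rw [hm4, setArr_arr_of_ne (by decide), setArr_arr_of_ne (by decide), ← h.inst.1]
      simp [Mem.setArr]
    · rw [hm4, setArr_arr_of_ne (by decide)]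
      simp [Mem.setArr]
    · rw [hm4]
      simp [Mem.setArr]
  have hstack : StackEq n p m m4 := by
    refine ⟨fun a ha i hi => ?_, fun a ha i hi => ?_⟩
    · simp only [List.mem_cons, List.not_mem_nil, or_false] at ha
      rw [ha4 a (by omega) (by omega) (by omega)]
      rcases ha with rfl | rfl | rfl
      · rw [h11, hb1 i hi]
      · rw [h12, hb2 i hi, hf1.2 12 (by decide)]
      · rw [hb3 i hi, hf2.2 13 (by decide), hf1.2 13 (by decide)]
    · have hne : i ≠ p := hi.ne
      simp only [List.mem_cons, List.not_mem_nil, or_false] at ha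
      rcases ha with rfl | rfl | rfl
      · rw [hm4, setArr_arr_of_ne (by decide), setArr_arr_of_ne (by decide)]
        simp only [Mem.setArr, Function.update_self]
        rw [Function.update_of_ne hne, harr 14 (by decide) (by decide) (by decide)]
      · rw [hm4, setArr_arr_of_ne (by decide)]
        simp only [Mem.setArr, Function.update_self]
        rw [Function.update_of_ne hne, Function.update_of_ne (by decide),
          harr 15 (by decide) (by decide) (by decide)]
      · rw [hm4]
        simp only [Mem.setArr, Function.update_self]
        rw [Function.update_of_ne hne, Function.update_of_ne (by decide),
          Function.update_of_ne (by decide), harr 16 (by decide) (by decide) (by decide)]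
  have hreg4 : ∀ x, x ≠ 4 → m4.reg x = m.reg x := fun x hx => by rw [hr4, hreg x hx]
  have harr4 : ∀ a < 11, m4.arr a = m.arr a := fun a ha => by
    rw [ha4 a (by omega) (by omega) (by omega), harr a (by omega) (by omega) (by omega)]
  clear hsem hm4 hr4 ha4 hreg harr h11 h12 hg1 hg2 hg3 hf1 hf2 hf3 hs1 hs2 hs3 hb1 hb2 hb3
  obtain ⟨m5, hm5⟩ : ∃ m5, m5 = (m4.setReg 14 (p + 1)).setReg 15 ((p + 1) * n) := ⟨_, rfl⟩
  have hsem : (Cmd.assign 15 (.add (.reg 15) (.reg 0))).sem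
      ((Cmd.assign 14 (.add (.reg 14) (.const 1))).sem m4) = m5 := by
    rw [hm5]
    simp only [Cmd.sem, Expr.eval]
    rw [Cmd.setReg_reg_of_ne (by decide), Cmd.setReg_reg_of_ne (by decide), hreg4 14 (by decide),
      hreg4 15 (by decide), hreg4 0 (by decide), h.height, h.offset, h.graph.1, Nat.succ_mul]
  rw [hsem]
  have ha5 : m5.arr = m4.arr := by rw [hm5]; rfl
  have hr5 : ∀ x, x ≠ 4 → x ≠ 14 → x ≠ 15 → m5.reg x = m.reg x := fun x h1 h2 h3 => by
    rw [hm5, Cmd.setReg_reg_of_ne h3, Cmd.setReg_reg_of_ne h2, hreg4 x h1]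
  have h514 : m5.reg 14 = p + 1 := by rw [hm5]; rfl
  have h515 : m5.reg 15 = (p + 1) * n := by rw [hm5]; rfl
  have hg5 : HoldsGraph m5 G := ⟨(hr5 0 (by decide) (by decide) (by decide)).trans h.graph.1,
    fun u v => by rw [ha5, harr4 0 (by decide)]; exact h.graph.2 u v⟩
  have hV5 : HoldsSet m5 1 E.V := fun u => by rw [ha5, harr4 1 (by decide)]; exact h.inst.2.1 u
  have hF5 : HoldsSet m5 2 E.F := fun u => by rw [ha5, harr4 2 (by decide)]; exact h.inst.2.2 u
  have hS5 : HoldsSet m5 3 S := fun u => by rw [ha5, harr4 3 (by decide)]; exact h.sol u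
  have hst5 : StackEq n (p + 1) m4 m5 := stackEq_of_arr fun a _ => by rw [ha5]
  have h51 := hr5 1 (by decide) (by decide) (by decide)
  have h53 := (hr5 3 (by decide) (by decide) (by decide)).trans h3
  have h516 := (hr5 16 (by decide) (by decide) (by decide)).trans h.budget
  have h517 := (hr5 17 (by decide) (by decide) (by decide)).trans h.mode
  replace hsaved := hsaved.stackEq hst5
  replace hstack := hstack.trans (hst5.mono (Nat.le_succ p))
  clear hm5 hsem hr5 ha5 hst5 hreg4 harr4
  have hk := h.inst.1
  -- With parameter zero, the call without `v` is answered "no" at once, by the mode register, since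
  -- a negative parameter cannot be stored.
  by_cases h1 : m5.reg 1 = 0
  · rw [Cmd.sem_cond_zero (e := .reg 1) h1]
    refine ⟨⟨⟨hg5.1, hg5.2⟩, h514, h515⟩, ⟨hsaved.1, hsaved.2, hsaved.3, hsaved.4, hsaved.5,
      hsaved.6⟩, hstack, fun _ => rfl, fun hpos => ?_⟩
    omega
  · rw [Cmd.sem_cond_ne (e := .reg 1) h1]
    have hsem : (Cmd.block [.store 1 (.reg 3) (.const 0), .store 3 (.reg 3) (.const 1),
        .assign 1 (.sub (.reg 1) (.const 1))]).sem m5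
        = ((m5.setArr 1 v 0).setArr 3 v 1).setReg 1 (m.reg 1 - 1) := by
      simp only [Cmd.sem_block_cons, Cmd.sem_block_singleton, Cmd.sem, Expr.eval, h53]
      rw [show (m5.setArr 1 v 0).reg 3 = v from h53,
        show ((m5.setArr 1 v 0).setArr 3 v 1).reg 1 = m.reg 1 from h51]
    rw [hsem]
    have hst6 : ∀ q, StackEq n q m5 (((m5.setArr 1 v 0).setArr 3 v 1).setReg 1 (m.reg 1 - 1)) :=
      fun q => stackEq_of_arr fun a ha => by
        simp only [List.mem_cons, List.not_mem_nil, or_false] at ha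
        exact (setArr_arr_of_ne (by omega)).trans (setArr_arr_of_ne (by omega))
    have h60 : ((m5.setArr 1 v 0).setArr 3 v 1).arr 0 = m5.arr 0 := by
      rw [setArr_arr_of_ne (by decide), setArr_arr_of_ne (by decide)]
    have hg6 : HoldsGraph (((m5.setArr 1 v 0).setArr 3 v 1).setReg 1 (m.reg 1 - 1)) G :=
      ⟨hg5.1, fun u w => (congrFun h60 _).trans (hg5.2 u w)⟩
    refine ⟨⟨hg6, h514, h515⟩, hsaved.stackEq (hst6 _), hstack.trans (hst6 _), fun h0 => ?_,
      fun hpos => ⟨⟨hg6, h514, h515⟩, ⟨?_, ?_, ?_⟩, h516, ?_, h517⟩⟩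
    · omega
    · simp only [Mem.setReg, Function.update_self, Inst.take]
      omega
    · exact (hV5.erase (v := v)).setArr (b := 3) (i := v) (c := 1) (by decide)
    · exact (hF5.setArr (b := 1) (i := v) (c := 0) (by decide)).setArr (b := 3) (i := v) (c := 1)
        (by decide)
    · exact (hS5.setArr (b := 1) (i := v) (c := 0) (by decide)).insert (v := v)

theorem call_spec (h : Calling m G I S p) (hI : I.Valid G) :
    (∃ r, NodeRun G I (.answer r) ∧ Returned (call.sem m) G r S p ∧ StackEq n p m (call.sem m)) ∨
    ∃ D E v, NodeRun G I (.branch D E v) ∧ Pointers (call.sem m) G (p + 1) ∧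
      Saved (call.sem m) p E (S ∪ D) v ∧ StackEq n p m (call.sem m) ∧
      (E.k = 0 → (call.sem m).reg 17 = 2) ∧
      (0 < E.k → Calling (call.sem m) G (E.take v) (insert v (S ∪ D)) (p + 1)) := by
  simp only [call, Cmd.sem_block_cons, Cmd.sem_block_singleton]
  have hf := nodeCmd.frame m
  obtain ⟨o, ho, hfrom⟩ := nodeCmd_spec hI h.graph h.inst h.sol
  generalize nodeCmd.sem m = m1 at hf hfrom ⊢
  have hp : Pointers m1 G p := ⟨h.graph.frame hf (by decide) (by decide),
    (hf.1 14 (by decide)).trans h.height, (hf.1 15 (by decide)).trans h.offset⟩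
  have hst : StackEq n p m m1 := stackEq_of_arr fun a ha => hf.2 a (by
    revert a
    decide)
  cases o with
  | answer r =>
    cases r with
    | none =>
      have h2 : m1.reg 2 = 0 := hfrom
      rw [Cmd.sem_cond_zero (e := .reg 2) h2]
      exact Or.inl ⟨none, ho, ⟨⟨⟨hp.1.1, hp.1.2⟩, hp.2, hp.3⟩, fun _ => rfl, fun X hX => by
        simp at hX⟩, hst⟩
    | some X =>
      obtain ⟨h2, h3⟩ := hfrom
      rw [Cmd.sem_cond_ne (e := .reg 2) (by simp [Expr.eval, h2]),
        Cmd.sem_cond_zero (by simp [Expr.eval, h2])]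
      refine Or.inl ⟨some X, ho, ⟨⟨⟨hp.1.1, hp.1.2⟩, hp.2, hp.3⟩, fun h => by simp at h,
        fun Y hY => ?_⟩, hst⟩
      obtain rfl := Option.some.inj hY
      exact ⟨rfl, h3⟩
  | branch D E v =>
    obtain ⟨h2, h3, hsol, hinst⟩ := hfrom
    rw [Cmd.sem_cond_ne (e := .reg 2) (by simp [Expr.eval, h2]),
      Cmd.sem_cond_ne (by simp [Expr.eval, h2])]
    have hs : BranchSpec G I D E v := ho.spec
    obtain ⟨h4, h5, h6, h7⟩ := descend_spec (v := v) (E := E) (S := S ∪ D) (m := m1)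
      ⟨hp, hinst, by rw [hf.1 16 (by decide), h.budget, hs.b_eq], hsol,
        (hf.1 17 (by decide)).trans h.mode⟩ h3
    exact Or.inr ⟨D, E, v, ho, h4, h5, hst.trans h6, h7⟩

theorem restore_spec (h : Pointers m G p) (hs : Saved m p E S v) (h16 : m.reg 16 = E.b) :
    Calling (restore.sem m) G (E.keep v) S p ∧ StackEq n p m (restore.sem m) := by
  have hst : StackEq n p m (restore.sem m) := stackEq_of_arr fun a ha => by
    refine Cmd.sem_arr ?_
    revert a
    decide
  refine ⟨?_, hst⟩
  have hp : Pointers (restore.sem m) G p := ⟨h.graph.frame (restore.frame m) (by decide) (by decide),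
    (Cmd.sem_reg (by decide)).trans h.height, (Cmd.sem_reg (by decide)).trans h.offset⟩
  suffices h : HoldsInst (restore.sem m) (E.keep v) ∧ (restore.sem m).reg 16 = (E.keep v).b ∧
      HoldsSet (restore.sem m) 3 S ∧ (restore.sem m).reg 17 = 1 from
    ⟨hp, h.1, h.2.1, h.2.2.1, h.2.2.2⟩
  clear hp hst
  simp only [restore, Cmd.sem_block_cons, Cmd.sem_block_singleton]
  obtain ⟨m1, hm1⟩ : ∃ m1, m1 = (m.setReg 16 (E.b - 1)).setReg 1 (m.arr 14 p) := ⟨_, rfl⟩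
  have hsem : (Cmd.assign 1 (.get 14 (.reg 14))).sem
      ((Cmd.assign 16 (.sub (.reg 16) (.const 1))).sem m) = m1 := by
    rw [hm1]
    simp only [Cmd.sem, Expr.eval, h16]
    rw [show (m.setReg 16 (E.b - 1)).reg 14 = p from h.height]
    rfl
  rw [hsem]
  have ha1 : m1.arr = m.arr := by rw [hm1]; rfl
  have h10 : m1.reg 0 = n := by rw [hm1]; exact h.graph.1
  have h11 : (m1.reg 1 : ℤ) = E.k := by rw [hm1]; exact hs.k_eq
  have h114 : m1.reg 14 = p := by rw [hm1]; exact h.height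
  have h115 : m1.reg 15 = p * n := by rw [hm1]; exact h.offset
  have h116 : m1.reg 16 = E.b - 1 := by rw [hm1]; rfl
  have hs1 : Saved m1 p E S v := hs.stackEq (stackEq_of_arr fun a _ => by rw [ha1])
  clear hm1 hsem ha1
  have hf2 := (load 1 11).frame m1
  have hl2 := load_spec (a := 1) (b := 11) (by decide) h10 hs1.setV h115
  generalize (load 1 11).sem m1 = m2 at hf2 hl2 ⊢
  have hs2 : Saved m2 p E S v := hs1.stackEq (stackEq_of_arr fun a ha => hf2.2 a (by
    revert a
    decide))
  have hf3 := (load 2 12).frame m2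
  have hl3 := load_spec (a := 2) (b := 12) (by decide) ((hf2.1 0 (by decide)).trans h10) hs2.setF
    ((hf2.1 15 (by decide)).trans h115)
  generalize (load 2 12).sem m2 = m3 at hf3 hl3 ⊢
  have hs3 : Saved m3 p E S v := hs2.stackEq (stackEq_of_arr fun a ha => hf3.2 a (by
    revert a
    decide))
  have hf4 := (load 3 13).frame m3
  have hl4 := load_spec (a := 3) (b := 13) (by decide)
    ((hf3.1 0 (by decide)).trans ((hf2.1 0 (by decide)).trans h10)) hs3.sol
    ((hf3.1 15 (by decide)).trans ((hf2.1 15 (by decide)).trans h115))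
  generalize (load 3 13).sem m3 = m4 at hf4 hl4 ⊢
  have hreg : ∀ x, x ≠ 4 → m4.reg x = m1.reg x := fun x hx => by
    rw [hf4.1 x (by simpa [load, Cmd.regs] using hx), hf3.1 x (by simpa [load, Cmd.regs] using hx),
      hf2.1 x (by simpa [load, Cmd.regs] using hx)]
  have hs4 : Saved m4 p E S v := hs3.stackEq (stackEq_of_arr fun a ha => hf4.2 a (by
    revert a
    decide))
  have hsem : (Cmd.assign 17 (.const 1)).sem
      ((Cmd.store 2 (.get 16 (.reg 14)) (.const 1)).sem m4) = (m4.setArr 2 v 1).setReg 17 1 := by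
    simp only [Cmd.sem, Expr.eval, hreg 14 (by decide), h114, hs4.v_eq]
  rw [hsem]
  refine ⟨⟨?_, ?_, ?_⟩, ?_, ?_, rfl⟩
  · exact (congrArg Nat.cast (hreg 1 (by decide))).trans h11
  · exact ((hl2.frame hf3 (by decide)).frame hf4 (by decide)).setArr (b := 2) (i := v) (c := 1)
      (by decide)
  · exact (hl3.frame hf4 (by decide)).insert (v := v)
  · exact (hreg 16 (by decide)).trans h116
  · exact hl4.setArr (b := 2) (i := v) (c := 1) (by decide)

/-- A success is passed on with array 3 untouched, because the vertices taken along the path, `v`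
included, are already accumulated there. After a failure, the saved budget decides between
truncation and step 6. -/
theorem ascend_spec (h : Pointers m G (p + 1)) (hs : Saved m p E S v) :
    StackEq n p m (ascend.sem m) ∧
    (m.reg 17 = 3 → Pointers (ascend.sem m) G p ∧ (ascend.sem m).reg 17 = 3 ∧
      (ascend.sem m).arr 3 = m.arr 3) ∧
    (m.reg 17 = 2 → E.b = 0 → Pointers (ascend.sem m) G p ∧ (ascend.sem m).reg 17 = 2) ∧
    (m.reg 17 = 2 → 0 < E.b → Calling (ascend.sem m) G (E.keep v) S p) := by
  have hst : StackEq n p m (ascend.sem m) := stackEq_of_arr fun a ha => by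
    refine Cmd.sem_arr ?_
    revert a
    decide
  refine ⟨hst, ?_⟩
  clear hst
  simp only [ascend, Cmd.sem_block_cons, Cmd.sem_block_singleton]
  obtain ⟨m1, hm1⟩ : ∃ m1, m1 = (m.setReg 14 p).setReg 15 (p * n) := ⟨_, rfl⟩
  have hsem : (Cmd.assign 15 (.sub (.reg 15) (.reg 0))).sem
      ((Cmd.assign 14 (.sub (.reg 14) (.const 1))).sem m) = m1 := by
    rw [hm1]
    simp only [Cmd.sem, Expr.eval]
    rw [Cmd.setReg_reg_of_ne (by decide), Cmd.setReg_reg_of_ne (by decide), h.height, h.offset,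
      h.graph.1, Nat.succ_mul, Nat.add_sub_cancel, Nat.add_sub_cancel]
  rw [hsem]
  have ha1 : m1.arr = m.arr := by rw [hm1]; rfl
  have hp1 : Pointers m1 G p := by
    rw [hm1]
    exact ⟨⟨h.graph.1, h.graph.2⟩, rfl, rfl⟩
  have h17 : m1.reg 17 = m.reg 17 := by rw [hm1]; rfl
  have hs1 : Saved m1 p E S v := hs.stackEq (stackEq_of_arr fun a _ => by rw [ha1])
  clear hm1 hsem
  refine ⟨fun h3 => ?_, fun h2 hb => ?_, fun h2 hb => ?_⟩
  · rw [Cmd.sem_cond_ne (by simp [Expr.eval, h17, h3])]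
    exact ⟨hp1, h17.trans h3, congrFun ha1 3⟩
  · rw [Cmd.sem_cond_zero (by simp [Expr.eval, h17, h2]), Cmd.sem_block_cons,
      Cmd.sem_block_singleton,
      Cmd.sem_cond_zero (by simp [Expr.eval, Cmd.sem, Mem.setReg, hp1.height, hs1.b_eq, hb])]
    exact ⟨⟨⟨hp1.1.1, hp1.1.2⟩, hp1.2, hp1.3⟩, h17.trans h2⟩
  · have h16 : ((Cmd.assign 16 (.get 15 (.reg 14))).sem m1).reg 16 = E.b := by
      simp [Expr.eval, Cmd.sem, Mem.setReg, hp1.height, hs1.b_eq]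
    rw [Cmd.sem_cond_zero (by simp [Expr.eval, h17, h2]), Cmd.sem_block_cons,
      Cmd.sem_block_singleton,
      Cmd.sem_cond_ne (e := .reg 16) (by simp only [Expr.eval, h16]; omega)]
    exact (restore_spec (m := (Cmd.assign 16 (.get 15 (.reg 14))).sem m1) ⟨⟨hp1.1.1, hp1.1.2⟩, hp1.2, hp1.3⟩
      ⟨hs1.1, hs1.2, hs1.3, hs1.4, hs1.5, hs1.6⟩ h16).1

end Search

/-! ### The whole program -/

section Main

variable {n : ℕ} {G : SimpleGraph (Fin n)} {S D X : Finset (Fin n)} {m m' m'' : Mem} {v : Fin n}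
  {I E : Inst n} {p : ℕ}

/-- `m'` is reached from `m` by `j` iterations of the main loop. -/
def Iterates : ℕ → Mem → Mem → Prop
  | 0, m, m' => m = m'
  | j + 1, m, m' => searchCond.eval m ≠ 0 ∧ Iterates j (searchStep.sem m) m'

theorem Iterates.trans {i j : ℕ} (h : Iterates i m m') (h' : Iterates j m' m'') :
    Iterates (i + j) m m'' := by
  induction i generalizing m with
  | zero =>
    have h : m = m' := h
    rwa [h, Nat.zero_add]
  | succ i ih =>
    rw [Nat.succ_add]
    exact ⟨h.1, ih h.2⟩

theorem Iterates.single (h : searchCond.eval m ≠ 0) : Iterates 1 m (searchStep.sem m) := ⟨h, rfl⟩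

/-- Each test of `searchCond` takes 6 steps, including the failing one at the end. -/
theorem Iterates.exec {j : ℕ} (h : Iterates j m m') (hn : m.reg 0 = n)
    (h' : searchCond.eval m' = 0) :
    ∃ t, Exec (.loop searchCond searchStep.toProg) m t m' ∧
      t ≤ j * ((searchStep.factor + 6) * (max n 1) ^ 2) + 6 := by
  induction j generalizing m with
  | zero =>
    have h : m = m' := h
    subst h
    exact ⟨_, Exec.loopFalse _ _ _ h', by simp [searchCond, Expr.cost]⟩
  | succ j ih =>
    obtain ⟨s, hs, hsle⟩ := Cmd.exec searchStep (by decide) (by decide) m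
    obtain ⟨t, ht, htle⟩ := ih h.2 ((Cmd.sem_reg (by decide)).trans hn)
    refine ⟨_, Exec.loopTrue _ _ _ _ _ _ _ h.1 hs ht, ?_⟩
    rw [hn, show searchStep.depth = 2 by decide] at hsle
    have h1 : 1 ≤ (max n 1) ^ 2 := Nat.one_le_pow _ _ (by omega)
    simp only [searchCond, Expr.cost]
    rw [Nat.succ_mul]
    generalize j * ((searchStep.factor + 6) * (max n 1) ^ 2) = a at htle ⊢
    rw [Nat.add_mul]
    omega

theorem Calling.searchCond_ne (h : Calling m G I S p) : searchCond.eval m ≠ 0 := by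
  simp [searchCond, Expr.eval, h.mode]

theorem Calling.searchStep_sem (h : Calling m G I S p) : searchStep.sem m = call.sem m :=
  Cmd.sem_cond_zero (by simp [Expr.eval, h.mode])

theorem Returned.two_le {r : Option (Finset (Fin n))} (h : Returned m G r S p) :
    2 ≤ m.reg 17 := by
  cases r with
  | none => exact (h.none_mode rfl).ge
  | some X => exact (by decide : 2 ≤ 3).trans (h.some_mode X rfl).1.ge

theorem Returned.searchCond_ne {r : Option (Finset (Fin n))} (h : Returned m G r S (p + 1)) :
    searchCond.eval m ≠ 0 := by
  simp [searchCond, Expr.eval, h.height]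

theorem Returned.searchStep_sem {r : Option (Finset (Fin n))} (h : Returned m G r S p) :
    searchStep.sem m = ascend.sem m :=
  Cmd.sem_cond_ne (by have := h.two_le; simp only [Expr.eval]; omega)

theorem BranchSpec.valid_take (h : BranchSpec G I D E v) (hI : I.Valid G) :
    (E.take v).Valid G := by
  refine ⟨fun w hw => Finset.mem_erase.2 ⟨fun hwv => ?_, h.F_subset hI.1 hw⟩,
    AcyclicOn.mono hI.2 h.F_subset'⟩
  have hv := (Finset.mem_sdiff.1 h.mem).2
  rw [← hwv] at hv
  exact hv hw

/-- The set `F ∪ {v}` still induces a forest precisely because step 2 does not apply to `v`. -/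
theorem BranchSpec.valid_keep (h : BranchSpec G I D E v) (hI : I.Valid G) :
    (E.keep v).Valid G :=
  ⟨Finset.insert_subset (Finset.mem_sdiff.1 h.mem).1 (h.F_subset hI.1),
    AcyclicOn.insert (AcyclicOn.mono hI.2 h.F_subset') fun x _ y _ hxy hx hy hc =>
      h.forced v (forced_iff.2 ⟨h.mem, x, y, hxy, hx, hy, hc⟩)⟩

theorem Returned.map_union {r : Option (Finset (Fin n))} (h : Returned m G r (S ∪ D) p) :
    Returned m G (r.map (D ∪ ·)) S p := by
  refine ⟨h.toPointers, fun hr => h.none_mode (Option.map_eq_none_iff.1 hr), fun X hX => ?_⟩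
  obtain ⟨Y, hY, rfl⟩ := Option.map_eq_some_iff.1 hX
  have := h.some_mode Y hY
  rwa [Finset.union_assoc] at this

/-- The main loop solves an instance, within a number of iterations that is exponential only in the
number of further branchings. -/
theorem run_spec (μ : ℕ) : ∀ {I : Inst n} {S : Finset (Fin n)} {p : ℕ} {m : Mem}, I.Valid G →
    I.k + I.b ≤ μ → Calling m G I S p →
    ∃ r m' j, Run G I r ∧ Returned m' G r S p ∧ StackEq n p m m' ∧ Iterates j m m' ∧
      j + 2 ≤ 4 * 2 ^ μ := by
  induction μ using Nat.strong_induction_on with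
  | _ μ ih =>
  intro I S p m hI hμ hm
  have hpos : 1 ≤ 2 ^ μ := Nat.one_le_two_pow
  have h1 := Iterates.single hm.searchCond_ne
  rw [hm.searchStep_sem] at h1
  rcases call_spec hm hI with ⟨r, hr, hret, hst⟩ | ⟨D, E, v, hB, hptr, hsaved, hst, hzero, hcall⟩
  · exact ⟨r, _, 1, .leaf _ _ hr, hret, hst, h1, by omega⟩
  have hspec : BranchSpec G I D E v := hB.spec
  have hEk := hspec.k_nonneg
  have hcard := hspec.card_le
  have hEb := hspec.b_eq
  -- A child that is called has a smaller value of `k + b` and so gets half of the bound. Its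
  -- parameter is held by a register and hence nonnegative, which makes `μ` positive.
  have hstep : ∀ J : Inst n, J.Valid G → J.k + J.b + 1 ≤ μ → ∀ {S : Finset (Fin n)} {p : ℕ}
      {m : Mem}, Calling m G J S p →
      ∃ r m' j, Run G J r ∧ Returned m' G r S p ∧ StackEq n p m m' ∧ Iterates j m m' ∧
        j + 2 ≤ 2 * 2 ^ μ := by
    intro J hJ hJμ S p m hm
    have hJk : 0 ≤ J.k := hm.inst.1 ▸ Int.natCast_nonneg _
    obtain ⟨μ', rfl⟩ : ∃ μ', μ = μ' + 1 := ⟨μ - 1, by omega⟩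
    obtain ⟨r, m', j, h1, h2, h3, h4, h5⟩ := ih μ' (Nat.lt_succ_self _) hJ (by omega) hm
    exact ⟨r, m', j, h1, h2, h3, h4, by rw [pow_succ]; omega⟩
  generalize call.sem m = m1 at h1 hptr hsaved hst hzero hcall
  obtain ⟨r5, m5, j5, hr5, hret5, hst5, hit5, hj5⟩ : ∃ r m' j, Run G (E.take v) r ∧
      Returned m' G r (insert v (S ∪ D)) (p + 1) ∧ StackEq n (p + 1) m1 m' ∧ Iterates j m1 m' ∧
        j + 2 ≤ 2 * 2 ^ μ := by
    -- If `E.k = 0`, the state after `call` already carries the answer "no" of the first child,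
    -- which takes no iteration.
    rcases hEk.eq_or_lt with h0 | h0
    · exact ⟨none, m1, 0, .leaf _ _ (.neg _ (by simp only [Inst.take]; omega)),
        ⟨hptr, fun _ => hzero h0.symm, fun X hX => (Option.some_ne_none X hX.symm).elim⟩,
        stackEq_of_arr fun _ _ => rfl, rfl, by omega⟩
    · exact hstep _ (hspec.valid_take hI) (by simp only [Inst.take]; omega) (hcall h0)
  obtain ⟨hst6, hsome, hcut, hkeep⟩ := ascend_spec hret5.toPointers (hsaved.stackEq hst5)
  have h2 := Iterates.single hret5.searchCond_ne
  rw [hret5.searchStep_sem] at h2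
  have hit6 := (h1.trans hit5).trans h2
  have hst' := (hst.trans (hst5.mono (Nat.le_succ p))).trans hst6
  generalize ascend.sem m5 = m6 at h2 hit6 hst6 hst' hsome hcut hkeep
  cases r5 with
  | some X =>
    obtain ⟨h17, hX⟩ := hret5.some_mode X rfl
    obtain ⟨hp6, h617, h63⟩ := hsome h17
    refine ⟨_, m6, _, .taken _ _ _ _ _ hB hr5, ⟨hp6, fun h => (Option.some_ne_none _ h).elim,
      fun Y hY => ?_⟩, hst', hit6, by omega⟩
    have hset : insert v (S ∪ D) ∪ X = S ∪ (D ∪ insert v X) := by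
      rw [Finset.union_insert, Finset.insert_union, Finset.union_insert, Finset.union_assoc]
    rw [hset] at hX
    rw [← Option.some.inj hY]
    exact ⟨h617, fun w => (congrFun h63 w).trans (hX w)⟩
  | none =>
    have h17 := hret5.none_mode rfl
    rcases Nat.eq_zero_or_pos E.b with hb | hb
    · obtain ⟨hp6, h617⟩ := hcut h17 hb
      exact ⟨none, m6, _, .cut _ _ _ _ hB hr5 hb, ⟨hp6, fun _ => h617,
        fun X hX => (Option.some_ne_none X hX.symm).elim⟩, hst', hit6, by omega⟩
    · obtain ⟨r, m7, j7, hr7, hret7, hst7, hit7, hj7⟩ :=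
        hstep _ (hspec.valid_keep hI) (by simp only [Inst.keep]; omega) (hkeep h17 hb)
      -- There are `1 + j5 + 1 + j7` iterations; the summand `2` in the bounds for the children pays
      -- for `call` and `ascend` and leaves `2` for the parent.
      exact ⟨_, m7, _, .kept _ _ _ _ _ hB hr5 hb hr7, hret7.map_union, hst'.trans hst7,
        hit6.trans hit7, by omega⟩

/-- Set up the root of the search tree. -/
def initCmd : Cmd := .block [.forN 4 (.store 1 (.reg 4) (.const 1)), zeroArr 4 2, zeroArr 4 3,
  .assign 14 (.const 0), .assign 15 (.const 0),
  .assign 16 (.add (.reg 1) (.add (.reg 1) (.reg 1))), .assign 17 (.const 1)]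

theorem initCmd_spec {k : ℕ} (hG : HoldsGraph m G) (hk : m.reg 1 = k) :
    Calling (initCmd.sem m) G (Inst.root n k) ∅ 0 := by
  simp only [initCmd, Cmd.sem_block_cons, Cmd.sem_block_singleton]
  have hf1 := (Cmd.forN 4 (.store 1 (.reg 4) (.const 1))).frame m
  have hV := Cmd.forN_store_rule (i := 4) (a := 1) (e := .const 1) (m := m) (n := n) (fun _ => 1)
    (by decide) hG.1 fun _ _ _ _ _ => rfl
  generalize (Cmd.forN 4 (.store 1 (.reg 4) (.const 1))).sem m = m1 at hf1 hV ⊢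
  have hG1 := hG.frame hf1 (by decide) (by decide)
  have hV1 : HoldsSet m1 1 (Finset.univ : Finset (Fin n)) := fun v => by simp [hV v]
  have hf2 := (zeroArr 4 2).frame m1
  have hF := zeroArr_holdsSet (m := m1) (i := 4) (a := 2) (by decide) hG1.1
  generalize (zeroArr 4 2).sem m1 = m2 at hf2 hF ⊢
  have hG2 := hG1.frame hf2 (by decide) (by decide)
  have hf3 := (zeroArr 4 3).frame m2
  have hS := zeroArr_holdsSet (m := m2) (i := 4) (a := 3) (by decide) hG2.1
  generalize (zeroArr 4 3).sem m2 = m3 at hf3 hS ⊢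
  have hG3 := hG2.frame hf3 (by decide) (by decide)
  have hk3 : m3.reg 1 = k :=
    (hf3.1 1 (by decide)).trans ((hf2.1 1 (by decide)).trans ((hf1.1 1 (by decide)).trans hk))
  have hV3 := (hV1.frame hf2 (by decide)).frame hf3 (by decide)
  have hF3 := hF.frame hf3 (by decide)
  refine ⟨⟨⟨hG3.1, hG3.2⟩, rfl, (Nat.zero_mul n).symm⟩,
    ⟨congrArg Nat.cast hk3, hV3, hF3⟩, ?_, hS, rfl⟩
  have : m3.reg 1 + (m3.reg 1 + m3.reg 1) = 3 * k := by omega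
  exact this

/-- Output the answer. -/
def finalCmd : Cmd := .assign 2 (.sub (.reg 17) (.const 2))

theorem finalCmd_spec {r : Option (Finset (Fin n))} (h : Returned m G r ∅ p) :
    HoldsAnswer (finalCmd.sem m) r := by
  cases r with
  | none => exact congrArg (· - 2) (h.none_mode rfl)
  | some X =>
    obtain ⟨h17, hX⟩ := h.some_mode X rfl
    rw [Finset.empty_union] at hX
    exact ⟨congrArg (· - 2) h17, hX⟩

/-- The implementation of the truncated algorithm. -/
def searchProg : Prog :=
  .seq initCmd.toProg (.seq (.loop searchCond searchStep.toProg) finalCmd.toProg)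

theorem HoldsAnswer.reg_eq_one_iff {r : Option (Finset (Fin n))} (h : HoldsAnswer m r) :
    m.reg 2 = 1 ↔ r.isSome := by
  cases r with
  | none =>
    have h : m.reg 2 = 0 := h
    simp [h]
  | some X => simpa using h.1

theorem root_valid (G : SimpleGraph (Fin n)) (k : ℕ) : (Inst.root n k).Valid G :=
  ⟨Finset.empty_subset _, acyclicOn_empty⟩

/-- At the root `k + b = 4 * k`, so the main loop makes at most `4 * 2 ^ (4 * k) = 4 * 16 ^ k`
iterations of quadratic cost each. -/
theorem exists_searchProg : ∃ (prog : Prog) (C : ℕ), ∀ (n k : ℕ) (G : SimpleGraph (Fin n))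
    (m : Mem), HoldsGraph m G → m.reg 1 = k →
    ∃ (r : Option (Finset (Fin n))) (t : ℕ) (m' : Mem),
      Run G (Inst.root n k) r ∧ Exec prog m t m' ∧ HoldsAnswer m' r ∧
      (m'.reg 2 = 1 ↔ ∃ X : Finset (Fin n), IsFVS G X ∧ X.card ≤ k) ∧
      t ≤ C * (16 ^ k * (max n 1) ^ 2) := by
  refine ⟨searchProg, initCmd.factor + 4 * (searchStep.factor + 6) + 6 + finalCmd.factor,
    fun n k G m hG hk => ?_⟩
  obtain ⟨s, hs, hsle⟩ := Cmd.exec initCmd (by decide) (by decide) m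
  have hinit := initCmd_spec hG hk
  generalize initCmd.sem m = m1 at hs hinit
  obtain ⟨r, m2, j, hr, hret, -, hit, hj⟩ := run_spec (4 * k) (root_valid G k)
    (by simp only [Inst.root]; push_cast; omega) hinit
  obtain ⟨t, ht, htle⟩ := hit.exec hinit.graph.1 (by
    have := hret.two_le
    have := hret.height
    simp only [searchCond, Expr.eval]
    omega)
  obtain ⟨u, hu, hule⟩ := Cmd.exec finalCmd (by decide) (by decide) m2
  have hans := finalCmd_spec hret
  refine ⟨r, _, _, hr, .seq _ _ _ _ _ _ _ hs (.seq _ _ _ _ _ _ _ ht hu), hans,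
    hans.reg_eq_one_iff.trans hr.root_isSome_iff, ?_⟩
  rw [hG.1, show initCmd.depth = 1 by decide, pow_one] at hsle
  rw [show finalCmd.depth = 0 by decide, pow_zero, mul_one] at hule
  have hN : max n 1 ≤ (max n 1) ^ 2 := Nat.le_self_pow (by decide) _
  have hN1 : 1 ≤ max n 1 := le_max_right n 1
  generalize max n 1 = N at *
  have h16 : 2 ^ (4 * k) = 16 ^ k := by rw [pow_mul]; norm_num
  rw [h16] at hj
  have hk1 : 1 ≤ 16 ^ k := Nat.one_le_pow _ _ (by decide)
  generalize 16 ^ k = K at *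
  have hNK : N ^ 2 ≤ K * N ^ 2 := Nat.le_mul_of_pos_left _ hk1
  calc s + (t + u)
      ≤ initCmd.factor * (K * N ^ 2) + ((4 * K * ((searchStep.factor + 6) * N ^ 2)
          + 6 * (K * N ^ 2)) + finalCmd.factor * (K * N ^ 2)) := by
        refine add_le_add (hsle.trans (Nat.mul_le_mul_left _ (hN.trans hNK))) (add_le_add
          (htle.trans (add_le_add (Nat.mul_le_mul_right _ (by omega)) (by omega)))
          (hule.trans (Nat.le_mul_of_pos_right _ (by omega))))
    _ = _ := by ring

end Main

end NaiveFVS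

theorem mainTheorem2 :
    -- whatever choices are made, the truncated algorithm answers correctly,
    -- and its search tree has depth at most `4k`
    (∀ (n k : ℕ) (G : SimpleGraph (Fin n)),
      (∀ r : Option (Finset (Fin n)), NaiveFVS.Run G (NaiveFVS.Inst.root n k) r →
        (r.isSome ↔ ∃ X : Finset (Fin n), NaiveFVS.IsFVS G X ∧ X.card ≤ k) ∧
        ∀ X : Finset (Fin n), r = some X → NaiveFVS.IsFVS G X ∧ X.card ≤ k) ∧
      ∀ (d : ℕ) (I : NaiveFVS.Inst n),
        NaiveFVS.SearchNode G (NaiveFVS.Inst.root n k) d I → d ≤ 4 * k) ∧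
    -- a node of the search tree can be processed in `O(n ^ 2)` time
    (∃ (node : NaiveFVS.Prog) (C : ℕ), ∀ (n : ℕ) (G : SimpleGraph (Fin n))
      (I : NaiveFVS.Inst n) (m : NaiveFVS.Mem),
      I.Valid G → NaiveFVS.HoldsGraph m G → NaiveFVS.HoldsInst m I →
      ∃ (o : NaiveFVS.Outcome n) (t : ℕ) (m' : NaiveFVS.Mem),
        NaiveFVS.NodeRun G I o ∧ NaiveFVS.Exec node m t m' ∧ NaiveFVS.HoldsOutcome m' o ∧
        t ≤ C * (max n 1) ^ 2) ∧
    -- the whole algorithm can be implemented in `O(16 ^ k * n ^ 2)` time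
    ∃ (prog : NaiveFVS.Prog) (C : ℕ), ∀ (n k : ℕ) (G : SimpleGraph (Fin n)) (m : NaiveFVS.Mem),
      NaiveFVS.HoldsGraph m G → m.reg 1 = k →
      ∃ (r : Option (Finset (Fin n))) (t : ℕ) (m' : NaiveFVS.Mem),
        NaiveFVS.Run G (NaiveFVS.Inst.root n k) r ∧ NaiveFVS.Exec prog m t m' ∧
        NaiveFVS.HoldsAnswer m' r ∧
        (m'.reg 2 = 1 ↔ ∃ X : Finset (Fin n), NaiveFVS.IsFVS G X ∧ X.card ≤ k) ∧
        t ≤ C * (16 ^ k * (max n 1) ^ 2) := by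
  refine ⟨fun n k G => ⟨fun r hr => ⟨hr.root_isSome_iff, fun X hX => ?_⟩, fun d I h => ?_⟩,
    NaiveFVS.exists_nodeProg, NaiveFVS.exists_searchProg⟩
  · subst hX
    exact hr.root_sound
  · have := h.depth_le
    omega
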